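/- Let $M$ be a compact $d$-dimensional $C^{1,1}$-manifold without boundary with a (continuous) Riemannian metric $g$ and Riemannian volume $\mu$, and let $\Omega\subseteq M$ be open. Let $\mathring H^1(\Omega)$ be the closure in $H^1(M)$ of the $C^{1,1}$ functions with support in $\Omega$, with $\|u\|_{\mathring H^1(\Omega)}=\big(\int_\Omega |\nabla u|_g^2\,d\mu\big)^{1/2}$. Nikolskii spaces. For $0<\gamma<1$ and $v_h(x)=v(x+h)$, put $[v]_\gamma=\sup_{h\ne0}|h|^{-\gamma}\|v_h-v\|_{L_2(\mathbb R^d)}$, $\|v\|_{N^\gamma_2(\mathbb R^d)}=\|v\|_{L_2}+[v]_\gamma$ and $\|v\|_{N^{1+\gamma}_2(\mathbb R^d)}=\|v\|_{L_2}+\sum_i\|\partial_iv\|_{L_2}+\max_i[\partial_iv]_\gamma$; let $N^\gamma_{2,0}(\mathbb R^d)$ be the set of $v\in N^\gamma_2(\mathbb R^d)$ with $|h|^{-\gamma}\|v_h-v\|_{L_2}\to0$ as $|h|\to0$ and as $|h|\to\infty$. Fix a finite $C^{1,1}$ atlas $\{(U_i,\kappa_i)\}$ of $M$ and a subordinate $C^{1,1}$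 partition of unity $\{\psi_i\}$. The spaces $N^{1+\gamma}_2(M)$ and $N^\gamma_{2,0}(M)$ consist of the $u\in L_2(M)$ for which all $(\psi_iu)\circ\kappa_i^{-1}$ (extended by zero) belong to the corresponding space on $\mathbb R^d$; the norm is the sum over $i$ of the norms of these functions. A tilde, as in $\tilde N^{1+\gamma}_2(\Omega)$ and $\tilde N^{\gamma}_{2,0}(\Omega)$, denotes the subspace of the functions with support in $\overline\Omega$. Hölder continuity. A linear form $\zeta$ with $H\subseteq\mathrm{dom}\,\zeta\subseteq L_1(\Omega)$ is Hölder continuous of order $\gamma$ in $H$ with constant $C_\zeta$ if there is a $C^{1,1}$ atlas of $M$ such that for each of its charts $(U,\kappa_U)$ and each $\varphi\in C^{1,1}(M)$ with $\operatorname{supp}\varphi\subset U$ there is a constant $C_{U,\varphi}$ with $$|\zeta(z)|\le C_{U,\varphi}\,C_\zeta\,\|u\|_H\,|h|^\gamma,\qquad z=\varphi(u-u_h),$$ for all $u\in H$ and all $h\in\mathbb R^d$ with $|h|<\mathrm{dist}(\operatorname{supp}\varphi,\partial U)$ (distance in the chart) for which $z\in H$. Here $u_h$ is the shift of $u$ by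 $h$ in the chart. Let $0<s<1$. For $f\in[\tilde N^{1-s}_{2,0}(\Omega)]'$ let $\tau(f,v)=f(v)$ be the action of $f$ on $v$, and for $f\in L_2(\Omega)$ let $\tau(f,v)=\int_\Omega fv\,d\mu$. Then: 1. for every $f\in[\tilde N^{1-s}_{2,0}(\Omega)]'$ and every $t>0$ with $s+t\le1$, the form $\tau(f,\cdot)$ is Hölder continuous of order $s+t$ in $\tilde N^{1+t}_2(\Omega)$ with constant $\|f\|_{[\tilde N^{1-s}_{2,0}(\Omega)]'}$; 2. for every $f\in[\tilde N^{1-s}_{2,0}(\Omega)]'$, the form $\tau(f,\cdot)$ is Hölder continuous of order $s$ in $\mathring H^1(\Omega)$ with constant $\|f\|_{[\tilde N^{1-s}_{2,0}(\Omega)]'}$; 3. for every $f\in L_2(\Omega)$, the form $\tau(f,\cdot)$ is Hölder continuous of order $1$ in $\mathring H^1(\Omega)$ with constant $\|f\|_{L_2(\Omega)}$. In each case the constants $C_{U,\varphi}$ do not depend on $f$, and one atlas serves for all three claims and all $s,t,f$. -/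

import Mathlib

open Set Filter Topology MeasureTheory
open scoped ENNReal NNReal

noncomputable section

namespace NikolskiiForms

/-! ### Compact `C^{1,1}` Riemannian manifolds -/

/-- The model space `ℝ^d` with its Euclidean norm. -/
abbrev Coord (d : ℕ) : Type := EuclideanSpace ℝ (Fin d)

/-- The standard basis vectors of `ℝ^d`. -/
def stdVec {d : ℕ} (i : Fin d) : Coord d := EuclideanSpace.single i (1 : ℝ)

/-- Coordinate maps: homeomorphisms from open subsets of `M` onto open subsets of `ℝ^d`. -/
abbrev Chart (d : ℕ) (M : Type*) [TopologicalSpace M] := OpenPartialHomeomorph M (Coord d)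

/-- `f` is of class `C^{1,1}` on the open set `s`: it is continuously differentiable there and its
derivative is locally Lipschitz. -/
def C11On {d : ℕ} {F : Type*} [NormedAddCommGroup F] [NormedSpace ℝ F]
    (f : Coord d → F) (s : Set (Coord d)) : Prop :=
  ContDiffOn ℝ 1 f s ∧ LocallyLipschitzOn s (fderiv ℝ f)

section Manifold

variable {d : ℕ} {M : Type*} [TopologicalSpace M]

/-- Both transition maps between two charts are of class `C^{1,1}`. -/
def C11Compatible (e e' : Chart d M) : Prop :=
  C11On (e' ∘ e.symm) (e.symm.trans e').source ∧ C11On (e ∘ e'.symm) (e'.symm.trans e).source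

variable (d M) in
/-- The charts of the given atlas define a `C^{1,1}` structure (without boundary) on `M`. -/
def IsC11Manifold [ChartedSpace (Coord d) M] : Prop :=
  ∀ e ∈ atlas (Coord d) M, ∀ e' ∈ atlas (Coord d) M, C11Compatible e e'

variable (d M) in
/-- The maximal `C^{1,1}` atlas: all charts which are `C^{1,1}`-compatible with the given atlas. -/
def c11Charts [ChartedSpace (Coord d) M] : Set (Chart d M) :=
  {e | ∀ e' ∈ atlas (Coord d) M, C11Compatible e e'}

variable [ChartedSpace (Coord d) M]

/-- An atlas of the `C^{1,1}` manifold `M`: admissible charts whose domains cover `M`. -/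
def IsC11Atlas (𝒰 : Set (Chart d M)) : Prop :=
  𝒰 ⊆ c11Charts d M ∧ ∀ x : M, ∃ e ∈ 𝒰, x ∈ e.source

variable (d) in
/-- Functions of class `C^{1,1}(M)`. -/
def IsC11Function (φ : M → ℝ) : Prop :=
  ∀ e ∈ c11Charts d M, C11On (φ ∘ e.symm) e.target

variable (d M) in
/-- A continuous Riemannian metric on a `C^{1,1}` manifold, given by its coordinate
expressions `g_e(y)(v, w) = g_{ij}(y) v^i w^j` in all admissible charts `e`, which are related by
the transformation law of covariant 2-tensors. (The values of `form e` for inadmissible `e`, and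
those outside `e.target`, play no role.) -/
structure RiemMetric where
  form : Chart d M → Coord d → (Coord d →L[ℝ] Coord d →L[ℝ] ℝ)
  symm : ∀ e ∈ c11Charts d M, ∀ y ∈ e.target, ∀ v w, form e y v w = form e y w v
  pos : ∀ e ∈ c11Charts d M, ∀ y ∈ e.target, ∀ v, v ≠ 0 → 0 < form e y v v
  cont : ∀ e ∈ c11Charts d M, ContinuousOn (form e) e.target
  transform : ∀ e ∈ c11Charts d M, ∀ e' ∈ c11Charts d M, ∀ y ∈ (e.symm.trans e').source, ∀ v w,
    form e y v w = form e' (e' (e.symm y))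
      (fderiv ℝ (e' ∘ e.symm) y v) (fderiv ℝ (e' ∘ e.symm) y w)

/-- The Gram matrix `(B_{ij})` of a bilinear form on `ℝ^d`. -/
def gram (B : Coord d →L[ℝ] Coord d →L[ℝ] ℝ) : Matrix (Fin d) (Fin d) ℝ :=
  Matrix.of fun i j => B (stdVec i) (stdVec j)

/-- The inverse form on covectors: `B^{ij} ξ_i ξ_j`, where `(B^{ij})` is the inverse of the Gram
matrix of `B`. -/
def coSq (B : Coord d →L[ℝ] Coord d →L[ℝ] ℝ) (ξ : Coord d →L[ℝ] ℝ) : ℝ :=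
  (fun i => ξ (stdVec i)) ⬝ᵥ Matrix.mulVec (gram B)⁻¹ (fun i => ξ (stdVec i))

/-- `G_x(ξ, ξ)` for a covector `ξ` at `x`. As for Mathlib's tangent spaces, a (co)vector at `x` is
represented by its coordinates in the preferred chart `chartAt _ x`; the value does not depend on
the chart. -/
def RiemMetric.cometric (g : RiemMetric d M) (x : M) (ξ : Coord d →L[ℝ] ℝ) : ℝ :=
  coSq (g.form (chartAt (Coord d) x) (chartAt (Coord d) x x)) ξ

/-- The Riemannian volume of the domain of a chart: the measure `√(det g_{ij}) dy` on `e.target`,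
transported to `M`. -/
def RiemMetric.chartVolume [MeasurableSpace M] (g : RiemMetric d M) (e : Chart d M) : Measure M :=
  Measure.map e.symm ((volume.restrict e.target).withDensity
    fun y => ENNReal.ofReal (Real.sqrt (gram (g.form e y)).det))

/-- The Riemannian volume `μ`: the least measure on `M` that dominates the volumes in all
admissible charts. By the change of variables formula the latter agree on overlaps, so that this is
the measure which is given by `√(det g_{ij}) dy` in each admissible chart. -/
def RiemMetric.vol [MeasurableSpace M] (g : RiemMetric d M) : Measure M :=
  ⨆ e ∈ c11Charts d M, g.chartVolume e

/-! ### Weak derivatives and `H̊¹(Ω)` -/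

/-- `w` is the weak differential of `v` on the open set `s ⊆ ℝ^d`. -/
def HasWeakGradOn (v : Coord d → ℝ) (w : Coord d → (Coord d →L[ℝ] ℝ)) (s : Set (Coord d)) :
    Prop :=
  LocallyIntegrableOn v s volume ∧ LocallyIntegrableOn w s volume ∧
    ∀ η : Coord d → ℝ, ContDiff ℝ (⊤ : ℕ∞) η → HasCompactSupport η → tsupport η ⊆ s →
      ∀ a : Coord d, ∫ x in s, v x * fderiv ℝ η x a = - ∫ x in s, w x a * η x

/-- The coordinates in the chart `e` of a field of covectors on `M`. -/
def covectorIn (e : Chart d M) (ξ : M → (Coord d →L[ℝ] ℝ)) (y : Coord d) : Coord d →L[ℝ] ℝ :=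
  (ξ (e.symm y)).comp (fderiv ℝ (chartAt (Coord d) (e.symm y) ∘ e.symm) y)

/-- `ξ` is the weak differential of `u` on `M`: it is so in every admissible chart. -/
def HasWeakDifferential (u : M → ℝ) (ξ : M → (Coord d →L[ℝ] ℝ)) : Prop :=
  ∀ e ∈ c11Charts d M, HasWeakGradOn (u ∘ e.symm) (covectorIn e ξ) e.target

open Classical in
/-- The weak differential of `u` (unique almost everywhere; zero if there is none). -/
def weakDifferential (u : M → ℝ) : M → (Coord d →L[ℝ] ℝ) :=
  if h : ∃ ξ : M → (Coord d →L[ℝ] ℝ), HasWeakDifferential u ξ then h.choose else 0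

/-- The classical differential, in the coordinates of the preferred charts. -/
def classicalDifferential (φ : M → ℝ) (x : M) : Coord d →L[ℝ] ℝ :=
  fderiv ℝ (φ ∘ (chartAt (Coord d) x).symm) (chartAt (Coord d) x x)

/-- `∫_S G(ξ, ξ) dμ` for a field of covectors. -/
def RiemMetric.energy [MeasurableSpace M] (g : RiemMetric d M) (S : Set M)
    (ξ : M → (Coord d →L[ℝ] ℝ)) : ℝ≥0∞ :=
  ∫⁻ x in S, ENNReal.ofReal (g.cometric x (ξ x)) ∂g.vol

/-- The space `H̊¹(Ω)`: the closure, in the norm of `H¹(M)`, of the `C^{1,1}` functions with support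
in `Ω`. (`M` is compact in all that follows.) -/
def RiemMetric.H10 [MeasurableSpace M] (g : RiemMetric d M) (Ω : Set M) : Set (M → ℝ) :=
  {u | MemLp u 2 g.vol ∧ (∃ ξ : M → (Coord d →L[ℝ] ℝ), HasWeakDifferential u ξ) ∧
    ∀ ε : ℝ≥0∞, 0 < ε → ∃ φ : M → ℝ, IsC11Function d φ ∧ tsupport φ ⊆ Ω ∧
      eLpNorm (u - φ) 2 g.vol < ε ∧
      g.energy univ (fun x => weakDifferential u x - classicalDifferential φ x) < ε}

/-- The norm `(∫_Ω G(∇u, ∇u) dμ)^{1/2}` of `H̊¹(Ω)`. -/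
def RiemMetric.h10Norm [MeasurableSpace M] (g : RiemMetric d M) (Ω : Set M) (u : M → ℝ) : ℝ :=
  Real.sqrt (g.energy Ω (weakDifferential u)).toReal

end Manifold

/-! ### Nikolskii spaces on `ℝ^d` -/

section Euclidean

variable {d : ℕ}

/-- `‖v_h - v‖_{L_2(ℝ^d)} / |h|^γ`, where `v_h(x) = v(x + h)`. -/
def nikQuot (γ : ℝ) (v : Coord d → ℝ) (h : Coord d) : ℝ≥0∞ :=
  eLpNorm (fun x => v (x + h) - v x) 2 volume / ENNReal.ofReal (‖h‖ ^ γ)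

/-- `sup_{h ≠ 0} ‖v_h - v‖_{L_2(ℝ^d)} / |h|^γ`. -/
def nikSemi (γ : ℝ) (v : Coord d → ℝ) : ℝ≥0∞ := ⨆ (h : Coord d) (_ : h ≠ 0), nikQuot γ v h

/-- The norm of `N^γ_2(ℝ^d)`, `0 < γ < 1`. -/
def nikNorm (γ : ℝ) (v : Coord d → ℝ) : ℝ≥0∞ := eLpNorm v 2 volume + nikSemi γ v

/-- The space `N^γ_{2,0}(ℝ^d)`, `0 < γ < 1`. -/
def MemNikZero (γ : ℝ) (v : Coord d → ℝ) : Prop :=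
  AEStronglyMeasurable v volume ∧ nikNorm γ v < ∞ ∧
    Tendsto (nikQuot γ v) (𝓝[≠] 0) (𝓝 0) ∧ Tendsto (nikQuot γ v) (Bornology.cobounded _) (𝓝 0)

open Classical in
/-- The weak differential on `ℝ^d` (unique almost everywhere; zero if there is none). -/
def weakGrad (v : Coord d → ℝ) : Coord d → (Coord d →L[ℝ] ℝ) :=
  if h : ∃ w : Coord d → (Coord d →L[ℝ] ℝ), HasWeakGradOn v w univ then h.choose else 0

/-- The weak partial derivative `∂_i v`. -/
def weakPartial (i : Fin d) (v : Coord d → ℝ) : Coord d → ℝ := fun x => weakGrad v x (stdVec i)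

/-- The norm of `N^{1+γ}_2(ℝ^d)`, `0 < γ < 1`. -/
def nikNormOne (γ : ℝ) (v : Coord d → ℝ) : ℝ≥0∞ :=
  (eLpNorm v 2 volume + ∑ i : Fin d, eLpNorm (weakPartial i v) 2 volume) +
    ⨆ i : Fin d, nikSemi γ (weakPartial i v)

/-- The space `N^{1+γ}_2(ℝ^d)`, `0 < γ < 1`. -/
def MemNikOne (γ : ℝ) (v : Coord d → ℝ) : Prop :=
  AEStronglyMeasurable v volume ∧
    (∃ w : Coord d → (Coord d →L[ℝ] ℝ), HasWeakGradOn v w univ) ∧ nikNormOne γ v < ∞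

lemma nikQuot_zero (γ : ℝ) (h : Coord d) : nikQuot γ (0 : Coord d → ℝ) h = 0 := by
  simp [nikQuot]

lemma nikQuot_add_le (γ : ℝ) {v w : Coord d → ℝ} (hv : AEStronglyMeasurable v volume)
    (hw : AEStronglyMeasurable w volume) (h : Coord d) :
    nikQuot γ (v + w) h ≤ nikQuot γ v h + nikQuot γ w h := by
  have key : ∀ {f : Coord d → ℝ}, AEStronglyMeasurable f volume →
      AEStronglyMeasurable (fun x => f (x + h) - f x) volume := fun hf =>
    (hf.comp_quasiMeasurePreserving
      (measurePreserving_add_right volume h).quasiMeasurePreserving).sub hf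
  unfold nikQuot
  rw [← ENNReal.add_div]
  gcongr
  refine le_trans (le_of_eq ?_) (eLpNorm_add_le (key hv) (key hw) (by norm_num))
  congr 1
  ext x
  simp only [Pi.add_apply]
  ring

lemma nikQuot_smul (γ c : ℝ) (v : Coord d → ℝ) (h : Coord d) :
    nikQuot γ (c • v) h = ‖c‖ₑ * nikQuot γ v h := by
  unfold nikQuot
  rw [← mul_div_assoc, ← eLpNorm_const_smul]
  congr 2
  ext x
  simp only [Pi.smul_apply, smul_eq_mul]
  ring

lemma nikNorm_zero (γ : ℝ) : nikNorm γ (0 : Coord d → ℝ) = 0 := by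
  simp [nikNorm, nikSemi, nikQuot_zero]

lemma nikNorm_add_le (γ : ℝ) {v w : Coord d → ℝ} (hv : AEStronglyMeasurable v volume)
    (hw : AEStronglyMeasurable w volume) : nikNorm γ (v + w) ≤ nikNorm γ v + nikNorm γ w := by
  have h1 : eLpNorm (v + w) 2 volume ≤ eLpNorm v 2 volume + eLpNorm w 2 volume :=
    eLpNorm_add_le hv hw (by norm_num)
  have h2 : nikSemi γ (v + w) ≤ nikSemi γ v + nikSemi γ w := by
    refine iSup₂_le fun h hh => (nikQuot_add_le γ hv hw h).trans ?_
    exact add_le_add (le_iSup₂ (f := fun h (_ : h ≠ 0) => nikQuot γ v h) h hh)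
      (le_iSup₂ (f := fun h (_ : h ≠ 0) => nikQuot γ w h) h hh)
  calc nikNorm γ (v + w) ≤ _ := add_le_add h1 h2
    _ = _ := by unfold nikNorm; ring

lemma nikNorm_smul (γ c : ℝ) (v : Coord d → ℝ) : nikNorm γ (c • v) = ‖c‖ₑ * nikNorm γ v := by
  simp only [nikNorm, nikSemi, nikQuot_smul, eLpNorm_const_smul, mul_add, ENNReal.mul_iSup]

lemma MemNikZero.zero (γ : ℝ) : MemNikZero γ (0 : Coord d → ℝ) := by
  have h : nikQuot γ (0 : Coord d → ℝ) = fun _ => 0 := funext (nikQuot_zero γ)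
  refine ⟨aestronglyMeasurable_zero, by simp [nikNorm_zero], ?_, ?_⟩ <;>
  · rw [h]; exact tendsto_const_nhds

lemma MemNikZero.add {γ : ℝ} {v w : Coord d → ℝ} (hv : MemNikZero γ v) (hw : MemNikZero γ w) :
    MemNikZero γ (v + w) := by
  have key : ∀ {l : Filter (Coord d)}, Tendsto (nikQuot γ v) l (𝓝 0) →
      Tendsto (nikQuot γ w) l (𝓝 0) → Tendsto (nikQuot γ (v + w)) l (𝓝 0) := fun h1 h2 =>
    tendsto_of_tendsto_of_tendsto_of_le_of_le tendsto_const_nhds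
      (by simpa using h1.add h2) (fun _ => bot_le) (nikQuot_add_le γ hv.1 hw.1)
  exact ⟨hv.1.add hw.1, (nikNorm_add_le γ hv.1 hw.1).trans_lt
    (ENNReal.add_lt_top.2 ⟨hv.2.1, hw.2.1⟩), key hv.2.2.1 hw.2.2.1, key hv.2.2.2 hw.2.2.2⟩

lemma MemNikZero.smul {γ : ℝ} {v : Coord d → ℝ} (c : ℝ) (hv : MemNikZero γ v) :
    MemNikZero γ (c • v) := by
  have key : ∀ {l : Filter (Coord d)}, Tendsto (nikQuot γ v) l (𝓝 0) →
      Tendsto (nikQuot γ (c • v)) l (𝓝 0) := fun h1 => by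
    rw [funext (nikQuot_smul γ c v)]
    simpa using ENNReal.Tendsto.const_mul (a := ‖c‖ₑ) h1 (Or.inr enorm_ne_top)
  refine ⟨hv.1.const_smul c, ?_, key hv.2.2.1, key hv.2.2.2⟩
  rw [nikNorm_smul]
  exact ENNReal.mul_lt_top enorm_lt_top hv.2.1

end Euclidean

/-! ### Nikolskii spaces on `M` and their dual spaces -/

section Nikolskii

variable {d : ℕ} {M : Type*} [TopologicalSpace M] [ChartedSpace (Coord d) M]

variable (d M) in
/-- A finite atlas of the `C^{1,1}` manifold `M` with a subordinate `C^{1,1}` partition of unity. -/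
structure FiniteAtlas where
  n : ℕ
  chart : Fin n → Chart d M
  chart_mem : ∀ i, chart i ∈ c11Charts d M
  ψ : PartitionOfUnity (Fin n) M
  ψ_c11 : ∀ i, IsC11Function d (ψ i)
  subordinate : ψ.IsSubordinate fun i => (chart i).source

/-- The function `(ψ_i u) ∘ κ_i⁻¹`, extended by zero to `ℝ^d`. -/
def FiniteAtlas.piece (A : FiniteAtlas d M) (i : Fin A.n) (u : M → ℝ) : Coord d → ℝ :=
  (A.chart i).target.indicator fun y => A.ψ i ((A.chart i).symm y) * u ((A.chart i).symm y)

lemma FiniteAtlas.piece_zero (A : FiniteAtlas d M) (i : Fin A.n) : A.piece i 0 = 0 := by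
  ext y; simp [piece]

lemma FiniteAtlas.piece_add (A : FiniteAtlas d M) (i : Fin A.n) (u v : M → ℝ) :
    A.piece i (u + v) = A.piece i u + A.piece i v := by
  ext y
  by_cases hy : y ∈ (A.chart i).target <;> simp [piece, hy, mul_add]

lemma FiniteAtlas.piece_smul (A : FiniteAtlas d M) (i : Fin A.n) (c : ℝ) (u : M → ℝ) :
    A.piece i (c • u) = c • A.piece i u := by
  ext y
  by_cases hy : y ∈ (A.chart i).target <;> simp [piece, hy, mul_left_comm]

variable [MeasurableSpace M]

/-- The space `Ñ^{1+γ}_2(Ω)` of all `u ∈ N^{1+γ}_2(M)` with support in the closure of `Ω`. -/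
def nikTildeOne (g : RiemMetric d M) (A : FiniteAtlas d M) (γ : ℝ) (Ω : Set M) : Set (M → ℝ) :=
  {u | MemLp u 2 g.vol ∧ (∀ᵐ x ∂g.vol, x ∉ closure Ω → u x = 0) ∧
    ∀ i, MemNikOne γ (A.piece i u)}

/-- The norm of `Ñ^{1+γ}_2(Ω)`. -/
def nikTildeOneNorm (A : FiniteAtlas d M) (γ : ℝ) (u : M → ℝ) : ℝ :=
  ∑ i, (nikNormOne γ (A.piece i u)).toReal

/-- The space `Ñ^γ_{2,0}(Ω)` of all `u ∈ N^γ_{2,0}(M)` with support in the closure of `Ω`, as a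
space of functions. -/
def nikTildeZero (g : RiemMetric d M) (A : FiniteAtlas d M) (γ : ℝ) (Ω : Set M) :
    Submodule ℝ (M → ℝ) where
  carrier := {u | MemLp u 2 g.vol ∧ (∀ᵐ x ∂g.vol, x ∉ closure Ω → u x = 0) ∧
    ∀ i, MemNikZero γ (A.piece i u)}
  zero_mem' := ⟨MemLp.zero, by simp, fun i => by rw [A.piece_zero]; exact MemNikZero.zero γ⟩
  add_mem' := by
    rintro u v ⟨hu, hu', hu''⟩ ⟨hv, hv', hv''⟩
    refine ⟨hu.add hv, ?_, fun i => by rw [A.piece_add]; exact (hu'' i).add (hv'' i)⟩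
    filter_upwards [hu', hv'] with x h1 h2 hx
    simp [h1 hx, h2 hx]
  smul_mem' := by
    rintro c u ⟨hu, hu', hu''⟩
    refine ⟨hu.const_smul c, ?_, fun i => by rw [A.piece_smul]; exact (hu'' i).smul c⟩
    filter_upwards [hu'] with x h1 hx
    simp [h1 hx]

/-- `Ñ^γ_{2,0}(Ω)` as a seminormed space. Its elements are functions; functions that agree almost
everywhere have distance zero, so that the dual space is the same as that of the space of classes
of functions. -/
def NikTildeZero (g : RiemMetric d M) (A : FiniteAtlas d M) (γ : ℝ) (Ω : Set M) : Type _ :=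
  nikTildeZero g A γ Ω

section Norm

variable (g : RiemMetric d M) (A : FiniteAtlas d M) (γ : ℝ) (Ω : Set M)

instance : AddCommGroup (NikTildeZero g A γ Ω) :=
  inferInstanceAs (AddCommGroup (nikTildeZero g A γ Ω))

instance : Module ℝ (NikTildeZero g A γ Ω) :=
  inferInstanceAs (Module ℝ (nikTildeZero g A γ Ω))

/-- An element of `Ñ^γ_{2,0}(Ω)`, given as a function on `M`. -/
def NikTildeZero.of : nikTildeZero g A γ Ω ≃ₗ[ℝ] NikTildeZero g A γ Ω :=
  LinearEquiv.refl ℝ (nikTildeZero g A γ Ω)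

/-- The norm `∑_i ‖ψ_i u‖_{N^γ_2}`. -/
instance : Norm (NikTildeZero g A γ Ω) where
  norm u := ∑ i, (nikNorm γ (A.piece i ((NikTildeZero.of g A γ Ω).symm u).1)).toReal

lemma NikTildeZero.norm_def (u : nikTildeZero g A γ Ω) :
    ‖NikTildeZero.of g A γ Ω u‖ = ∑ i, (nikNorm γ (A.piece i u.1)).toReal := rfl

lemma NikTildeZero.core : SeminormedSpace.Core ℝ (NikTildeZero g A γ Ω) where
  norm_nonneg u := Finset.sum_nonneg fun _ _ => ENNReal.toReal_nonneg
  norm_smul c u := by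
    change ‖NikTildeZero.of g A γ Ω (c • (NikTildeZero.of g A γ Ω).symm u)‖ =
      ‖c‖ * ‖NikTildeZero.of g A γ Ω ((NikTildeZero.of g A γ Ω).symm u)‖
    rw [norm_def, norm_def, Finset.mul_sum]
    refine Finset.sum_congr rfl fun i _ => ?_
    rw [Submodule.coe_smul, A.piece_smul, nikNorm_smul, ENNReal.toReal_mul, toReal_enorm]
  norm_triangle u v := by
    set u' := (NikTildeZero.of g A γ Ω).symm u
    set v' := (NikTildeZero.of g A γ Ω).symm v
    change ‖NikTildeZero.of g A γ Ω (u' + v')‖ ≤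
      ‖NikTildeZero.of g A γ Ω u'‖ + ‖NikTildeZero.of g A γ Ω v'‖
    rw [norm_def, norm_def, norm_def, ← Finset.sum_add_distrib]
    refine Finset.sum_le_sum fun i _ => ?_
    have hu := u'.2.2.2 i
    have hv := v'.2.2.2 i
    rw [Submodule.coe_add, A.piece_add, ← ENNReal.toReal_add hu.2.1.ne hv.2.1.ne]
    exact ENNReal.toReal_mono (ENNReal.add_lt_top.2 ⟨hu.2.1, hv.2.1⟩).ne
      (nikNorm_add_le γ hu.1 hv.1)

instance : SeminormedAddCommGroup (NikTildeZero g A γ Ω) :=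
  SeminormedAddCommGroup.ofCore (NikTildeZero.core g A γ Ω)

instance : NormedSpace ℝ (NikTildeZero g A γ Ω) where
  norm_smul_le c u := ((NikTildeZero.core g A γ Ω).norm_smul c u).le

end Norm

/-! ### Linear forms and their Hölder continuity -/

/-- The form `τ(f, ·)` of a functional `f ∈ [Ñ^γ_{2,0}(Ω)]'`: the action of `f`, with domain
`Ñ^γ_{2,0}(Ω)`. -/
def tauDual (g : RiemMetric d M) (A : FiniteAtlas d M) (γ : ℝ) (Ω : Set M)
    (f : StrongDual ℝ (NikTildeZero g A γ Ω)) : (M → ℝ) →ₗ.[ℝ] ℝ where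
  domain := nikTildeZero g A γ Ω
  toFun := (f : NikTildeZero g A γ Ω →ₗ[ℝ] ℝ) ∘ₗ (NikTildeZero.of g A γ Ω).toLinearMap

/-- The square integrable functions on a measure space. -/
def sqIntegrable {X : Type*} [MeasurableSpace X] (ν : Measure X) : Submodule ℝ (X → ℝ) where
  carrier := {v | MemLp v 2 ν}
  zero_mem' := MemLp.zero
  add_mem' hu hv := hu.add hv
  smul_mem' c _ hu := hu.const_smul c

/-- The form `τ(f, v) = ∫_Ω f v dμ` of a function `f ∈ L_2(Ω)`, with domain `L_2(Ω)`. -/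
def tauL2 (g : RiemMetric d M) (Ω : Set M) (f : Lp ℝ 2 (g.vol.restrict Ω)) :
    (M → ℝ) →ₗ.[ℝ] ℝ where
  domain := sqIntegrable (g.vol.restrict Ω)
  toFun :=
    { toFun := fun v => ∫ x in Ω, f x * v.1 x ∂g.vol
      map_add' := fun u v => by
        have hu : Integrable (fun x => f x * u.1 x) (g.vol.restrict Ω) :=
          (Lp.memLp f).integrable_mul u.2
        have hv : Integrable (fun x => f x * v.1 x) (g.vol.restrict Ω) :=
          (Lp.memLp f).integrable_mul v.2
        rw [← integral_add hu hv]
        simp [mul_add]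
      map_smul' := fun c u => by
        simp [mul_left_comm, integral_const_mul] }

/-- The distance from the support of `φ` to the boundary of the domain of the chart `e`, measured
in the coordinates of `e`. -/
def chartDist (e : Chart d M) (φ : M → ℝ) : ℝ≥0∞ :=
  ⨅ y ∈ e '' tsupport φ, Metric.infEDist y (frontier e.target)

/-- The function `φ (u - u_h)`, where `u_h` is the shift of `u` by `h` in the coordinates of `e`. -/
def shiftDiff (e : Chart d M) (φ u : M → ℝ) (h : Coord d) : M → ℝ :=
  fun x => φ x * (u x - u (e.symm (e x + h)))

/-- The linear form `ζ` is Hölder continuous of order `γ` in the space `H ⊆ dom ζ ⊆ L_1(Ω)` with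
norm `nrm`, with respect to the atlas `𝒰`, with the constants `K e φ` (which depend on the chart and
on the cut-off function) and `Cζ`. -/
def IsHolderForm (g : RiemMetric d M) (Ω : Set M) (𝒰 : Set (Chart d M))
    (K : Chart d M → (M → ℝ) → ℝ≥0) (γ : ℝ) (H : Set (M → ℝ)) (nrm : (M → ℝ) → ℝ)
    (ζ : (M → ℝ) →ₗ.[ℝ] ℝ) (Cζ : ℝ) : Prop :=
  H ⊆ ζ.domain ∧ (∀ v ∈ ζ.domain, IntegrableOn v Ω g.vol) ∧
    ∀ e ∈ 𝒰, ∀ φ : M → ℝ, IsC11Function d φ → tsupport φ ⊆ e.source →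
      ∀ u ∈ H, ∀ h : Coord d, ‖h‖ₑ < chartDist e φ → shiftDiff e φ u h ∈ H →
        ∀ hz : shiftDiff e φ u h ∈ ζ.domain,
          |ζ ⟨shiftDiff e φ u h, hz⟩| ≤ K e φ * Cζ * nrm u * ‖h‖ ^ γ

end Nikolskii

end NikolskiiForms

end

open NikolskiiForms

/-! The difference z = φ(u - u_h) is estimated in the norm of Ñ^{1-s}_2 for the functionals, and in
L_2 for the last claim. The form then enters only through its norm, so that no constant depends on
f.

Write δ_h v = v(· + h) - v. For U in N^{1+t}_2(ℝ^d), the function δ_h U is an average of ∇U · h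
along segments, and hence δ_k δ_h U is of order |h| |k|^t in L_2. Differences commute, so it is also
of order |k| |h|^t. The second bound is the better one for |k| ≤ |h|, the first one otherwise, and
together they give |h|^{s+t} |k|^{1-s} as long as s + t ≤ 1. A cut-off function only adds a harmless
Leibniz term. This is `DiffBound.nikBound_mul_fwdShift`, the source of the order s + t. For u in H̊¹
there is no bound on second differences. Still, φ δ_h u has L_2 norm of order |h| and a bounded
gradient, so its k-differences are of order min(|h|, |k|) ≤ |h|^s |k|^{1-s}
(`nikBound_of_lipschitz_shift`). The L_2 bound of order |h| alone yields the third claim.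

On the manifold, the Nikolskii norms only see the functions ψ_i u in fixed charts. The atlas of the
theorem consists of the charts `smallChart`, in which ψ_j is bounded from below. There u = ψ_j⁻¹
(ψ_j u), the reciprocal extends to a C^{1,1} multiplier on ℝ^d (`CompactC11.exists_inv`), and
multipliers preserve the bounds on differences (`DiffBound.mul`). The images of these charts are
relatively compact in those of the original charts, which makes the metric uniformly comparable with
the Euclidean one. Conversely, z is controlled in one chart while its norm is computed in all of
them. A coordinate change T turns the shift by k into the displacement T(y + k) - T(y), which varies
with y. It is handled by averaging over all shifts in a ball (`lintegral_comp_sub_comp_le`,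
`exists_nikBound_transfer`).

The estimates in H̊¹ are proved for C^{1,1} functions by the fundamental theorem of calculus and
pass to L_2 limits. The approximants have support in Ω, so that the energy over Ω controls their
whole energy. -/

set_option linter.unusedSectionVars false

/-! ### Squares of L_2 norms -/

section Squares

variable {X : Type*} [MeasurableSpace X] {μ : Measure X}

lemma eLpNorm_two_sq_eq_lintegral {F : Type*} [NormedAddCommGroup F] (f : X → F) :
    eLpNorm f 2 μ ^ 2 = ∫⁻ x, ‖f x‖ₑ ^ 2 ∂μ := by
  have := eLpNorm_nnreal_pow_eq_lintegral (f := f) (μ := μ) (p := 2) (by norm_num)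
  simpa using this

lemma eLpNorm_two_le_iff {F : Type*} [NormedAddCommGroup F] {f : X → F} {c : ℝ≥0∞} :
    eLpNorm f 2 μ ≤ c ↔ ∫⁻ x, ‖f x‖ₑ ^ 2 ∂μ ≤ c ^ 2 := by
  rw [← eLpNorm_two_sq_eq_lintegral]
  exact (ENNReal.pow_le_pow_left_iff two_ne_zero).symm

lemma sq_lintegral_le_lintegral_sq [IsProbabilityMeasure μ] {f : X → ℝ≥0∞}
    (hf : AEMeasurable f μ) : (∫⁻ x, f x ∂μ) ^ 2 ≤ ∫⁻ x, f x ^ 2 ∂μ := by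
  have h := ENNReal.lintegral_mul_le_Lp_mul_Lq μ (Real.HolderConjugate.two_two) hf
    (aemeasurable_const (b := (1 : ℝ≥0∞)))
  simp only [Pi.mul_apply, mul_one, lintegral_const, measure_univ, ENNReal.rpow_ofNat, one_pow,
    ENNReal.one_rpow] at h
  calc _ ≤ ((∫⁻ x, f x ^ 2 ∂μ) ^ (1 / 2 : ℝ)) ^ 2 := by gcongr
    _ = _ := by rw [← ENNReal.rpow_natCast, ← ENNReal.rpow_mul]; norm_num

end Squares

/-! ### L_2 bounds and Nikolskii norms on ℝ^d -/

section Euclidean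

variable {d : ℕ}

/-- Each section in the second variable is a translation, so null sets pull back to null sets. This
allows functions defined only almost everywhere to be composed with (x, θ) ↦ x + θh. -/
lemma quasiMeasurePreserving_add_prod {Y : Type*} [MeasurableSpace Y] {ℓ : Y → Coord d}
    (hℓ : Measurable ℓ) (ν : Measure Y) [SFinite ν] :
    Measure.QuasiMeasurePreserving (fun p : Coord d × Y => p.1 + ℓ p.2)
      ((volume : Measure (Coord d)).prod ν) volume := by
  have hm : Measurable (fun p : Coord d × Y => p.1 + ℓ p.2) := by fun_prop
  refine ⟨hm, Measure.AbsolutelyContinuous.mk fun s hs h0 => ?_⟩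
  rw [Measure.map_apply hm hs, Measure.prod_apply_symm (hm hs)]
  simp only [← preimage_comp]
  have : ∀ y : Y, volume ((fun x : Coord d => x + ℓ y) ⁻¹' s) = 0 := fun y => by
    rw [measure_preimage_add_right, h0]
  simp [Function.comp_def, this]

/-- Averages along segments do not increase the `L_2` norm. -/
lemma eLpNorm_le_of_le_segment_average {F G : Type*} [NormedAddCommGroup F]
    [NormedAddCommGroup G] {D : Coord d → F} {q : Coord d → G} {h : Coord d}
    (hq : AEStronglyMeasurable q volume)
    (hD : ∀ᵐ x, ‖D x‖ₑ ≤ ∫⁻ θ in Ioc (0 : ℝ) 1, ‖q (x + θ • h)‖ₑ) :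
    eLpNorm D 2 volume ≤ eLpNorm q 2 volume := by
  have hprob : IsProbabilityMeasure (volume.restrict (Ioc (0 : ℝ) 1)) := ⟨by simp⟩
  have hmeas : AEMeasurable (fun p : Coord d × ℝ => ‖q (p.1 + p.2 • h)‖ₑ)
      ((volume : Measure (Coord d)).prod (volume.restrict (Ioc (0 : ℝ) 1))) :=
    hq.enorm.comp_quasiMeasurePreserving (quasiMeasurePreserving_add_prod (ℓ := fun θ : ℝ => θ • h) (by fun_prop) _)
  rw [eLpNorm_two_le_iff, eLpNorm_two_sq_eq_lintegral]
  have hsec : ∀ᵐ x : Coord d, AEMeasurable (fun θ : ℝ => ‖q (x + θ • h)‖ₑ)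
      (volume.restrict (Ioc (0 : ℝ) 1)) := by
    filter_upwards [hmeas.aestronglyMeasurable.prodMk_left] with x hx using hx.aemeasurable
  -- Convexity of the square on each segment, Tonelli, and translation invariance: every slice θ
  -- contributes the same norm.
  calc ∫⁻ x, ‖D x‖ₑ ^ 2
      ≤ ∫⁻ x, ∫⁻ θ in Ioc (0 : ℝ) 1, ‖q (x + θ • h)‖ₑ ^ 2 := by
        refine lintegral_mono_ae ?_
        filter_upwards [hD, hsec] with x h1 h2
        exact (pow_le_pow_left' h1 2).trans (sq_lintegral_le_lintegral_sq h2)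
    _ = ∫⁻ θ in Ioc (0 : ℝ) 1, ∫⁻ x, ‖q (x + θ • h)‖ₑ ^ 2 :=
        lintegral_lintegral_swap (hmeas.pow_const 2)
    _ = ∫⁻ θ in Ioc (0 : ℝ) 1, ∫⁻ x, ‖q x‖ₑ ^ 2 := by
        refine lintegral_congr fun θ => ?_
        exact lintegral_add_right_eq_self (fun x => ‖q x‖ₑ ^ 2) (θ • h)
    _ = _ := by simp

/-- `v_h - v`, where `v_h(x) = v(x + h)`. -/
def fwdShift (h : Coord d) (v : Coord d → ℝ) : Coord d → ℝ := fun x => v (x + h) - v x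

/-- `f` is square integrable on `ℝ^d`, with norm at most `a`. -/
def L2Le (f : Coord d → ℝ) (a : ℝ) : Prop :=
  AEStronglyMeasurable f volume ∧ eLpNorm f 2 volume ≤ ENNReal.ofReal a

namespace L2Le

variable {f g : Coord d → ℝ} {a b c : ℝ}

lemma mono (hf : L2Le f a) (h : a ≤ b) : L2Le f b :=
  ⟨hf.1, hf.2.trans (ENNReal.ofReal_le_ofReal h)⟩

lemma add (hf : L2Le f a) (hg : L2Le g b) (ha : 0 ≤ a) (hb : 0 ≤ b) : L2Le (f + g) (a + b) :=
  ⟨hf.1.add hg.1, (eLpNorm_add_le hf.1 hg.1 (by norm_num)).trans <| by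
    rw [ENNReal.ofReal_add ha hb]; exact add_le_add hf.2 hg.2⟩

lemma neg (hf : L2Le f a) : L2Le (-f) a := ⟨hf.1.neg, by rw [eLpNorm_neg]; exact hf.2⟩

lemma sub (hf : L2Le f a) (hg : L2Le g b) (ha : 0 ≤ a) (hb : 0 ≤ b) : L2Le (f - g) (a + b) := by
  rw [sub_eq_add_neg]; exact hf.add hg.neg ha hb

lemma of_le_mul (hf : L2Le f a) (hg : AEStronglyMeasurable g volume)
    (h : ∀ᵐ x, |g x| ≤ c * |f x|) (hc : 0 ≤ c) : L2Le g (c * a) := by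
  refine ⟨hg, (eLpNorm_le_mul_eLpNorm_of_ae_le_mul (c := c) (g := f) ?_ 2).trans ?_⟩
  · simpa only [Real.norm_eq_abs] using h
  · rw [ENNReal.ofReal_mul hc]; gcongr; exact hf.2

lemma mul_left {m : Coord d → ℝ} (hf : L2Le f a) (hm : AEStronglyMeasurable m volume)
    (h : ∀ x, |m x| ≤ c) (hc : 0 ≤ c) : L2Le (m * f) (c * a) :=
  hf.of_le_mul (hm.mul hf.1) (ae_of_all _ fun x => by
    simp only [Pi.mul_apply, abs_mul]; gcongr; exact h x) hc

lemma shift (hf : L2Le f a) (h : Coord d) : L2Le (fun x => f (x + h)) a := by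
  have mp := measurePreserving_add_right (volume : Measure (Coord d)) h
  refine ⟨hf.1.comp_measurePreserving mp, ?_⟩
  exact (eLpNorm_comp_measurePreserving hf.1 mp).trans_le hf.2

lemma fwd (hf : L2Le f a) (ha : 0 ≤ a) (h : Coord d) : L2Le (fwdShift h f) (2 * a) := by
  rw [two_mul]; exact (hf.shift h).sub hf ha ha

lemma const_mul (hf : L2Le f a) (r : ℝ) : L2Le (fun x => r * f x) (|r| * a) :=
  hf.of_le_mul (hf.1.const_mul r) (ae_of_all _ fun x => by rw [abs_mul]) (abs_nonneg r)

lemma sum {ι : Type*} (s : Finset ι) {f : ι → Coord d → ℝ} {a : ι → ℝ}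
    (hf : ∀ i ∈ s, L2Le (f i) (a i)) (ha : ∀ i ∈ s, 0 ≤ a i) :
    L2Le (fun x => ∑ i ∈ s, f i x) (∑ i ∈ s, a i) := by
  classical
  induction s using Finset.induction_on with
  | empty => simp [L2Le, aestronglyMeasurable_const]
  | insert i s hi ih =>
    simp only [Finset.sum_insert hi]
    exact (hf i (by simp)).add
      (ih (fun j hj => hf j (by simp [hj])) (fun j hj => ha j (by simp [hj])))
      (ha i (by simp)) (Finset.sum_nonneg fun j hj => ha j (by simp [hj]))

lemma congr (hf : L2Le f a) (h : f =ᵐ[volume] g) : L2Le g a :=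
  ⟨hf.1.congr h, (eLpNorm_congr_ae h).symm.trans_le hf.2⟩

lemma congr' (hf : L2Le f a) (h : ∀ x, f x = g x) : L2Le g a := hf.congr (ae_of_all _ h)

lemma segment_average {q : Coord d → ℝ} (hq : L2Le q a) (hf : AEStronglyMeasurable f volume)
    {h : Coord d} (hD : ∀ᵐ x, ‖f x‖ₑ ≤ ∫⁻ θ in Ioc (0 : ℝ) 1, ‖q (x + θ • h)‖ₑ) : L2Le f a :=
  ⟨hf, (eLpNorm_le_of_le_segment_average hq.1 hD).trans hq.2⟩

/-- `L_2` bounds pass to limits. -/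
lemma of_tendsto {f : Coord d → ℝ} (hf : AEStronglyMeasurable f volume) (ha : 0 ≤ a)
    (H : ∀ ε : ℝ, 0 < ε → ∃ g, L2Le g (a + ε) ∧ L2Le (f - g) ε) : L2Le f a := by
  refine ⟨hf, ENNReal.le_of_forall_pos_le_add fun ε hε _ => ?_⟩
  obtain ⟨g, hg, hfg⟩ := H (ε / 2) (by positivity)
  have := (hg.add hfg (by positivity) (by positivity)).2
  rw [add_sub_cancel] at this
  refine this.trans (le_of_eq ?_)
  rw [add_assoc, add_halves, ENNReal.ofReal_add ha ε.coe_nonneg, ENNReal.ofReal_coe_nnreal]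

end L2Le

section Nik

variable {v : Coord d → ℝ} {a b γ : ℝ}

lemma nikQuot_le_ofReal {c : ℝ} {k : Coord d} (hc : 0 ≤ c)
    (h : L2Le (fwdShift k v) (c * ‖k‖ ^ γ)) : nikQuot γ v k ≤ ENNReal.ofReal c := by
  refine ENNReal.div_le_of_le_mul ?_
  rw [← ENNReal.ofReal_mul hc]
  exact h.2

lemma nikNorm_le_ofReal (ha : 0 ≤ a) (hb : 0 ≤ b) (hv : L2Le v a)
    (h : ∀ k ≠ 0, L2Le (fwdShift k v) (b * ‖k‖ ^ γ)) : nikNorm γ v ≤ ENNReal.ofReal (a + b) := by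
  rw [ENNReal.ofReal_add ha hb]
  exact add_le_add hv.2 (iSup₂_le fun k hk => nikQuot_le_ofReal hb (h k hk))

lemma L2Le.fwd_of_nikSemi_le (hv : AEStronglyMeasurable v volume) (hb : 0 ≤ b)
    (h : nikSemi γ v ≤ ENNReal.ofReal b) (k : Coord d) : L2Le (fwdShift k v) (b * ‖k‖ ^ γ) := by
  refine ⟨(hv.comp_measurePreserving (measurePreserving_add_right _ k)).sub hv, ?_⟩
  rcases eq_or_ne k 0 with rfl | hk
  · have : fwdShift 0 v = 0 := by ext x; simp [fwdShift]
    simp [this]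
  have h1 : nikQuot γ v k ≤ ENNReal.ofReal b :=
    (le_iSup₂ (f := fun (h : Coord d) (_ : h ≠ 0) => nikQuot γ v h) k hk).trans h
  have hpos : 0 < ‖k‖ ^ γ := Real.rpow_pos_of_pos (norm_pos_iff.2 hk) _
  rw [ENNReal.ofReal_mul hb]
  rwa [nikQuot, ENNReal.div_le_iff (by simpa using hpos) ENNReal.ofReal_ne_top] at h1

/-- Increments of order |k| make the quotient of order |k|^{1-γ}, which settles k → 0. The trivial
bound 2a for increments makes it of order |k|^{-γ}, which settles k → ∞. -/
lemma memNikZero_of_lipschitz_shift (h0 : 0 < γ) (h1 : γ < 1) (ha : 0 ≤ a) (hb : 0 ≤ b)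
    (hv : L2Le v a) (h : ∀ k, L2Le (fwdShift k v) (b * ‖k‖)) : MemNikZero γ v := by
  have q1 : ∀ k : Coord d, k ≠ 0 → nikQuot γ v k ≤ ENNReal.ofReal (b * ‖k‖ ^ (1 - γ)) := by
    intro k hk
    have hk' := norm_pos_iff.2 hk
    refine nikQuot_le_ofReal (by positivity) ((h k).mono ?_)
    rw [mul_assoc, ← Real.rpow_add hk']; simp
  have q2 : ∀ k : Coord d, k ≠ 0 → nikQuot γ v k ≤ ENNReal.ofReal (2 * a * ‖k‖ ^ (-γ)) := by
    intro k hk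
    have hk' := norm_pos_iff.2 hk
    refine nikQuot_le_ofReal (by positivity) ((hv.fwd ha k).mono ?_)
    rw [mul_assoc (2 * a), ← Real.rpow_add hk']; simp
  refine ⟨hv.1, ?_, ?_, ?_⟩
  · refine ENNReal.add_lt_top.2 ⟨hv.2.trans_lt ENNReal.ofReal_lt_top, ?_⟩
    refine lt_of_le_of_lt (iSup₂_le fun k hk => ?_) (ENNReal.ofReal_lt_top (r := b + 2 * a))
    have hk' := norm_pos_iff.2 hk
    rcases le_total ‖k‖ 1 with hk1 | hk1
    · refine (q1 k hk).trans (ENNReal.ofReal_le_ofReal ?_)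
      have := Real.rpow_le_one hk'.le hk1 (by linarith : 0 ≤ 1 - γ)
      nlinarith
    · refine (q2 k hk).trans (ENNReal.ofReal_le_ofReal ?_)
      have := Real.rpow_le_one_of_one_le_of_nonpos hk1 (by linarith : -γ ≤ 0)
      nlinarith
  · have : Tendsto (fun k : Coord d => ENNReal.ofReal (b * ‖k‖ ^ (1 - γ))) (𝓝[≠] 0) (𝓝 0) := by
      have hc : Continuous fun k : Coord d => ENNReal.ofReal (b * ‖k‖ ^ (1 - γ)) :=
        ENNReal.continuous_ofReal.comp (continuous_const.mul
          (continuous_norm.rpow_const fun _ => Or.inr (by linarith)))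
      have := hc.tendsto 0
      simp only [norm_zero, Real.zero_rpow (by linarith : 1 - γ ≠ 0), mul_zero,
        ENNReal.ofReal_zero] at this
      exact this.mono_left nhdsWithin_le_nhds
    refine tendsto_of_tendsto_of_tendsto_of_le_of_le' tendsto_const_nhds this
      (Eventually.of_forall fun _ => bot_le) ?_
    filter_upwards [self_mem_nhdsWithin] with k hk using q1 k hk
  · have : Tendsto (fun k : Coord d => ENNReal.ofReal (2 * a * ‖k‖ ^ (-γ)))
        (Bornology.cobounded _) (𝓝 0) := by
      have h2 := ((tendsto_rpow_neg_atTop h0).comp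
        (tendsto_norm_cobounded_atTop (E := Coord d))).const_mul (2 * a)
      simpa [Function.comp_def] using (ENNReal.continuous_ofReal.tendsto _).comp h2
    refine tendsto_of_tendsto_of_tendsto_of_le_of_le' tendsto_const_nhds this
      (Eventually.of_forall fun _ => bot_le) ?_
    filter_upwards [(tendsto_norm_cobounded_atTop (E := Coord d)).eventually_gt_atTop 0] with k hk
    exact q2 k (norm_pos_iff.1 hk)

/-- Two bounds for a mixed second difference imply the intermediate ones. -/
lemma le_rpow_mul_rpow_of_le {X N a b s t : ℝ} (hN : 0 ≤ N) (ha : 0 < a) (hb : 0 < b)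
    (hs : 0 ≤ s) (hst : s + t ≤ 1) (h1 : X ≤ N * (a * b ^ t)) (h2 : X ≤ N * (b * a ^ t)) :
    X ≤ N * b ^ (s + t) * a ^ (1 - s) := by
  -- If a ≤ b, the factor a^s of the first bound is enlarged to b^s. Otherwise the factor b^{1-s-t}
  -- of the second is enlarged to a^{1-s-t}, which needs s + t ≤ 1.
  rcases le_total a b with hab | hab
  · refine h1.trans ?_
    rw [mul_assoc]
    refine mul_le_mul_of_nonneg_left ?_ hN
    calc a * b ^ t = a ^ s * b ^ t * a ^ (1 - s) := by
          rw [mul_right_comm, ← Real.rpow_add ha]; simp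
      _ ≤ b ^ s * b ^ t * a ^ (1 - s) := by gcongr
      _ = _ := by rw [← Real.rpow_add hb]
  · refine h2.trans ?_
    rw [mul_assoc]
    refine mul_le_mul_of_nonneg_left ?_ hN
    calc b * a ^ t = b ^ (s + t) * (b ^ (1 - s - t) * a ^ t) := by
          rw [← mul_assoc, ← Real.rpow_add hb, show s + t + (1 - s - t) = 1 by ring,
            Real.rpow_one]
      _ ≤ b ^ (s + t) * (a ^ (1 - s - t) * a ^ t) := by
          gcongr; linarith
      _ = _ := by rw [← Real.rpow_add ha, sub_add_cancel]

end Nik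

/-! ### Differences after a change of variables -/

section Transfer

lemma enorm_sub_sq_le_two_mul_add (a b c : ℝ) :
    ‖a - b‖ₑ ^ 2 ≤ 2 * ‖c - a‖ₑ ^ 2 + 2 * ‖c - b‖ₑ ^ 2 := by
  simp only [← ofReal_norm, ← ENNReal.ofReal_pow (norm_nonneg _)]
  rw [← ENNReal.ofReal_ofNat 2, ← ENNReal.ofReal_mul (by norm_num),
    ← ENNReal.ofReal_mul (by norm_num), ← ENNReal.ofReal_add (by positivity) (by positivity)]
  refine ENNReal.ofReal_le_ofReal ?_
  simp only [Real.norm_eq_abs, sq_abs]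
  nlinarith [sq_nonneg (c - a + (c - b))]

variable {T : Coord d → Coord d} {K A : Set (Coord d)} {C : ℝ≥0}

lemma map_restrict_absolutelyContinuous (hTm : AEMeasurable T (volume.restrict K))
    (hT : ∀ F : Coord d → ℝ≥0∞, ∫⁻ y in K, F (T y) ≤ C * ∫⁻ p, F p) :
    Measure.map T (volume.restrict K) ≪ volume := by
  refine Measure.AbsolutelyContinuous.mk fun s hs h0 => ?_
  have := hT (s.indicator 1)
  rw [lintegral_indicator_one hs, h0, mul_zero, nonpos_iff_eq_zero] at this
  rw [← lintegral_indicator_one hs, lintegral_map' _ hTm, this]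
  exact (measurable_one.indicator hs).aemeasurable

/-- Differences of `w ∘ T` are controlled by differences of `w`: average over balls. -/
lemma lintegral_comp_sub_comp_le (hK : MeasurableSet K) (hA : MeasurableSet A)
    (hTm : AEMeasurable T (volume.restrict K))
    (hT : ∀ F : Coord d → ℝ≥0∞, ∫⁻ y in K, F (T y) ≤ C * ∫⁻ p, F p)
    {k : Coord d} (hAK : ∀ y ∈ A, y ∈ K ∧ y + k ∈ K) {r : ℝ} (hr : 0 < r)
    (hTr : ∀ y ∈ A, ‖T (y + k) - T y‖ ≤ r) {w : Coord d → ℝ} (hw : AEStronglyMeasurable w volume)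
    {b : ℝ} (hb : ∀ m, ‖m‖ < 2 * r → L2Le (fwdShift m w) b) :
    ∫⁻ y in A, ‖w (T (y + k)) - w (T y)‖ₑ ^ 2 ≤ 4 * 2 ^ d * C * ENNReal.ofReal b ^ 2 := by
  -- Both w(T(y + k)) and w(T y) are compared with w(T y + m), averaged over the ball |m| < r. Since
  -- |T(y + k) - T y| ≤ r, the offsets seen from T(y + k) stay in the ball B of radius 2r. Φ(p)
  -- collects the squared differences from p over all of B.
  set B : Set (Coord d) := Metric.ball 0 (2 * r) with hBdef
  set Φ : Coord d → ℝ≥0∞ := fun p => ∫⁻ m in B, ‖w (p + m) - w p‖ₑ ^ 2 with hΦ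
  have hmeas : AEMeasurable (fun p : Coord d × Coord d => ‖w (p.1 + p.2) - w p.1‖ₑ ^ 2)
      ((volume : Measure (Coord d)).prod (volume.restrict B)) :=
    ((hw.comp_quasiMeasurePreserving (quasiMeasurePreserving_add_prod
      (ℓ := fun m : Coord d => m) measurable_id _)).sub
      (hw.comp_quasiMeasurePreserving Measure.quasiMeasurePreserving_fst)).enorm.pow_const 2
  have hΦm : AEMeasurable Φ volume := hmeas.lintegral_prod_right'
  have hΦT : AEMeasurable (fun y => Φ (T y)) (volume.restrict K) :=
    (hΦm.mono_ac (map_restrict_absolutelyContinuous hTm hT)).comp_aemeasurable hTm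
  have hΦint : ∫⁻ p, Φ p ≤ volume B * ENNReal.ofReal b ^ 2 := by
    rw [hΦ, lintegral_lintegral_swap hmeas]
    calc _ ≤ ∫⁻ m in B, ENNReal.ofReal b ^ 2 := by
          refine setLIntegral_mono measurable_const fun m hm => ?_
          rw [← eLpNorm_two_le_iff]
          exact (hb m (by simpa [hBdef] using hm)).2
      _ = _ := by simp [mul_comm]
  have hB : volume B = 2 ^ d * volume (Metric.ball (0 : Coord d) r) := by
    rw [hBdef, Measure.addHaar_ball_mul_of_pos volume 0 (by norm_num : (0 : ℝ) < 2)]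
    simp [finrank_euclideanSpace]
  have key : ∀ y ∈ A, volume (Metric.ball (0 : Coord d) r) * ‖w (T (y + k)) - w (T y)‖ₑ ^ 2 ≤
      2 * Φ (T (y + k)) + 2 * Φ (T y) := by
    intro y hy
    have hw1 : AEStronglyMeasurable (fun m => w (T y + m)) volume :=
      hw.comp_measurePreserving (measurePreserving_add_left volume (T y))
    calc volume (Metric.ball (0 : Coord d) r) * ‖w (T (y + k)) - w (T y)‖ₑ ^ 2
        = ∫⁻ m in Metric.ball (0 : Coord d) r, ‖w (T (y + k)) - w (T y)‖ₑ ^ 2 := by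
          simp [mul_comm]
      _ ≤ ∫⁻ m in Metric.ball (0 : Coord d) r, (2 * ‖w (T y + m) - w (T (y + k))‖ₑ ^ 2 +
            2 * ‖w (T y + m) - w (T y)‖ₑ ^ 2) := by
          refine lintegral_mono fun m => ?_
          exact enorm_sub_sq_le_two_mul_add _ _ _
      _ = 2 * (∫⁻ m in Metric.ball (0 : Coord d) r, ‖w (T y + m) - w (T (y + k))‖ₑ ^ 2) +
            2 * (∫⁻ m in Metric.ball (0 : Coord d) r, ‖w (T y + m) - w (T y)‖ₑ ^ 2) := by
          rw [lintegral_add_right', lintegral_const_mul' _ _ (by norm_num),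
            lintegral_const_mul' _ _ (by norm_num)]
          exact (((hw1.sub aestronglyMeasurable_const).enorm.pow_const 2).const_mul 2).restrict
      _ ≤ _ := by
          refine add_le_add (mul_le_mul_right ?_ 2) (mul_le_mul_right
            (lintegral_mono_set (Metric.ball_subset_ball (by linarith))) 2)
          rw [hΦ, ← lintegral_indicator measurableSet_ball]
          simp only
          rw [← lintegral_indicator measurableSet_ball,
            ← lintegral_add_left_eq_self (indicator B _) (T y - T (y + k))]
          refine lintegral_mono fun m => ?_
          by_cases h1 : m ∈ Metric.ball (0 : Coord d) r
          · have h2 : T y - T (y + k) + m ∈ B := by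
              have := norm_add_le (T y - T (y + k)) m
              have h3 := hTr y hy
              rw [norm_sub_rev] at h3
              rw [mem_ball_zero_iff] at h1 ⊢
              linarith
            rw [indicator_of_mem h1, indicator_of_mem h2, ← add_assoc, add_sub_cancel]
          · rw [indicator_of_notMem h1]; exact bot_le
  -- The factor 4 comes from splitting the square and from the two base points y and y + k; the
  -- factor 2^d is the ratio of the volumes of the two balls.
  have hsum : volume (Metric.ball (0 : Coord d) r) * ∫⁻ y in A, ‖w (T (y + k)) - w (T y)‖ₑ ^ 2 ≤
      volume (Metric.ball (0 : Coord d) r) * (4 * 2 ^ d * C * ENNReal.ofReal b ^ 2) := by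
    calc _ = ∫⁻ y in A, volume (Metric.ball (0 : Coord d) r) * ‖w (T (y + k)) - w (T y)‖ₑ ^ 2 :=
          (lintegral_const_mul' _ _ measure_ball_lt_top.ne).symm
      _ ≤ ∫⁻ y in A, (2 * Φ (T (y + k)) + 2 * Φ (T y)) := setLIntegral_mono' hA key
      _ = 2 * (∫⁻ y in A, Φ (T (y + k))) + 2 * (∫⁻ y in A, Φ (T y)) := by
          rw [lintegral_add_right', lintegral_const_mul' _ _ (by norm_num),
            lintegral_const_mul' _ _ (by norm_num)]
          exact (hΦT.mono_measure (Measure.restrict_mono (fun y hy => (hAK y hy).1) le_rfl)).const_mul 2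
      _ ≤ 2 * (∫⁻ y in K, Φ (T y)) + 2 * (∫⁻ y in K, Φ (T y)) := by
          refine add_le_add (mul_le_mul_right ?_ 2) (mul_le_mul_right
            (lintegral_mono_set fun y hy => (hAK y hy).1) 2)
          rw [← lintegral_indicator hA, ← lintegral_indicator hK,
            ← lintegral_add_right_eq_self (indicator K _) k]
          refine lintegral_mono fun y => ?_
          by_cases h1 : y ∈ A
          · rw [indicator_of_mem h1, indicator_of_mem (hAK y h1).2]
          · rw [indicator_of_notMem h1]; exact bot_le
      _ = 4 * ∫⁻ y in K, Φ (T y) := by rw [← add_mul]; norm_num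
      _ ≤ 4 * (C * (volume B * ENNReal.ofReal b ^ 2)) := by
          gcongr
          exact (hT Φ).trans (by gcongr)
      _ = _ := by rw [hB]; ring
  exact (ENNReal.mul_le_mul_iff_right (Metric.measure_ball_pos _ _ hr).ne'
    measure_ball_lt_top.ne).1 hsum

end Transfer

end Euclidean

/-! ### The fundamental theorem of calculus for weak differentials -/

section Weak

variable {d : ℕ} {v : Coord d → ℝ} {G : Coord d → (Coord d →L[ℝ] ℝ)}

/-- Fubini's theorem for a locally integrable function and the translates of a continuous
function with compact support. -/
lemma integrable_prod_mul_translate {q : Coord d → ℝ} (hq : LocallyIntegrable q volume)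
    {η : Coord d → ℝ} (hη : Continuous η) (hηc : HasCompactSupport η) (h : Coord d) :
    Integrable (fun p : Coord d × ℝ => q p.1 * η (p.1 - p.2 • h))
      ((volume : Measure (Coord d)).prod (volume.restrict (Ioc (0 : ℝ) 1))) := by
  obtain ⟨B, hB⟩ := hηc.exists_bound_of_continuous hη
  -- K is the compact set swept out by the support of η; truncating q to K changes nothing in the
  -- product and makes q integrable.
  set K : Set (Coord d) := (fun p : Coord d × ℝ => p.1 + p.2 • h) '' (tsupport η ×ˢ Icc 0 1)
  have hK : IsCompact K := (hηc.isCompact.prod isCompact_Icc).image (by fun_prop)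
  have hqK : Integrable (K.indicator q) volume :=
    (hq.integrableOn_isCompact hK).integrable_indicator hK.measurableSet
  have h1 : Integrable (fun p : Coord d × ℝ => K.indicator q p.1 * (1 : ℝ))
      ((volume : Measure (Coord d)).prod (volume.restrict (Ioc (0 : ℝ) 1))) :=
    hqK.mul_prod (integrable_const 1)
  have h2 := h1.mul_bdd (g := fun p : Coord d × ℝ => η (p.1 - p.2 • h)) (c := B)
    (by fun_prop) (ae_of_all _ fun p => hB _)
  refine h2.congr ?_
  have : ∀ᵐ p : Coord d × ℝ ∂((volume : Measure (Coord d)).prod (volume.restrict (Ioc (0 : ℝ) 1))),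
      p.2 ∈ Ioc (0 : ℝ) 1 :=
    Measure.quasiMeasurePreserving_snd.ae (ae_restrict_mem measurableSet_Ioc)
  filter_upwards [this] with p hp
  by_cases hpK : p.1 ∈ K
  · simp [indicator_of_mem hpK]
  · have : η (p.1 - p.2 • h) = 0 := by
      by_contra hne
      refine hpK ⟨(p.1 - p.2 • h, p.2), ⟨subset_tsupport _ hne, Ioc_subset_Icc_self hp⟩, by simp⟩
    simp [this]

lemma integrable_prod_translate {q : Coord d → ℝ} (hq : LocallyIntegrable q volume)
    {K : Set (Coord d)} (hK : IsCompact K) (h : Coord d) :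
    Integrable (fun p : Coord d × ℝ => q (p.1 + p.2 • h))
      ((volume.restrict K : Measure (Coord d)).prod (volume.restrict (Ioc (0 : ℝ) 1))) := by
  set K' : Set (Coord d) := (fun p : Coord d × ℝ => p.1 + p.2 • h) '' (K ×ˢ Icc 0 1)
  have hK' : IsCompact K' := (hK.prod isCompact_Icc).image (by fun_prop)
  have hqK : Integrable (K'.indicator q) volume :=
    (hq.integrableOn_isCompact hK').integrable_indicator hK'.measurableSet
  have h1 : Integrable (fun p : Coord d × ℝ => K'.indicator q (p.1 + p.2 • h))
      ((volume : Measure (Coord d)).prod (volume.restrict (Ioc (0 : ℝ) 1))) := by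
    have hm : AEStronglyMeasurable (fun p : Coord d × ℝ => K'.indicator q (p.1 + p.2 • h))
        ((volume : Measure (Coord d)).prod (volume.restrict (Ioc (0 : ℝ) 1))) :=
      hqK.1.comp_quasiMeasurePreserving
        (quasiMeasurePreserving_add_prod (ℓ := fun θ : ℝ => θ • h) (by fun_prop) _)
    rw [integrable_prod_iff' hm]
    refine ⟨ae_of_all _ fun θ => hqK.comp_add_right (θ • h), ?_⟩
    have : ∀ θ : ℝ, ∫ x, ‖K'.indicator q (x + θ • h)‖ = ∫ x, ‖K'.indicator q x‖ := fun θ =>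
      integral_add_right_eq_self (fun x => ‖K'.indicator q x‖) (θ • h)
    simp only [this]
    exact integrable_const _
  have h2 : Integrable (fun p : Coord d × ℝ => K'.indicator q (p.1 + p.2 • h))
      ((volume.restrict K : Measure (Coord d)).prod (volume.restrict (Ioc (0 : ℝ) 1))) :=
    h1.mono_measure (Measure.prod_mono Measure.restrict_le_self le_rfl)
  refine h2.congr ?_
  rw [Measure.prod_restrict]
  filter_upwards [ae_restrict_mem (hK.measurableSet.prod measurableSet_Ioc)] with p hp
  rw [indicator_of_mem]
  exact ⟨p, ⟨hp.1, Ioc_subset_Icc_self hp.2⟩, rfl⟩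

/-- Fubini on countably many balls. Without integrability the integrals along segments would be
default zeros, and a difference of two of them could not be merged into one. -/
lemma ae_integrableOn_segment {q : Coord d → ℝ} (hq : LocallyIntegrable q volume) (h : Coord d) :
    ∀ᵐ x, IntegrableOn (fun θ : ℝ => q (x + θ • h)) (Ioc 0 1) := by
  have h1 : ∀ n : ℕ, ∀ᵐ x, x ∈ Metric.closedBall (0 : Coord d) n →
      IntegrableOn (fun θ : ℝ => q (x + θ • h)) (Ioc 0 1) := fun n => by
    rw [← ae_restrict_iff' Metric.isClosed_closedBall.measurableSet]
    exact (integrable_prod_translate hq (isCompact_closedBall 0 (n : ℝ)) h).prod_right_ae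
  filter_upwards [ae_all_iff.2 h1] with x hx
  obtain ⟨n, hn⟩ := exists_nat_ge ‖x‖
  exact hx n (by simpa using hn)

/-- The fundamental theorem of calculus for weak differentials. -/
lemma fwdShift_eq_of_hasWeakGradOn (H : HasWeakGradOn v G univ) (h : Coord d) :
    ∀ᵐ x, fwdShift h v x = ∫ θ in Ioc (0 : ℝ) 1, G (x + θ • h) h := by
  obtain ⟨hv, hG, H⟩ := H
  rw [locallyIntegrableOn_univ] at hv hG
  set q : Coord d → ℝ := fun x => G x h with hqdef
  have hq : LocallyIntegrable q volume := fun x => by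
    obtain ⟨s, hs, hGs⟩ := hG x
    exact ⟨s, hs, (ContinuousLinearMap.apply ℝ ℝ h).integrable_comp hGs⟩
  have hvh : LocallyIntegrable (fun x => v (x + h)) volume := by
    rw [locallyIntegrable_iff]
    intro K hK
    have := (hv.integrableOn_isCompact (hK.image (continuous_add_const h))).integrable_indicator
      (hK.image (continuous_add_const h)).measurableSet
    refine ((this.comp_add_right h).integrableOn (s := K)).congr_fun (fun x hx => ?_)
      hK.measurableSet
    simp only
    rw [indicator_of_mem (mem_image_of_mem _ hx)]
  have havg : LocallyIntegrable (fun x => ∫ θ in Ioc (0 : ℝ) 1, q (x + θ • h)) volume := by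
    rw [locallyIntegrable_iff]
    intro K hK
    exact (integrable_prod_translate hq hK h).integral_prod_left
  -- Testing against η moves the shift onto η. Writing η(x - h) - η(x) as an integral over θ and
  -- exchanging the integrals, the claim becomes the definition of the weak differential for the
  -- test functions η(· - θh).
  have key := ae_eq_zero_of_integral_contDiff_smul_eq_zero ((hvh.sub hv).sub havg) ?_
  · filter_upwards [key] with x hx
    simpa [fwdShift, sub_eq_zero] using hx
  intro η hη hηc
  have hηcont := hη.continuous
  have hint : ∀ {f : Coord d → ℝ}, LocallyIntegrable f volume →
      Integrable (fun x => f x * η x) volume := fun hf => by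
    simpa [mul_comm] using hf.integrable_smul_left_of_hasCompactSupport hηcont hηc
  have htr : ∀ θ : ℝ, HasCompactSupport fun x => η (x - θ • h) := fun θ => by
    simpa [Function.comp_def, sub_eq_add_neg] using
      hηc.comp_homeomorph (Homeomorph.addRight (-(θ • h)))
  have hDη : ∀ (x : Coord d) (θ : ℝ), fderiv ℝ (fun y => η (y - θ • h)) x h =
      fderiv ℝ η (x - θ • h) h := fun x θ => by
    rw [fderiv_comp_sub]
  have hDc : Continuous fun x => fderiv ℝ η x h :=
    (hη.continuous_fderiv (by simp)).clm_apply continuous_const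
  have hDcs : HasCompactSupport fun x => fderiv ℝ η x h := hηc.fderiv_apply ℝ h
  -- the derivative of `∫ v η(· - θ h)` with respect to `θ`
  have hweak : ∀ θ : ℝ, ∫ x, v x * fderiv ℝ η (x - θ • h) h = - ∫ x, q (x + θ • h) * η x := by
    intro θ
    have h1 := H (fun y => η (y - θ • h)) (hη.comp (contDiff_id.sub contDiff_const)) (htr θ)
      (subset_univ _) h
    simp only [hDη, Measure.restrict_univ] at h1
    rw [h1, ← integral_add_right_eq_self _ (θ • h)]
    simp [hqdef]
  have hseg : ∀ x, η (x - h) - η x = - ∫ θ in Ioc (0 : ℝ) 1, fderiv ℝ η (x - θ • h) h := by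
    intro x
    have hd : ∀ θ ∈ uIcc (0 : ℝ) 1, HasDerivAt (fun θ : ℝ => η (x - θ • h))
        (-(fderiv ℝ η (x - θ • h) h)) θ := by
      intro θ _
      have h1 : HasDerivAt (fun θ : ℝ => x - θ • h) (-h) θ := by
        simpa using ((hasDerivAt_id θ).smul_const h).const_sub x
      have h2 := ((hη.differentiable (by simp)) (x - θ • h)).hasFDerivAt.comp_hasDerivAt θ h1
      simpa [Function.comp_def] using h2
    have h3 := intervalIntegral.integral_eq_sub_of_hasDerivAt hd
      (Continuous.intervalIntegrable (by fun_prop) _ _)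
    rw [intervalIntegral.integral_of_le zero_le_one, integral_neg] at h3
    simpa using h3.symm
  have e1 : ∫ x, (v (x + h) - v x) * η x = ∫ x, v x * (η (x - h) - η x) := by
    have i1 : Integrable (fun x => v x * η (x - h)) volume := by
      have := (hint hvh).comp_sub_right h
      simpa using this
    simp only [sub_mul, mul_sub]
    rw [integral_sub (hint hvh) (hint hv), integral_sub i1 (hint hv),
      ← integral_add_right_eq_self (fun x => v x * η (x - h)) h]
    simp
  have e2 : ∫ x, v x * (η (x - h) - η x) =
      - ∫ θ in Ioc (0 : ℝ) 1, ∫ x, v x * fderiv ℝ η (x - θ • h) h := by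
    rw [← integral_integral_swap (integrable_prod_mul_translate hv hDc hDcs h),
      ← integral_neg]
    refine integral_congr_ae (ae_of_all _ fun x => ?_)
    simp only [hseg]
    rw [integral_const_mul, mul_neg]
  have e3 : ∫ x, (∫ θ in Ioc (0 : ℝ) 1, q (x + θ • h)) * η x =
      ∫ θ in Ioc (0 : ℝ) 1, ∫ x, q (x + θ • h) * η x := by
    have hK := hηc.isCompact
    obtain ⟨B, hB⟩ := hηc.exists_bound_of_continuous hηcont
    have := (integrable_prod_translate hq hK h).mul_bdd (g := fun p => η p.1) (c := B)
      (by fun_prop) (ae_of_all _ fun p => hB _)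
    have h0 : ∀ f : Coord d → ℝ, ∫ x in tsupport η, f x * η x = ∫ x, f x * η x := fun f =>
      setIntegral_eq_integral_of_forall_compl_eq_zero fun x hx => by
        rw [image_eq_zero_of_notMem_tsupport hx, mul_zero]
    simp only [← h0]
    rw [← integral_integral_swap this]
    simp only [integral_mul_const]
  calc ∫ x, η x • ((((fun x => v (x + h)) - v) - fun x => ∫ θ in Ioc (0 : ℝ) 1, q (x + θ • h)) x)
      = ∫ x, ((v (x + h) - v x) * η x - (∫ θ in Ioc (0 : ℝ) 1, q (x + θ • h)) * η x) := by
        refine integral_congr_ae (ae_of_all _ fun x => ?_)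
        simp only [smul_eq_mul, Pi.sub_apply]; ring
    _ = 0 := by
        rw [integral_sub (by exact hint (hvh.sub hv)) (hint havg), e1, e2, e3]
        simp only [hweak, integral_neg, neg_neg, sub_self]

lemma enorm_fwdShift_le_of_hasWeakGradOn (H : HasWeakGradOn v G univ) (h : Coord d) :
    ∀ᵐ x, ‖fwdShift h v x‖ₑ ≤ ∫⁻ θ in Ioc (0 : ℝ) 1, ‖G (x + θ • h) h‖ₑ := by
  filter_upwards [fwdShift_eq_of_hasWeakGradOn H h] with x hx
  rw [hx]
  exact enorm_integral_le_lintegral_enorm _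

end Weak

/-! ### First and mixed second differences -/

section Differences

variable {d : ℕ}

lemma fwdShift_mul (k : Coord d) (a b : Coord d → ℝ) :
    fwdShift k (a * b) = (fun x => a (x + k)) * fwdShift k b + fwdShift k a * b := by
  ext x
  simp only [fwdShift, Pi.mul_apply, Pi.add_apply]
  ring

lemma fwdShift_add (k : Coord d) (a b : Coord d → ℝ) :
    fwdShift k (a + b) = fwdShift k a + fwdShift k b := by
  ext x
  simp only [fwdShift, Pi.add_apply]
  ring

lemma fwdShift_comm (k h : Coord d) (a : Coord d → ℝ) :
    fwdShift k (fwdShift h a) = fwdShift h (fwdShift k a) := by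
  ext x
  simp only [fwdShift, add_right_comm x k h]
  ring

lemma fwdShift_zero (a : Coord d → ℝ) : fwdShift 0 a = 0 := by
  ext x; simp [fwdShift]

lemma fwdShift_translate (k h : Coord d) (a : Coord d → ℝ) :
    fwdShift k (fun x => a (x + h)) = fun x => fwdShift k a (x + h) := by
  ext x
  simp only [fwdShift, add_right_comm x k h]

lemma L2Le.min {f : Coord d → ℝ} {a b : ℝ} (ha : L2Le f a) (hb : L2Le f b) :
    L2Le f (min a b) := by
  rcases min_choice a b with h | h <;> rwa [h]

/-- `w` belongs to `N^γ_2(ℝ^d)`, with both parts of the norm bounded by `B`. -/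
def NikBound (γ : ℝ) (w : Coord d → ℝ) (B : ℝ) : Prop :=
  L2Le w B ∧ ∀ k, L2Le (fwdShift k w) (B * ‖k‖ ^ γ)

/-- A Lipschitz multiplier. -/
structure LipMult (c : ℝ) (β : Coord d → ℝ) : Prop where
  cont : Continuous β
  bound : ∀ x, |β x| ≤ c
  lip : ∀ h x, |fwdShift h β x| ≤ c * ‖h‖

/-- A `C^{1,1}` multiplier. -/
structure C11Mult (c : ℝ) (β : Coord d → ℝ) : Prop extends LipMult c β where
  lip_two : ∀ h k x, |fwdShift k (fwdShift h β) x| ≤ c * ‖h‖ * ‖k‖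

/-- Interpolation between the exponents 0 and 1: a bounded Lipschitz function satisfies Hölder
bounds of every intermediate order. -/
lemma min_one_le_rpow {r t : ℝ} (hr : 0 < r) (ht0 : 0 ≤ t) (ht1 : t ≤ 1) : min 1 r ≤ r ^ t := by
  rcases le_total r 1 with h | h
  · rw [min_eq_right h]
    simpa using Real.rpow_le_rpow_of_exponent_ge hr h ht1
  · rw [min_eq_left h]
    exact Real.one_le_rpow h ht0

lemma LipMult.nonneg {c : ℝ} {β : Coord d → ℝ} (hβ : LipMult c β) : 0 ≤ c :=
  (abs_nonneg _).trans (hβ.bound 0)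

lemma LipMult.abs_fwdShift_le {c t : ℝ} {β : Coord d → ℝ} (hβ : LipMult c β) (ht0 : 0 ≤ t)
    (ht1 : t ≤ 1) {k : Coord d} (hk : k ≠ 0) (x : Coord d) :
    |fwdShift k β x| ≤ 2 * c * ‖k‖ ^ t := by
  have h1 := hβ.lip k x
  have h2 : |fwdShift k β x| ≤ 2 * c := by
    have := abs_sub (β (x + k)) (β x)
    have := hβ.bound x
    have := hβ.bound (x + k)
    simp only [fwdShift]; linarith
  have hc := hβ.nonneg
  have hk' := norm_pos_iff.2 hk
  calc _ ≤ 2 * c * min 1 ‖k‖ := by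
        rw [mul_min_of_nonneg _ _ (by positivity)]
        exact le_min (by linarith) (h1.trans (by nlinarith))
    _ ≤ _ := by gcongr; exact min_one_le_rpow hk' ht0 ht1

lemma C11Mult.abs_fwdShift_fwdShift_le {c t : ℝ} {β : Coord d → ℝ} (hβ : C11Mult c β)
    (ht0 : 0 ≤ t) (ht1 : t ≤ 1) {k : Coord d} (hk : k ≠ 0) (h x : Coord d) :
    |fwdShift k (fwdShift h β) x| ≤ 2 * c * ‖h‖ * ‖k‖ ^ t := by
  have h1 := hβ.lip_two h k x
  have h2 : |fwdShift k (fwdShift h β) x| ≤ 2 * c * ‖h‖ := by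
    have := abs_sub (fwdShift h β (x + k)) (fwdShift h β x)
    have := hβ.lip h x
    have := hβ.lip h (x + k)
    simp only [fwdShift] at *; linarith
  have hc := hβ.nonneg
  have hk' := norm_pos_iff.2 hk
  calc _ ≤ 2 * c * ‖h‖ * min 1 ‖k‖ := by
        rw [mul_min_of_nonneg _ _ (by positivity)]
        refine le_min (by linarith) (h1.trans ?_)
        have : 0 ≤ c * ‖h‖ * ‖k‖ := by positivity
        linarith
    _ ≤ _ := by gcongr; exact min_one_le_rpow hk' ht0 ht1

lemma continuous_fwdShift {β : Coord d → ℝ} (hβ : Continuous β) (h : Coord d) :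
    Continuous (fwdShift h β) := by
  unfold fwdShift; fun_prop

/-- The bounds for first and mixed second differences that hold in `N^{1+t}_2(ℝ^d)`. -/
structure DiffBound (t : ℝ) (v : Coord d → ℝ) (N : ℝ) : Prop where
  zero : L2Le v N
  one : ∀ h, L2Le (fwdShift h v) (N * ‖h‖)
  two : ∀ h k, k ≠ 0 → L2Le (fwdShift k (fwdShift h v)) (N * ‖h‖ * ‖k‖ ^ t)

lemma DiffBound.mul {t N c : ℝ} {β v : Coord d → ℝ} (hv : DiffBound t v N) (hN : 0 ≤ N)
    (ht0 : 0 ≤ t) (ht1 : t ≤ 1) (hβ : C11Mult c β) : DiffBound t (β * v) (7 * c * N) := by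
  have hc := hβ.nonneg
  have hcN : 0 ≤ c * N := by positivity
  have hβh : ∀ h : Coord d, Continuous fun x => β (x + h) := fun h =>
    hβ.cont.comp (continuous_add_const h)
  have hβs : ∀ h : Coord d, Continuous (fwdShift h β) := fun h => continuous_fwdShift hβ.cont h
  refine ⟨?_, fun h => ?_, fun h k hk => ?_⟩
  · exact (hv.zero.mul_left hβ.cont.aestronglyMeasurable hβ.bound hc).mono (by linarith)
  · rw [fwdShift_mul]
    have h1 := (hv.one h).mul_left (hβh h).aestronglyMeasurable (fun x => hβ.bound _) hc
    have h2 := hv.zero.mul_left (hβs h).aestronglyMeasurable (hβ.lip h) (by positivity)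
    refine (h1.add h2 (by positivity) (by positivity)).mono ?_
    have : 0 ≤ c * N * ‖h‖ := by positivity
    linarith
  · have hk' := norm_pos_iff.2 hk
    rw [fwdShift_mul, fwdShift_add, fwdShift_mul, fwdShift_mul]
    have h1 := (hv.two h k hk).mul_left (m := fun x => β (x + k + h)) (c := c)
      (by have := hβ.cont; fun_prop) (fun x => hβ.bound _) hc
    have h2 := (hv.one h).mul_left (m := fwdShift k fun x => β (x + h)) (c := 2 * c * ‖k‖ ^ t)
      (continuous_fwdShift (hβh h) k).aestronglyMeasurable
      (fun x => by rw [fwdShift_translate]; exact hβ.abs_fwdShift_le ht0 ht1 hk _) (by positivity)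
    -- The order t results from the Lipschitz bound for small k and the trivial bound 2N for large
    -- k.
    have h3' : L2Le (fwdShift k v) (2 * N * ‖k‖ ^ t) := by
      refine ((hv.one k).min (hv.zero.fwd hN k)).mono ?_
      calc _ ≤ 2 * N * min 1 ‖k‖ := by
            rw [mul_min_of_nonneg _ _ (by positivity)]
            refine le_min (min_le_right _ _ |>.trans (by linarith)) (min_le_left _ _ |>.trans ?_)
            have : 0 ≤ N * ‖k‖ := by positivity
            linarith
        _ ≤ _ := by gcongr; exact min_one_le_rpow hk' ht0 ht1
    have h3 := h3'.mul_left (m := fun x => fwdShift h β (x + k)) (c := c * ‖h‖)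
      ((hβs h).comp (continuous_add_const k)).aestronglyMeasurable
      (fun x => hβ.lip h _) (by positivity)
    have h4 := hv.zero.mul_left (m := fwdShift k (fwdShift h β)) (c := 2 * c * ‖h‖ * ‖k‖ ^ t)
      (continuous_fwdShift (hβs h) k).aestronglyMeasurable
      (hβ.abs_fwdShift_fwdShift_le ht0 ht1 hk h) (by positivity)
    -- The four terms of the Leibniz rule carry the constants 1, 2, 2, 2, whence 7.
    refine ((h1.add h2 ?_ ?_).add (h3.add h4 ?_ ?_) ?_ ?_).mono (le_of_eq ?_)
    any_goals positivity
    ring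

/-- The main estimate in `ℝ^d`: the differences of an element of `N^{1+t}_2`, multiplied by a
cut-off function, are of order `|h|^{s+t}` in `N^{1-s}_2`. -/
lemma DiffBound.nikBound_mul_fwdShift {t s N c R : ℝ} {φ U : Coord d → ℝ} (hU : DiffBound t U N)
    (hN : 0 ≤ N) (ht0 : 0 ≤ t) (hs0 : 0 < s) (hs1 : s < 1) (hst : s + t ≤ 1) (hφ : LipMult c φ)
    (hR : 1 ≤ R) {h : Coord d} (h0 : h ≠ 0) (hh : ‖h‖ ≤ R) :
    NikBound (1 - s) (φ * fwdShift h U) (3 * c * R * N * ‖h‖ ^ (s + t)) := by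
  have hc := hφ.nonneg
  have hh0 := norm_pos_iff.2 h0
  -- Since ‖h‖ ≤ R, the full power of ‖h‖ may be lowered to the exponent p at the price of a factor
  -- R.
  have hpow : ∀ {p : ℝ}, 0 ≤ p → p ≤ 1 → ‖h‖ ≤ R * ‖h‖ ^ p := by
    intro p hp0 hp1
    calc ‖h‖ = ‖h‖ ^ (1 - p) * ‖h‖ ^ p := by rw [← Real.rpow_add hh0]; simp
      _ ≤ R ^ (1 - p) * ‖h‖ ^ p := by gcongr
      _ ≤ R * ‖h‖ ^ p := by
          gcongr
          simpa using Real.rpow_le_rpow_of_exponent_le hR (by linarith : 1 - p ≤ 1)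
  constructor
  · refine ((hU.one h).mul_left hφ.cont.aestronglyMeasurable hφ.bound hc).mono ?_
    calc c * (N * ‖h‖) ≤ c * (N * (R * ‖h‖ ^ (s + t))) := by
          gcongr; exact hpow (by linarith) hst
      _ ≤ _ := by
          have : 0 ≤ c * R * N * ‖h‖ ^ (s + t) := by positivity
          linarith
  · intro k
    rcases eq_or_ne k 0 with rfl | hk
    · rw [fwdShift_zero]
      refine ⟨aestronglyMeasurable_zero, by simp⟩
    have hk' := norm_pos_iff.2 hk
    have hφk : AEStronglyMeasurable (fun x => φ (x + k)) volume :=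
      (hφ.cont.comp (continuous_add_const k)).aestronglyMeasurable
    have hφs := (continuous_fwdShift hφ.cont k).aestronglyMeasurable (μ := volume)
    have b1 : L2Le (fwdShift k (φ * fwdShift h U)) (3 * c * R * N * (‖h‖ * ‖k‖ ^ t)) := by
      rw [fwdShift_mul]
      have h1 := (hU.two h k hk).mul_left hφk (fun x => hφ.bound _) hc
      have h2 := (hU.one h).mul_left hφs (hφ.abs_fwdShift_le ht0 (by linarith) hk) (by positivity)
      refine (h1.add h2 (by positivity) (by positivity)).mono ?_
      have : 0 ≤ c * N * (‖h‖ * ‖k‖ ^ t) := by positivity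
      nlinarith
    -- The mixed difference is symmetric, so the roles of h and k can be exchanged; now k carries
    -- the full power.
    have b2 : L2Le (fwdShift k (φ * fwdShift h U)) (3 * c * R * N * (‖k‖ * ‖h‖ ^ t)) := by
      rw [fwdShift_mul]
      have h1 := (hU.two k h h0).mul_left hφk (fun x => hφ.bound _) hc
      rw [fwdShift_comm] at h1
      have h2 := (hU.one h).mul_left hφs (hφ.lip k) (by positivity)
      refine (h1.add h2 (by positivity) (by positivity)).mono ?_
      have h3 : c * ‖k‖ * (N * ‖h‖) ≤ c * ‖k‖ * (N * (R * ‖h‖ ^ t)) := by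
        gcongr; exact hpow ht0 (by linarith)
      have : 0 ≤ c * N * (‖k‖ * ‖h‖ ^ t) := by positivity
      nlinarith
    exact (b2.min b1).mono (le_rpow_mul_rpow_of_le (by positivity) hk' hh0 hs0.le hst
      (min_le_left _ _) (min_le_right _ _))

/-- Since δ_h v is the average of ∇v · h along the segment from x to x + h, and δ_k commutes with
this average, everything reduces to the norms of the partial derivatives. Expanding h in coordinates
costs the factor d; the additional 1 is needed for the norm of v itself. -/
lemma MemNikOne.diffBound {t : ℝ} {v : Coord d → ℝ} (hv : MemNikOne t v) :
    DiffBound t v ((d + 1) * (nikNormOne t v).toReal) := by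
  classical
  obtain ⟨hvm, hex, hfin⟩ := hv
  set N := (nikNormOne t v).toReal with hNdef
  have hN0 : 0 ≤ N := ENNReal.toReal_nonneg
  have hNle : nikNormOne t v = ENNReal.ofReal N := (ENNReal.ofReal_toReal hfin.ne).symm
  have hG : HasWeakGradOn v (weakGrad v) univ := by
    unfold weakGrad
    rw [dif_pos hex]
    exact hex.choose_spec
  have hGm : AEStronglyMeasurable (weakGrad v) volume :=
    (locallyIntegrableOn_univ.1 hG.2.1).aestronglyMeasurable
  have hpm : ∀ i, AEStronglyMeasurable (weakPartial i v) volume := fun i =>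
    (ContinuousLinearMap.apply ℝ ℝ (stdVec i)).continuous.comp_aestronglyMeasurable hGm
  have hv0 : L2Le v N := ⟨hvm, by
    rw [← hNle]; exact le_self_add.trans le_self_add⟩
  have hp0 : ∀ i, L2Le (weakPartial i v) N := fun i => ⟨hpm i, by
    rw [← hNle]
    refine le_trans ?_ (le_self_add (b := ⨆ i : Fin d, nikSemi t (weakPartial i v)))
    refine le_trans ?_ le_add_self
    exact Finset.single_le_sum (f := fun i => eLpNorm (weakPartial i v) 2 volume)
      (fun _ _ => bot_le) (Finset.mem_univ i)⟩
  have hp1 : ∀ i k, L2Le (fwdShift k (weakPartial i v)) (N * ‖k‖ ^ t) := fun i k =>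
    L2Le.fwd_of_nikSemi_le (hpm i) hN0 (by
      rw [← hNle]
      exact (le_iSup (fun i : Fin d => nikSemi t (weakPartial i v)) i).trans le_add_self) k
  have hdir : ∀ h x, weakGrad v x h = ∑ i, h i * weakPartial i v x := by
    intro h x
    have : h = ∑ i, h i • stdVec i := by
      ext j
      simp [stdVec, Pi.single_apply]
    conv_lhs => rw [this]
    simp [weakPartial]
  have hcoord : ∀ (h : Coord d) (i : Fin d), |h i| ≤ ‖h‖ := fun h i => by
    simpa using PiLp.norm_apply_le h i
  have hsum : ∀ (h : Coord d) {b : ℝ}, 0 ≤ b → ∑ i, |h i| * b ≤ (d + 1) * (b * ‖h‖) := by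
    intro h b hb
    calc ∑ i, |h i| * b ≤ ∑ i : Fin d, ‖h‖ * b := by gcongr with i; exact hcoord h i
      _ = d * (b * ‖h‖) := by
          rw [Finset.sum_const, Finset.card_fin, nsmul_eq_mul, mul_comm b]
      _ ≤ _ := by gcongr; simp
  refine ⟨hv0.mono (by nlinarith [(Nat.cast_nonneg d : (0 : ℝ) ≤ d)]), fun h => ?_, fun h k hk => ?_⟩
  · have hq : L2Le (fun x => weakGrad v x h) (∑ i, |h i| * N) := by
      simp only [hdir]
      exact L2Le.sum _ (fun i _ => (hp0 i).const_mul (h i)) (fun i _ => by positivity)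
    refine (hq.segment_average (hv0.fwd hN0 h).1
      (enorm_fwdShift_le_of_hasWeakGradOn hG h)).mono ?_
    rw [mul_assoc]; exact hsum h hN0
  · have hk' := norm_pos_iff.2 hk
    have hq : L2Le (fwdShift k fun x => weakGrad v x h) (∑ i, |h i| * (N * ‖k‖ ^ t)) := by
      refine (L2Le.sum Finset.univ (fun i _ => (hp1 i k).const_mul (h i))
        (fun i _ => by positivity)).congr' fun x => ?_
      simp only [fwdShift, hdir, ← Finset.sum_sub_distrib]
      exact Finset.sum_congr rfl fun i _ => by ring
    have hint : ∀ᵐ x, IntegrableOn (fun θ : ℝ => weakGrad v (x + θ • h) h) (Ioc 0 1) := by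
      refine ae_integrableOn_segment (q := fun x => weakGrad v x h) (fun x => ?_) h
      obtain ⟨s, hs, hGs⟩ := locallyIntegrableOn_univ.1 hG.2.1 x
      exact ⟨s, hs, (ContinuousLinearMap.apply ℝ ℝ h).integrable_comp hGs⟩
    refine (hq.segment_average (h := h) ((hv0.fwd hN0 h).fwd (by positivity) k).1 ?_).mono ?_
    · have mp := measurePreserving_add_right (volume : Measure (Coord d)) k
      have hFTC := fwdShift_eq_of_hasWeakGradOn hG h
      filter_upwards [hFTC, mp.quasiMeasurePreserving.ae hFTC, hint,
        mp.quasiMeasurePreserving.ae hint] with x h1 h2 h3 h4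
      have : fwdShift k (fwdShift h v) x =
          ∫ θ in Ioc (0 : ℝ) 1, fwdShift k (fun x => weakGrad v x h) (x + θ • h) := by
        simp only [fwdShift, add_right_comm x _ k] at *
        rw [h1, h2, integral_sub h4 h3]
      rw [this]
      exact enorm_integral_le_lintegral_enorm _
    · refine (hsum h (by positivity)).trans (le_of_eq (by ring))

end Differences

/-! ### C^{1,1} multipliers with compact support -/

section Multipliers

variable {d : ℕ}

/-- On a ball with radius one larger than needed for the support, compactness gives a constant. A
point outside it has value zero and distance at least 1 from all points with nonzero value, so that
the supremum of ‖f‖ serves as a constant there. -/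
lemma LocallyLipschitz.exists_lipschitzWith_of_hasCompactSupport {E F : Type*}
    [NormedAddCommGroup E] [ProperSpace E] [NormedAddCommGroup F] {f : E → F}
    (hf : LocallyLipschitz f) (hc : HasCompactSupport f) : ∃ C, LipschitzWith C f := by
  obtain ⟨R, hR⟩ := hc.isCompact.isBounded.subset_closedBall (0 : E)
  obtain ⟨C, hC⟩ := (hf.locallyLipschitzOn (s := Metric.closedBall 0 (R + 1))
    ).exists_lipschitzOnWith_of_compact (isCompact_closedBall 0 (R + 1))
  obtain ⟨B, hB⟩ := hc.exists_bound_of_continuous hf.continuous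
  have h0 : ∀ x, R < ‖x‖ → f x = 0 := fun x hx => by
    by_contra hne
    exact not_lt.2 (by simpa using hR (subset_tsupport _ hne)) hx
  have key : ∀ x y, R + 1 < ‖x‖ → dist (f x) (f y) ≤ B.toNNReal * dist x y := by
    intro x y hx
    rw [h0 x (by linarith)]
    by_cases hy : R < ‖y‖
    · rw [h0 y hy]; simp; positivity
    · have h1 : 1 ≤ dist x y := by
        have := norm_sub_norm_le x y
        rw [dist_eq_norm]; linarith
      rw [dist_zero_left]
      have h2 : ‖f y‖ ≤ B.toNNReal := (hB y).trans (Real.le_coe_toNNReal B)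
      nlinarith [B.toNNReal.coe_nonneg]
  refine ⟨max C B.toNNReal, LipschitzWith.of_dist_le_mul fun x y => ?_⟩
  have hle : ∀ {D : ℝ≥0}, D ≤ max C B.toNNReal → dist (f x) (f y) ≤ D * dist x y →
      dist (f x) (f y) ≤ (max C B.toNNReal : ℝ≥0) * dist x y := fun hD h =>
    h.trans (by gcongr)
  by_cases hx : R + 1 < ‖x‖
  · exact hle (le_max_right _ _) (key x y hx)
  by_cases hy : R + 1 < ‖y‖
  · refine hle (le_max_right _ _) ?_
    rw [dist_comm, dist_comm x y]; exact key y x hy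
  · exact hle (le_max_left _ _) (hC.dist_le_mul x (by simpa using hx) y (by simpa using hy))

/-- A compactly supported function of class `C^{1,1}` on `ℝ^d`. -/
structure CompactC11 (β : Coord d → ℝ) : Prop where
  smooth : ContDiff ℝ 1 β
  supp : HasCompactSupport β
  lip : ∃ C, LipschitzWith C (fderiv ℝ β)

/-- The second difference is bounded by the mean value inequality for δ_h β, whose derivative is at
most a Lipschitz constant of Dβ times ‖h‖. -/
lemma CompactC11.exists_mult {β : Coord d → ℝ} (hβ : CompactC11 β) : ∃ c, C11Mult c β := by
  obtain ⟨B, hB⟩ := hβ.supp.exists_bound_of_continuous hβ.smooth.continuous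
  obtain ⟨C, hC⟩ := hβ.smooth.lipschitzWith_of_hasCompactSupport hβ.supp one_ne_zero
  obtain ⟨D, hD⟩ := hβ.lip
  have hdiff := hβ.smooth.differentiable one_ne_zero
  refine ⟨max B (max C D), ⟨⟨hβ.smooth.continuous, fun x => (hB x).trans (le_max_left _ _),
    fun h x => ?_⟩, fun h k x => ?_⟩⟩
  · have := hC.norm_sub_le (x + h) x
    rw [add_sub_cancel_left] at this
    refine this.trans ?_
    gcongr
    exact (le_max_left _ _).trans (le_max_right _ _)
  · have hd : ∀ y, HasFDerivAt (fwdShift h β) (fderiv ℝ β (y + h) - fderiv ℝ β y) y := fun y =>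
      ((hasFDerivAt_comp_add_right h).2 (hdiff (y + h)).hasFDerivAt).sub (hdiff y).hasFDerivAt
    have hb : ∀ y ∈ (univ : Set (Coord d)), ‖fderiv ℝ β (y + h) - fderiv ℝ β y‖ ≤ D * ‖h‖ :=
      fun y _ => by
        have := hD.norm_sub_le (y + h) y
        rwa [add_sub_cancel_left] at this
    have := convex_univ.norm_image_sub_le_of_norm_hasFDerivWithin_le
      (fun y _ => (hd y).hasFDerivWithinAt) hb (mem_univ x) (mem_univ (x + k))
    rw [add_sub_cancel_left] at this
    refine this.trans ?_
    gcongr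
    exact (le_max_right _ _).trans (le_max_right _ _)

/-- The reciprocal is cut off by a bump around 1 that equals 1 on [c, 1] and vanishes below c/2. The
value 0 at 0 preserves compact support under composition; two derivatives make ρ' Lipschitz. -/
lemma exists_smooth_inv {c : ℝ} (h0 : 0 < c) (h1 : c < 1) :
    ∃ ρ : ℝ → ℝ, ContDiff ℝ 2 ρ ∧ HasCompactSupport ρ ∧ ρ 0 = 0 ∧
      ∀ r, c ≤ r → r ≤ 1 → ρ r * r = 1 := by
  let b : ContDiffBump (1 : ℝ) := ⟨1 - c, 1 - c / 2, by linarith, by linarith⟩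
  have hb0 : ∀ r, r ≤ c / 2 → b r = 0 := fun r hr => b.zero_of_le_dist (by
    change 1 - c / 2 ≤ dist r 1
    rw [Real.dist_eq, abs_sub_comm]
    exact le_trans (by linarith) (le_abs_self _))
  refine ⟨fun r => b r * r⁻¹, ?_, ?_, by simp, fun r hr hr1 => ?_⟩
  · rw [contDiff_iff_contDiffAt]
    intro r
    by_cases hr : r < c / 2
    · have : (fun r => b r * r⁻¹) =ᶠ[𝓝 r] fun _ => 0 := by
        filter_upwards [Iio_mem_nhds hr] with x hx
        rw [hb0 x (le_of_lt hx), zero_mul]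
      exact contDiffAt_const.congr_of_eventuallyEq this
    · exact b.contDiff.contDiffAt.mul (contDiffAt_inv ℝ (by linarith))
  · exact b.hasCompactSupport.mul_right
  · have : b r = 1 := b.one_of_mem_closedBall (by
      rw [Metric.mem_closedBall]
      change dist r 1 ≤ 1 - c
      rw [Real.dist_eq, abs_sub_comm, abs_of_nonneg] <;> linarith)
    simp only [this, one_mul]
    exact inv_mul_cancel₀ (by linarith)

/-- This recovers u from ψ_j u where ψ_j ≥ c, by a multiplier defined on all of ℝ^d. It is ρ ∘ χ,
whose derivative is a product of bounded Lipschitz functions. -/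
lemma CompactC11.exists_inv {χ : Coord d → ℝ} (hχ : CompactC11 χ) {c : ℝ} (h0 : 0 < c)
    (h1 : c < 1) : ∃ β, CompactC11 β ∧ ∀ y, c ≤ χ y → χ y ≤ 1 → β y * χ y = 1 := by
  obtain ⟨ρ, hρ, hρc, hρ0, hinv⟩ := exists_smooth_inv h0 h1
  have hρ' : ContDiff ℝ 1 (deriv ρ) :=
    ((contDiff_succ_iff_deriv (n := 1) (f := ρ)).1 (by exact_mod_cast hρ)).2.2
  have hρ1 : ContDiff ℝ 1 ρ := hρ.of_le (by norm_num)
  obtain ⟨L, hL⟩ := hρ'.lipschitzWith_of_hasCompactSupport hρc.deriv one_ne_zero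
  obtain ⟨B, hB⟩ := hρc.deriv.exists_bound_of_continuous hρ'.continuous
  obtain ⟨Lχ, hLχ⟩ := hχ.smooth.lipschitzWith_of_hasCompactSupport hχ.supp one_ne_zero
  obtain ⟨D, hD⟩ := hχ.lip
  obtain ⟨B', hB'⟩ := (hχ.supp.fderiv ℝ).exists_bound_of_continuous
    (hχ.smooth.continuous_fderiv one_ne_zero)
  refine ⟨ρ ∘ χ, ⟨hρ1.comp hχ.smooth, hχ.supp.comp_left hρ0,
    (L * Lχ * B'.toNNReal + B.toNNReal * D), LipschitzWith.of_dist_le_mul fun x y => ?_⟩,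
    fun y hy hy' => hinv _ hy hy'⟩
  have hf : ∀ x, fderiv ℝ (ρ ∘ χ) x = deriv ρ (χ x) • fderiv ℝ χ x := fun x =>
    (((hρ1.differentiable one_ne_zero) (χ x)).hasDerivAt.comp_hasFDerivAt x
      ((hχ.smooth.differentiable one_ne_zero) x).hasFDerivAt).fderiv
  rw [hf, hf, dist_eq_norm]
  have e : deriv ρ (χ x) • fderiv ℝ χ x - deriv ρ (χ y) • fderiv ℝ χ y =
      (deriv ρ (χ x) - deriv ρ (χ y)) • fderiv ℝ χ x +
        deriv ρ (χ y) • (fderiv ℝ χ x - fderiv ℝ χ y) := by module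
  rw [e]
  refine (norm_add_le _ _).trans ?_
  rw [norm_smul, norm_smul]
  push_cast
  rw [add_mul]
  have b1 : ‖deriv ρ (χ x) - deriv ρ (χ y)‖ ≤ L * Lχ * dist x y := by
    rw [← dist_eq_norm]
    exact_mod_cast (hL.comp hLχ).dist_le_mul x y
  have b2 : ‖fderiv ℝ χ x‖ ≤ B'.toNNReal := (hB' x).trans (Real.le_coe_toNNReal _)
  have b3 : ‖deriv ρ (χ y)‖ ≤ B.toNNReal := (hB _).trans (Real.le_coe_toNNReal _)
  have b4 : ‖fderiv ℝ χ x - fderiv ℝ χ y‖ ≤ D * dist x y := by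
    rw [← dist_eq_norm]; exact hD.dist_le_mul x y
  refine add_le_add ?_ ?_
  · calc _ ≤ L * Lχ * dist x y * B'.toNNReal := by gcongr
      _ = _ := by ring
  · calc _ ≤ (B.toNNReal : ℝ) * (D * dist x y) := by gcongr
      _ = _ := by ring

end Multipliers

/-! ### Coordinate changes and Nikolskii bounds -/

section Charts

variable {d : ℕ} {M : Type*} [TopologicalSpace M]

/-- The function `φ ∘ e⁻¹`, extended by zero to `ℝ^d`. -/
noncomputable def chartExt (e : Chart d M) (φ : M → ℝ) : Coord d → ℝ := e.target.indicator (φ ∘ e.symm)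

lemma chartExt_apply {e : Chart d M} {φ : M → ℝ} {x : M} (hx : x ∈ e.source) :
    chartExt e φ (e x) = φ x := by
  rw [chartExt, indicator_of_mem (e.map_source hx), Function.comp_apply, e.left_inv hx]

lemma isCompact_chart_image {e : Chart d M} {K : Set M} (hK : IsCompact K) (hKe : K ⊆ e.source) :
    IsCompact (e '' K) := hK.image_of_continuousOn (e.continuousOn.mono hKe)

lemma chart_image_subset_target {e : Chart d M} {K : Set M} (hKe : K ⊆ e.source) :
    e '' K ⊆ e.target := by
  rintro _ ⟨x, hx, rfl⟩; exact e.map_source (hKe hx)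

lemma chartExt_eq_zero {e : Chart d M} {φ : M → ℝ} {y : Coord d}
    (hy : y ∉ e '' tsupport φ) : chartExt e φ y = 0 := by
  by_cases hyt : y ∈ e.target
  · rw [chartExt, indicator_of_mem hyt]
    exact image_eq_zero_of_notMem_tsupport (f := φ) fun h => hy ⟨_, h, e.right_inv hyt⟩
  · exact indicator_of_notMem hyt _

lemma chartExt_hasCompactSupport [CompactSpace M] {e : Chart d M} {φ : M → ℝ}
    (hφ : tsupport φ ⊆ e.source) : HasCompactSupport (chartExt e φ) :=
  HasCompactSupport.intro (isCompact_chart_image (isClosed_tsupport φ).isCompact hφ)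
    fun _ => chartExt_eq_zero

lemma chartExt_eventuallyEq {e : Chart d M} {φ : M → ℝ} {y : Coord d} (hy : y ∈ e.target) :
    chartExt e φ =ᶠ[𝓝 y] φ ∘ e.symm := by
  filter_upwards [e.open_target.mem_nhds hy] with x hx using indicator_of_mem hx _

lemma chartExt_eventuallyEq_zero [CompactSpace M] {e : Chart d M} {φ : M → ℝ}
    (hφ : tsupport φ ⊆ e.source) {y : Coord d} (hy : y ∉ e.target) :
    chartExt e φ =ᶠ[𝓝 y] fun _ => 0 := by
  have hK := isCompact_chart_image (isClosed_tsupport φ).isCompact hφ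
  filter_upwards [hK.isClosed.isOpen_compl.mem_nhds
    (fun h => hy (chart_image_subset_target hφ h))] with x hx using chartExt_eq_zero hx

/-- The support of φ has a compact image, so the extension vanishes near every point outside the
target, and local regularity becomes global. -/
lemma compactC11_chartExt [CompactSpace M] [ChartedSpace (Coord d) M] {e : Chart d M}
    (he : e ∈ c11Charts d M) {φ : M → ℝ} (hφ : IsC11Function d φ) (hs : tsupport φ ⊆ e.source) :
    CompactC11 (chartExt e φ) := by
  obtain ⟨h1, h2⟩ := hφ e he
  have hc := chartExt_hasCompactSupport hs
  refine ⟨contDiff_iff_contDiffAt.2 fun y => ?_, hc,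
    LocallyLipschitz.exists_lipschitzWith_of_hasCompactSupport (fun y => ?_) (hc.fderiv ℝ)⟩
  · by_cases hy : y ∈ e.target
    · exact (h1.contDiffAt (e.open_target.mem_nhds hy)).congr_of_eventuallyEq
        (chartExt_eventuallyEq hy)
    · exact contDiffAt_const.congr_of_eventuallyEq (chartExt_eventuallyEq_zero hs hy)
  · by_cases hy : y ∈ e.target
    · obtain ⟨C, t, ht, hC⟩ := h2 hy
      rw [e.open_target.nhdsWithin_eq hy] at ht
      have := (chartExt_eventuallyEq (φ := φ) hy).fderiv (𝕜 := ℝ)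
      refine ⟨C, _, inter_mem ht this, fun a ha b hb => ?_⟩
      rw [ha.2, hb.2]
      exact hC ha.1 hb.1
    · have := (chartExt_eventuallyEq_zero hs hy).fderiv (𝕜 := ℝ)
      refine ⟨0, _, this, fun a ha b hb => ?_⟩
      rw [ha, hb]
      simp

lemma mem_transition_source {e e' : Chart d M} {y : Coord d} :
    y ∈ (e.symm.trans e').source ↔ y ∈ e.target ∧ e.symm y ∈ e'.source := Iff.rfl

lemma injOn_transition (e e' : Chart d M) :
    InjOn (e' ∘ e.symm) (e.symm.trans e').source := (e.symm.trans e').injOn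

lemma transition_mem_source {e e' : Chart d M} {y : Coord d}
    (hy : y ∈ (e.symm.trans e').source) : e' (e.symm y) ∈ (e'.symm.trans e).source := by
  obtain ⟨h1, h2⟩ := mem_transition_source.1 hy
  refine mem_transition_source.2 ⟨e'.map_source h2, ?_⟩
  rw [e'.left_inv h2]
  exact e.map_target h1

lemma transition_transition {e e' : Chart d M} {y : Coord d}
    (hy : y ∈ (e.symm.trans e').source) : e (e'.symm (e' (e.symm y))) = y := by
  obtain ⟨h1, h2⟩ := mem_transition_source.1 hy
  rw [e'.left_inv h2, e.right_inv h1]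

variable [ChartedSpace (Coord d) M]

/-- Admissible charts are compared by definition only with the given atlas; near each point the
transition is factored through the preferred chart there. -/
lemma contDiffOn_transition {e e' : Chart d M} (he : e ∈ c11Charts d M)
    (he' : e' ∈ c11Charts d M) : ContDiffOn ℝ 1 (e' ∘ e.symm) (e.symm.trans e').source := by
  intro y hy
  refine ContDiffAt.contDiffWithinAt ?_
  have hy1 : y ∈ e.target := hy.1
  have hy2 : e.symm y ∈ e'.source := hy.2
  set c := chartAt (Coord d) (e.symm y)
  have hc : e.symm y ∈ c.source := mem_chart_source _ _
  have h1 := (he c (chart_mem_atlas _ _)).1.1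
  have h2 := (he' c (chart_mem_atlas _ _)).2.1
  have m1 : y ∈ (e.symm.trans c).source := ⟨hy1, hc⟩
  have m2 : c (e.symm y) ∈ (c.symm.trans e').source :=
    ⟨c.map_source hc, by simpa [c.left_inv hc] using hy2⟩
  have d1 := h1.contDiffAt ((e.symm.trans c).open_source.mem_nhds m1)
  have d2 := h2.contDiffAt ((c.symm.trans e').open_source.mem_nhds m2)
  refine (ContDiffAt.comp y d2 d1).congr_of_eventuallyEq ?_
  filter_upwards [(e.symm.trans c).open_source.mem_nhds m1] with x hx
  have : e.symm x ∈ c.source := hx.2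
  simp [c.left_inv this]

lemma hasFDerivAt_transition {e e' : Chart d M} (he : e ∈ c11Charts d M)
    (he' : e' ∈ c11Charts d M) {y : Coord d} (hy : y ∈ (e.symm.trans e').source) :
    HasFDerivAt (e' ∘ e.symm) (fderiv ℝ (e' ∘ e.symm) y) y :=
  (((contDiffOn_transition he he').contDiffAt
    ((e.symm.trans e').open_source.mem_nhds hy)).differentiableAt one_ne_zero).hasFDerivAt

/-- The coordinate changes do not increase integrals over compact sets by more than a constant
factor. -/
lemma exists_lintegral_comp_transition_le {e e' : Chart d M} (he : e ∈ c11Charts d M)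
    (he' : e' ∈ c11Charts d M) {K : Set (Coord d)} (hK : IsCompact K)
    (hKe : K ⊆ (e.symm.trans e').source) :
    ∃ C : ℝ≥0, ∀ F : Coord d → ℝ≥0∞, ∫⁻ y in K, F (e' (e.symm y)) ≤ C * ∫⁻ p, F p := by
  set W := (e' ∘ e.symm) '' K with hW
  have hWc : IsCompact W :=
    hK.image_of_continuousOn ((contDiffOn_transition he he').continuousOn.mono hKe)
  have hWs : W ⊆ (e'.symm.trans e).source := by
    rintro _ ⟨y, hy, rfl⟩
    exact transition_mem_source (hKe hy)
  have hinv : ∀ y ∈ K, e (e'.symm (e' (e.symm y))) = y := fun y hy =>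
    transition_transition (hKe hy)
  have himg : (e ∘ e'.symm) '' W = K := by
    rw [hW, ← image_comp]
    refine (image_congr fun y hy => ?_).trans (image_id K)
    simp [hinv y hy]
  have hcont : ContinuousOn (fderiv ℝ (e ∘ e'.symm)) W :=
    ((contDiffOn_transition he' he).continuousOn_fderiv_of_isOpen
      (e'.symm.trans e).open_source le_rfl).mono hWs
  -- The Jacobian in the substitution is that of the inverse transition, which is bounded on the
  -- compact image W.
  obtain ⟨B, hB⟩ := hWc.exists_bound_of_continuousOn
    (f := fun p => (fderiv ℝ (e ∘ e'.symm) p).det)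
    (ContinuousLinearMap.continuous_det.comp_continuousOn hcont)
  refine ⟨B.toNNReal, fun F => ?_⟩
  calc ∫⁻ y in K, F (e' (e.symm y))
      = ∫⁻ p in W, ENNReal.ofReal |(fderiv ℝ (e ∘ e'.symm) p).det| *
          F (e' (e.symm ((e ∘ e'.symm) p))) := by
        rw [← lintegral_image_eq_lintegral_abs_det_fderiv_mul volume hWc.measurableSet
          (fun p hp => (hasFDerivAt_transition he' he (hWs hp)).hasFDerivWithinAt)
          ((injOn_transition e' e).mono hWs) (fun y => F (e' (e.symm y))), himg]
    _ ≤ ∫⁻ p in W, B.toNNReal * F p := by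
        refine setLIntegral_mono' hWc.measurableSet fun p hp => ?_
        have : e' (e.symm ((e ∘ e'.symm) p)) = p := transition_transition (hWs hp)
        rw [this]
        gcongr
        exact ENNReal.ofReal_le_ofReal (hB p hp)
    _ = B.toNNReal * ∫⁻ p in W, F p := lintegral_const_mul' _ _ ENNReal.coe_ne_top
    _ ≤ _ := by gcongr; exact Measure.restrict_le_self

/-- A function on `M` whose coordinate expression in one chart belongs to `N^γ_2` does so in any
other chart, after multiplication by a cut-off function. -/
lemma exists_nikBound_transfer [CompactSpace M] {e e' : Chart d M} (he : e ∈ c11Charts d M)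
    (he' : e' ∈ c11Charts d M) {φ χ : M → ℝ} (hφ : tsupport φ ⊆ e.source)
    (hχ : IsC11Function d χ) (hχs : tsupport χ ⊆ e'.source) {γ : ℝ} (hγ0 : 0 < γ) (hγ1 : γ < 1) :
    ∃ D : ℝ, 0 ≤ D ∧ ∀ (z : M → ℝ) (w : Coord d → ℝ) (B : ℝ), 0 ≤ B →
      (∀ x ∉ tsupport φ, z x = 0) → (∀ x ∈ e.source, z x = w (e x)) → NikBound γ w B →
      NikBound γ (e'.target.indicator fun y => χ (e'.symm y) * z (e'.symm y)) (D * B) := by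
  set V := (e'.symm.trans e).source with hV
  set K : Set (Coord d) := e' '' (tsupport φ ∩ tsupport χ) with hKdef
  have hKc : IsCompact K :=
    isCompact_chart_image ((isClosed_tsupport φ).inter (isClosed_tsupport χ)).isCompact
      (inter_subset_right.trans hχs)
  have hKV : K ⊆ V := by
    rintro _ ⟨x, ⟨h1, h2⟩, rfl⟩
    refine mem_transition_source.2 ⟨e'.map_source (hχs h2), ?_⟩
    rw [e'.left_inv (hχs h2)]
    exact hφ h1
  -- K carries the product χz in the coordinates of e'. The margin δ leaves room for shifts of
  -- length at most δ inside the overlap; longer shifts are treated by the triangle inequality.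
  obtain ⟨δ, hδ, hδV⟩ := hKc.exists_cthickening_subset_open (e'.symm.trans e).open_source hKV
  set K' := Metric.cthickening δ K with hK'
  have hK'c : IsCompact K' := hKc.cthickening
  have hKK' : K ⊆ K' := Metric.self_subset_cthickening K
  obtain ⟨C, hC⟩ := exists_lintegral_comp_transition_le he' he hK'c hδV
  obtain ⟨L', hL'⟩ := hK'c.exists_bound_of_continuousOn
    (((contDiffOn_transition he' he).continuousOn_fderiv_of_isOpen
      (e'.symm.trans e).open_source le_rfl).mono hδV)
  -- The maximum with 1 keeps the averaging radius L‖k‖ positive.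
  set L := max L' 1 with hLdef
  have hL1 : 1 ≤ L := le_max_right _ _
  have hL : ∀ y ∈ K', ‖fderiv ℝ (e ∘ e'.symm) y‖ ≤ L := fun y hy => (hL' y hy).trans (le_max_left _ _)
  obtain ⟨c, hc⟩ := (compactC11_chartExt he' hχ hχs).exists_mult
  have hc0 := hc.nonneg
  set T : Coord d → Coord d := fun y => e (e'.symm y) with hTdef
  have hTm : AEMeasurable T (volume.restrict K') :=
    ((contDiffOn_transition he' he).continuousOn.mono hδV).aemeasurable hK'c.measurableSet
  have hTac := map_restrict_absolutelyContinuous hTm hC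
  set E : ℝ := Real.sqrt C with hE
  set E' : ℝ := 2 * Real.sqrt (2 ^ d) * E with hE'
  -- The four terms bound, in this order: the L_2 norm, the differences of w ∘ T for short shifts,
  -- the differences of the cut-off function for short shifts, and the differences for long shifts.
  refine ⟨c * E + c * (E' * (2 * L) ^ γ) + c * E * δ ^ (1 - γ) + 2 * (c * E) * δ ^ (-γ),
    by positivity, ?_⟩
  intro z w B hB hz hzw hw
  set v : Coord d → ℝ := e'.target.indicator fun y => χ (e'.symm y) * z (e'.symm y) with hv
  set a : Coord d → ℝ := K'.indicator fun y => w (T y) with ha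
  have hva : v = chartExt e' χ * a := by
    ext y
    by_cases hy : y ∈ K'
    · obtain ⟨h1, h2⟩ := mem_transition_source.1 (hδV hy)
      simp only [hv, ha, Pi.mul_apply, chartExt, indicator_of_mem h1, indicator_of_mem hy,
        Function.comp_apply]
      rw [hzw _ h2]
    · rw [Pi.mul_apply, ha, indicator_of_notMem hy, mul_zero, hv]
      by_cases hyt : y ∈ e'.target
      · rw [indicator_of_mem hyt]
        by_cases h1 : e'.symm y ∈ tsupport φ
        · have h2 : e'.symm y ∉ tsupport χ := fun h2 =>
            hy (hKK' ⟨_, ⟨h1, h2⟩, e'.right_inv hyt⟩)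
          rw [image_eq_zero_of_notMem_tsupport h2, zero_mul]
        · rw [hz _ h1, mul_zero]
      · exact indicator_of_notMem hyt _
  have hvK : ∀ y ∉ K, v y = 0 := by
    intro y hy
    rw [hv]
    by_cases hyt : y ∈ e'.target
    · rw [indicator_of_mem hyt]
      by_cases h1 : e'.symm y ∈ tsupport φ
      · have h2 : e'.symm y ∉ tsupport χ := fun h2 => hy ⟨_, ⟨h1, h2⟩, e'.right_inv hyt⟩
        rw [image_eq_zero_of_notMem_tsupport h2, zero_mul]
      · rw [hz _ h1, mul_zero]
    · exact indicator_of_notMem hyt _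
  have ham : AEStronglyMeasurable a volume :=
    (aestronglyMeasurable_indicator_iff hK'c.measurableSet).2
      ((hw.1.1.mono_ac hTac).comp_aemeasurable hTm)
  have hE2 : (C : ℝ≥0∞) = ENNReal.ofReal E ^ 2 := by
    rw [hE, ← ENNReal.ofReal_pow (Real.sqrt_nonneg _), Real.sq_sqrt C.coe_nonneg,
      ENNReal.ofReal_coe_nnreal]
  have hE'2 : 4 * 2 ^ d * (C : ℝ≥0∞) = ENNReal.ofReal E' ^ 2 := by
    rw [hE', ENNReal.ofReal_mul (by positivity), ENNReal.ofReal_mul (by positivity), mul_pow,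
      mul_pow, ← hE2, ← ENNReal.ofReal_pow (Real.sqrt_nonneg _), Real.sq_sqrt (by positivity),
      ENNReal.ofReal_pow (by positivity)]
    norm_num
  have haL : L2Le a (E * B) := by
    refine ⟨ham, eLpNorm_two_le_iff.2 ?_⟩
    calc ∫⁻ y, ‖a y‖ₑ ^ 2 = ∫⁻ y in K', ‖w (T y)‖ₑ ^ 2 := by
          rw [← lintegral_indicator hK'c.measurableSet]
          refine lintegral_congr fun y => ?_
          by_cases hy : y ∈ K' <;> simp [ha, hy]
      _ ≤ C * ∫⁻ p, ‖w p‖ₑ ^ 2 := hC fun p => ‖w p‖ₑ ^ 2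
      _ ≤ C * ENNReal.ofReal B ^ 2 := by gcongr; exact eLpNorm_two_le_iff.1 hw.1.2
      _ = _ := by rw [ENNReal.ofReal_mul (Real.sqrt_nonneg _), mul_pow, hE2]
  have hvL : L2Le v (c * (E * B)) := by
    rw [hva]
    exact haL.mul_left hc.cont.aestronglyMeasurable hc.bound hc0
  refine ⟨hvL.mono ?_, fun k => ?_⟩
  · have : 0 ≤ (c * (E' * (2 * L) ^ γ) + c * E * δ ^ (1 - γ) + 2 * (c * E) * δ ^ (-γ)) * B := by
      positivity
    linarith
  rcases eq_or_ne k 0 with rfl | hk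
  · rw [fwdShift_zero]; exact ⟨aestronglyMeasurable_zero, by simp⟩
  have hk' := norm_pos_iff.2 hk
  by_cases hkδ : δ < ‖k‖
  · refine (hvL.fwd (by positivity) k).mono ?_
    have h1 : 1 ≤ δ ^ (-γ) * ‖k‖ ^ γ := by
      rw [Real.rpow_neg hδ.le, ← Real.inv_rpow hδ.le, ← Real.mul_rpow (by positivity) hk'.le]
      refine Real.one_le_rpow ?_ hγ0.le
      rw [inv_mul_eq_div, one_le_div hδ]; exact hkδ.le
    have h2 : 0 ≤ (c * E + c * (E' * (2 * L) ^ γ) + c * E * δ ^ (1 - γ)) * B * ‖k‖ ^ γ := by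
      positivity
    have h3 : 0 ≤ 2 * (c * E) * B := by positivity
    nlinarith
  push Not at hkδ
  set A : Set (Coord d) := K ∪ (fun y => y + k) ⁻¹' K with hA
  have hAm : MeasurableSet A := hKc.measurableSet.union
    (hKc.measurableSet.preimage (measurable_add_const k))
  have hball : ∀ y ∈ A, ∃ p ∈ K, y ∈ Metric.closedBall p δ ∧ y + k ∈ Metric.closedBall p δ := by
    rintro y (hy | hy)
    · exact ⟨y, hy, by simp [hδ.le], by simpa using hkδ⟩
    · exact ⟨y + k, hy, by simpa [dist_eq_norm] using hkδ, by simp [hδ.le]⟩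
  have hAK : ∀ y ∈ A, y ∈ K' ∧ y + k ∈ K' := fun y hy => by
    obtain ⟨p, hp, h1, h2⟩ := hball y hy
    have := Metric.closedBall_subset_cthickening hp δ
    exact ⟨this h1, this h2⟩
  -- Both points lie in one closed ball centred in K. It is convex and contained in the overlap, so
  -- the mean value inequality applies.
  have hAT : ∀ y ∈ A, ‖T (y + k) - T y‖ ≤ L * ‖k‖ := by
    intro y hy
    obtain ⟨p, hp, h1, h2⟩ := hball y hy
    have hsub := Metric.closedBall_subset_cthickening hp δ
    have := (convex_closedBall p δ).norm_image_sub_le_of_norm_hasFDerivWithin_le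
      (f := T) (f' := fderiv ℝ (e ∘ e'.symm)) (C := L)
      (fun q hq => (hasFDerivAt_transition he' he (hδV (hsub hq))).hasFDerivWithinAt)
      (fun q hq => hL q (hsub hq)) h1 h2
    rwa [add_sub_cancel_left] at this
  set b : Coord d → ℝ := A.indicator (fwdShift k a) with hb
  have hbL : L2Le b (E' * (2 * L) ^ γ * B * ‖k‖ ^ γ) := by
    refine ⟨((haL.fwd (by positivity) k).1).indicator hAm, eLpNorm_two_le_iff.2 ?_⟩
    have h1 := lintegral_comp_sub_comp_le hK'c.measurableSet hAm hTm hC hAK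
      (r := L * ‖k‖) (by positivity) hAT hw.1.1 (b := B * (2 * (L * ‖k‖)) ^ γ) (fun m hm =>
        (hw.2 m).mono (by gcongr))
    calc ∫⁻ y, ‖b y‖ₑ ^ 2 = ∫⁻ y in A, ‖w (T (y + k)) - w (T y)‖ₑ ^ 2 := by
          rw [← lintegral_indicator hAm]
          refine lintegral_congr fun y => ?_
          by_cases hy : y ∈ A
          · obtain ⟨h1, h2⟩ := hAK y hy
            simp [hb, hy, fwdShift, ha, h1, h2]
          · simp [hb, hy]
      _ ≤ _ := h1
      _ = _ := by
          rw [hE'2, ← mul_pow, ← ENNReal.ofReal_mul (by positivity), ← mul_assoc 2 L,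
            Real.mul_rpow (by positivity) hk'.le]
          congr 2
          ring
  -- Off A the function v vanishes at both y and y + k, so a and its differences are needed on A
  -- only.
  have hdec : fwdShift k v = (fun y => chartExt e' χ (y + k)) * b +
      fwdShift k (chartExt e' χ) * A.indicator a := by
    ext y
    by_cases hy : y ∈ A
    · rw [hva, fwdShift_mul]
      simp [hb, hy]
    · have h1 : y ∉ K := fun h => hy (Or.inl h)
      have h2 : y + k ∉ K := fun h => hy (Or.inr h)
      simp [hb, hy, fwdShift, hvK _ h1, hvK _ h2]
  have haA : L2Le (A.indicator a) (E * B) := by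
    have := haL.of_le_mul (g := A.indicator a) (c := 1) (haL.1.indicator hAm)
      (ae_of_all _ fun y => by by_cases hy : y ∈ A <;> simp [hy]) zero_le_one
    rwa [one_mul] at this
  rw [hdec]
  have i1 := hbL.mul_left (m := fun y => chartExt e' χ (y + k)) (c := c)
    (hc.cont.comp (continuous_add_const k)).aestronglyMeasurable (fun y => hc.bound _) hc0
  have i2 := haA.mul_left (continuous_fwdShift hc.cont k).aestronglyMeasurable (hc.lip k)
    (by positivity)
  refine (i1.add i2 (by positivity) (by positivity)).mono ?_
  have hkpow : ‖k‖ ≤ δ ^ (1 - γ) * ‖k‖ ^ γ := by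
    calc ‖k‖ = ‖k‖ ^ (1 - γ) * ‖k‖ ^ γ := by rw [← Real.rpow_add hk']; simp
      _ ≤ _ := by gcongr
  have h3 : c * ‖k‖ * (E * B) ≤ c * (δ ^ (1 - γ) * ‖k‖ ^ γ) * (E * B) := by gcongr
  have h4 : 0 ≤ (c * E + 2 * (c * E) * δ ^ (-γ)) * B * ‖k‖ ^ γ := by positivity
  linarith

end Charts

/-! ### Positive definite forms and their duals -/

section Forms

variable {d : ℕ}

lemma sum_smul_stdVec (v : Coord d) : ∑ i, v i • stdVec i = v := by
  ext j
  simp [stdVec, Pi.single_apply]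

lemma bilin_apply_eq_gram (B : Coord d →L[ℝ] Coord d →L[ℝ] ℝ) (v w : Coord d) :
    B v w = v.ofLp ⬝ᵥ (gram B).mulVec w.ofLp := by
  conv_lhs => rw [← sum_smul_stdVec v, ← sum_smul_stdVec w]
  simp only [map_sum, map_smul, sum_apply, smul_apply,
    smul_eq_mul, dotProduct, Matrix.mulVec, gram, Matrix.of_apply, Finset.mul_sum]
  rw [Finset.sum_comm]
  exact Finset.sum_congr rfl fun i _ => Finset.sum_congr rfl fun j _ => by ring

/-- A symmetric, positive definite bilinear form. -/
structure IsInnerForm (B : Coord d →L[ℝ] Coord d →L[ℝ] ℝ) : Prop where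
  symm : ∀ v w, B v w = B w v
  pos : ∀ v, v ≠ 0 → 0 < B v v

namespace IsInnerForm

variable {B : Coord d →L[ℝ] Coord d →L[ℝ] ℝ}

lemma posDef (hB : IsInnerForm B) : (gram B).PosDef := by
  refine Matrix.PosDef.of_dotProduct_mulVec_pos ?_ fun x hx => ?_
  · ext i j
    simpa [gram] using hB.symm _ _
  · have := hB.pos (WithLp.toLp 2 x) (by simpa using hx)
    rw [bilin_apply_eq_gram] at this
    simpa using this

lemma nonneg (hB : IsInnerForm B) (v : Coord d) : 0 ≤ B v v := by
  rcases eq_or_ne v 0 with rfl | hv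
  · simp
  · exact (hB.pos v hv).le

/-- The inverse Gram matrix sends the coordinates of ξ to those of its Riesz vector b. The
properties of `coSq` are then read off from b. -/
lemma coSq_eq (hB : IsInnerForm B) {ξ : Coord d →L[ℝ] ℝ} {b : Coord d}
    (h : ∀ v, B b v = ξ v) : coSq B ξ = ξ b := by
  have h1 : (fun i => ξ (stdVec i)) = (gram B).mulVec b.ofLp := by
    ext i
    rw [← h, hB.symm, bilin_apply_eq_gram]
    simp [stdVec]
  unfold coSq
  rw [h1, Matrix.mulVec_mulVec, Matrix.nonsing_inv_mul _ hB.posDef.det_pos.ne'.isUnit,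
    Matrix.one_mulVec, ← h1, dotProduct]
  conv_rhs => rw [← sum_smul_stdVec b]
  simp [mul_comm]

lemma exists_riesz (hB : IsInnerForm B) (ξ : Coord d →L[ℝ] ℝ) : ∃ b, ∀ v, B b v = ξ v := by
  refine ⟨WithLp.toLp 2 ((gram B)⁻¹.mulVec fun i => ξ (stdVec i)), fun v => ?_⟩
  rw [hB.symm, bilin_apply_eq_gram, Matrix.mulVec_mulVec,
    Matrix.mul_nonsing_inv _ hB.posDef.det_pos.ne'.isUnit, Matrix.one_mulVec, dotProduct]
  conv_rhs => rw [← sum_smul_stdVec v]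
  simp

lemma coSq_nonneg (hB : IsInnerForm B) (ξ : Coord d →L[ℝ] ℝ) : 0 ≤ coSq B ξ := by
  obtain ⟨b, hb⟩ := hB.exists_riesz ξ
  rw [hB.coSq_eq hb, ← hb]
  exact hB.nonneg b

lemma coSq_add_le (hB : IsInnerForm B) (ξ η : Coord d →L[ℝ] ℝ) :
    coSq B (ξ + η) ≤ 2 * coSq B ξ + 2 * coSq B η := by
  obtain ⟨b, hb⟩ := hB.exists_riesz ξ
  obtain ⟨c, hc⟩ := hB.exists_riesz η
  rw [hB.coSq_eq hb, hB.coSq_eq hc, hB.coSq_eq (b := b + c) (fun v => by simp [hb, hc]),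
    add_apply, ← hb, ← hc]
  have h := hB.nonneg (b - c)
  have := hB.symm b c
  have hbb := hb b
  have hcc := hc c
  simp only [map_add, map_sub, sub_apply] at *
  linarith

/-- Cauchy–Schwarz for B, from nonnegativity at the vector B(b, v) b - B(b, b) v. -/
lemma sq_apply_le (hB : IsInnerForm B) (ξ : Coord d →L[ℝ] ℝ) (v : Coord d) :
    ξ v ^ 2 ≤ coSq B ξ * B v v := by
  obtain ⟨b, hb⟩ := hB.exists_riesz ξ
  rw [hB.coSq_eq hb, ← hb, ← hb]
  rcases eq_or_ne b 0 with rfl | h0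
  · simp
  have hp := hB.pos b h0
  have h := hB.nonneg (B b v • b - B b b • v)
  simp only [map_sub, map_smul, sub_apply, smul_apply,
    smul_eq_mul] at h
  rw [hB.symm v b] at h
  have h2 : 0 ≤ B b b * (B b b * B v v - B b v ^ 2) := by nlinarith
  nlinarith [nonneg_of_mul_nonneg_right h2 hp]

/-- This turns energies into Euclidean norms of gradients, uniformly where the metric is bounded. -/
lemma norm_sq_le (hB : IsInnerForm B) (ξ : Coord d →L[ℝ] ℝ) : ‖ξ‖ ^ 2 ≤ ‖B‖ * coSq B ξ := by
  have h0 := hB.coSq_nonneg ξ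
  have : ‖ξ‖ ≤ √(‖B‖ * coSq B ξ) := by
    refine ContinuousLinearMap.opNorm_le_bound _ (Real.sqrt_nonneg _) fun v => ?_
    rw [← Real.sqrt_sq (norm_nonneg v), ← Real.sqrt_mul (by positivity)]
    refine Real.le_sqrt_of_sq_le ?_
    rw [Real.norm_eq_abs, sq_abs]
    have h1 : B v v ≤ ‖B‖ * ‖v‖ * ‖v‖ := (le_abs_self _).trans (B.le_opNorm₂ v v)
    have := hB.sq_apply_le ξ v
    nlinarith
  calc ‖ξ‖ ^ 2 ≤ √(‖B‖ * coSq B ξ) ^ 2 := by gcongr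
    _ = _ := Real.sq_sqrt (by positivity)

end IsInnerForm

/-- D maps the Riesz vector of the pulled-back covector to that of ξ. -/
lemma coSq_comp {B B' : Coord d →L[ℝ] Coord d →L[ℝ] ℝ} (hB : IsInnerForm B)
    (hB' : IsInnerForm B') {D : Coord d →L[ℝ] Coord d} (hD : Function.Surjective D)
    (h : ∀ v w, B v w = B' (D v) (D w)) (ξ : Coord d →L[ℝ] ℝ) :
    coSq B (ξ.comp D) = coSq B' ξ := by
  obtain ⟨b', hb'⟩ := hB'.exists_riesz ξ
  obtain ⟨b, rfl⟩ := hD b'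
  rw [hB'.coSq_eq hb', hB.coSq_eq (b := b) fun v => by rw [h, hb']; rfl]
  rfl

lemma det_gram_comp {B B' : Coord d →L[ℝ] Coord d →L[ℝ] ℝ} {D : Coord d →L[ℝ] Coord d}
    (h : ∀ v w, B v w = B' (D v) (D w)) : (gram B).det = D.det ^ 2 * (gram B').det := by
  set P : Matrix (Fin d) (Fin d) ℝ := LinearMap.toMatrix (EuclideanSpace.basisFun (Fin d) ℝ).toBasis
    (EuclideanSpace.basisFun (Fin d) ℝ).toBasis D with hP
  have hPd : P.det = D.det := LinearMap.det_toMatrix _ _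
  have hPij : ∀ i j, P i j = D (stdVec j) i := fun i j => by
    simp [hP, LinearMap.toMatrix_apply, stdVec]
  have hg : gram B = P.transpose * gram B' * P := by
    ext i j
    have : ∀ k l, gram B k l = B (stdVec k) (stdVec l) := fun _ _ => rfl
    rw [this, h, bilin_apply_eq_gram, Matrix.mul_assoc, Matrix.mul_apply]
    simp only [dotProduct, Matrix.transpose_apply, hPij, Matrix.mul_apply, Matrix.mulVec]
  rw [hg, Matrix.det_mul, Matrix.det_mul, Matrix.det_transpose, hPd]
  ring

lemma continuous_gram : Continuous (gram : (Coord d →L[ℝ] Coord d →L[ℝ] ℝ) → _) := by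
  refine continuous_matrix fun i j => ?_
  change Continuous fun B : Coord d →L[ℝ] Coord d →L[ℝ] ℝ => B (stdVec i) (stdVec j)
  fun_prop

end Forms

/-! ### Chart independence of the cometric -/

section Metric

variable {d : ℕ} {M : Type*} [TopologicalSpace M] [ChartedSpace (Coord d) M]
  (g : RiemMetric d M)

lemma NikolskiiForms.RiemMetric.isInnerForm {e : Chart d M} (he : e ∈ c11Charts d M) {y : Coord d}
    (hy : y ∈ e.target) : IsInnerForm (g.form e y) := ⟨g.symm e he y hy, g.pos e he y hy⟩

lemma surjective_fderiv_transition {e e' : Chart d M} (he : e ∈ c11Charts d M)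
    (he' : e' ∈ c11Charts d M) {y : Coord d} (hy : y ∈ (e.symm.trans e').source) :
    Function.Surjective (fderiv ℝ (e' ∘ e.symm) y) := by
  have h1 := hasFDerivAt_transition he he' hy
  have hy' := transition_mem_source hy
  have h2 := hasFDerivAt_transition he' he hy'
  have hback := transition_transition hy
  have h3 : HasFDerivAt ((e' ∘ e.symm) ∘ (e ∘ e'.symm))
      ((fderiv ℝ (e' ∘ e.symm) y).comp (fderiv ℝ (e ∘ e'.symm) (e' (e.symm y))))
      (e' (e.symm y)) := by
    refine HasFDerivAt.comp _ ?_ h2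
    simp only [Function.comp_apply, hback]
    exact h1
  have h4 : (e' ∘ e.symm) ∘ (e ∘ e'.symm) =ᶠ[𝓝 (e' (e.symm y))] id := by
    filter_upwards [(e'.symm.trans e).open_source.mem_nhds hy'] with x hx
      using transition_transition hx
  have h5 := (h3.congr_of_eventuallyEq h4.symm).unique (hasFDerivAt_id _)
  intro v
  exact ⟨_, congrArg (fun D : Coord d →L[ℝ] Coord d => D v) h5⟩

variable (hM : IsC11Manifold d M)
include hM

lemma chartAt_mem_c11Charts (x : M) : chartAt (Coord d) x ∈ c11Charts d M :=
  fun e' he' => hM _ (chart_mem_atlas _ _) e' he'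

/-- The cometric is defined by the preferred chart at each point, which jumps from point to point;
by invariance under pullback it may be computed in one admissible chart. -/
lemma NikolskiiForms.RiemMetric.cometric_eq {e : Chart d M} (he : e ∈ c11Charts d M)
    (ξ : M → (Coord d →L[ℝ] ℝ)) {x : M} (hx : x ∈ e.source) :
    g.cometric x (ξ x) = coSq (g.form e (e x)) (covectorIn e ξ (e x)) := by
  have hc := chartAt_mem_c11Charts hM x
  have hxc := mem_chart_source (Coord d) x
  have hy : e x ∈ (e.symm.trans (chartAt (Coord d) x)).source :=
    mem_transition_source.2 ⟨e.map_source hx, by rw [e.left_inv hx]; exact hxc⟩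
  have ht := g.transform e he _ hc (e x) hy
  unfold covectorIn RiemMetric.cometric
  rw [e.left_inv hx] at *
  exact (coSq_comp (g.isInnerForm he (e.map_source hx))
    (g.isInnerForm hc ((chartAt (Coord d) x).map_source hxc))
    (surjective_fderiv_transition he hc hy) ht _).symm

lemma covectorIn_classicalDifferential {e : Chart d M} (he : e ∈ c11Charts d M) {p : M → ℝ}
    (hp : IsC11Function d p) {y : Coord d} (hy : y ∈ e.target) :
    covectorIn e (classicalDifferential p) y = fderiv ℝ (p ∘ e.symm) y := by
  set x := e.symm y with hx
  set c := chartAt (Coord d) x with hcdef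
  have hc : c ∈ c11Charts d M := chartAt_mem_c11Charts hM x
  have hxc : x ∈ c.source := mem_chart_source (Coord d) x
  have hyc : y ∈ (e.symm.trans c).source := mem_transition_source.2 ⟨hy, hxc⟩
  have h1 := hasFDerivAt_transition he hc hyc
  have h2 : HasFDerivAt (p ∘ c.symm) (fderiv ℝ (p ∘ c.symm) (c x)) (c x) :=
    ((((hp c hc).1).contDiffAt (c.open_target.mem_nhds (c.map_source hxc))).differentiableAt
      one_ne_zero).hasFDerivAt
  have h3 := (HasFDerivAt.comp y (f := c ∘ e.symm) h2 h1).congr_of_eventuallyEq (f₁ := p ∘ e.symm)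
    (by
      filter_upwards [(e.symm.trans c).open_source.mem_nhds hyc] with y' hy'
      simp only [Function.comp_apply]
      rw [c.left_inv (mem_transition_source.1 hy').2])
  exact h3.fderiv.symm

end Metric

/-! ### The Riemannian volume in coordinates -/

section Volume

variable {d : ℕ} {M : Type*} [TopologicalSpace M] [ChartedSpace (Coord d) M]
  (g : RiemMetric d M)

/-- The density `√(det g_{ij})` of the Riemannian volume in a chart. -/
noncomputable def volDensity (e : Chart d M) (y : Coord d) : ℝ := √(gram (g.form e y)).det

lemma continuousOn_volDensity {e : Chart d M} (he : e ∈ c11Charts d M) :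
    ContinuousOn (volDensity g e) e.target :=
  (Real.continuous_sqrt.comp (continuous_gram.matrix_det)).comp_continuousOn (g.cont e he)

lemma volDensity_pos {e : Chart d M} (he : e ∈ c11Charts d M) {y : Coord d} (hy : y ∈ e.target) :
    0 < volDensity g e y :=
  Real.sqrt_pos.2 (g.isInnerForm he hy).posDef.det_pos

lemma volDensity_transition {e e' : Chart d M} (he : e ∈ c11Charts d M)
    (he' : e' ∈ c11Charts d M) {y : Coord d} (hy : y ∈ (e.symm.trans e').source) :
    volDensity g e y = |(fderiv ℝ (e' ∘ e.symm) y).det| * volDensity g e' (e' (e.symm y)) := by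
  unfold volDensity
  rw [det_gram_comp (g.transform e he e' he' y hy), Real.sqrt_mul (sq_nonneg _),
    Real.sqrt_sq_eq_abs]

variable [MeasurableSpace M] [BorelSpace M]

/-- The Riemannian volume on the target of a chart. -/
noncomputable def targetVolume (e : Chart d M) : Measure (Coord d) :=
  (volume.restrict e.target).withDensity fun y => ENNReal.ofReal (volDensity g e y)

lemma chartVolume_eq (e : Chart d M) :
    g.chartVolume e = Measure.map e.symm (targetVolume g e) := rfl

lemma aemeasurable_volDensity {e : Chart d M} (he : e ∈ c11Charts d M) :
    AEMeasurable (fun y => ENNReal.ofReal (volDensity g e y)) (volume.restrict e.target) :=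
  ((continuousOn_volDensity g he).aemeasurable e.open_target.measurableSet).ennreal_ofReal

lemma aemeasurable_chart_symm (e : Chart d M) :
    AEMeasurable e.symm (volume.restrict e.target) :=
  e.continuousOn_symm.aemeasurable e.open_target.measurableSet

lemma targetVolume_ac (e : Chart d M) : targetVolume g e ≪ volume.restrict e.target :=
  withDensity_absolutelyContinuous _ _

lemma ac_targetVolume {e : Chart d M} (he : e ∈ c11Charts d M) :
    volume.restrict e.target ≪ targetVolume g e := by
  refine withDensity_absolutelyContinuous' (aemeasurable_volDensity g he) ?_
  filter_upwards [ae_restrict_mem e.open_target.measurableSet] with y hy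
  simpa using volDensity_pos g he hy

lemma aemeasurable_chart_symm_targetVolume (e : Chart d M) :
    AEMeasurable e.symm (targetVolume g e) :=
  (aemeasurable_chart_symm e).mono_ac (targetVolume_ac g e)

lemma chartVolume_le_vol {e : Chart d M} (he : e ∈ c11Charts d M) : g.chartVolume e ≤ g.vol :=
  le_iSup₂ (f := fun (e : Chart d M) (_ : e ∈ c11Charts d M) => g.chartVolume e) e he

lemma measurableSet_target_inter_preimage (e : Chart d M) {S : Set M} (hS : MeasurableSet S) :
    MeasurableSet (e.target ∩ e.symm ⁻¹' S) := by
  have h := (e.continuousOn_symm.domRestrict).measurable hS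
  have := (MeasurableEmbedding.subtype_coe e.open_target.measurableSet).measurableSet_image.2 h
  convert this using 1
  ext y
  simp [domRestrict, and_comm]

lemma chartVolume_apply (e : Chart d M) {S : Set M}
    (hS : MeasurableSet S) :
    g.chartVolume e S = ∫⁻ y in e.target ∩ e.symm ⁻¹' S, ENNReal.ofReal (volDensity g e y) := by
  rw [chartVolume_eq, Measure.map_apply_of_aemeasurable
    (aemeasurable_chart_symm_targetVolume g e) hS]
  have hD := measurableSet_target_inter_preimage e hS
  have h0 : targetVolume g e (e.symm ⁻¹' S) = targetVolume g e (e.target ∩ e.symm ⁻¹' S) := by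
    refine measure_congr ?_
    filter_upwards [(targetVolume_ac g e).ae_le (ae_restrict_mem e.open_target.measurableSet)]
      with y hy
    exact propext ⟨fun h => ⟨hy, h⟩, fun h => h.2⟩
  rw [h0, targetVolume, withDensity_apply _ hD, Measure.restrict_restrict hD,
    inter_eq_self_of_subset_left inter_subset_left]

/-- By the change of variables formula, the volumes in two charts agree on the overlap. -/
lemma chartVolume_apply_le {e e' : Chart d M} (he : e ∈ c11Charts d M) (he' : e' ∈ c11Charts d M)
    {S : Set M} (hS : MeasurableSet S) (hSe : S ⊆ e.source) :
    g.chartVolume e' S ≤ g.chartVolume e S := by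
  rw [chartVolume_apply g e hS, chartVolume_apply g e' hS]
  set D := e'.target ∩ e'.symm ⁻¹' S
  have hD : MeasurableSet D := measurableSet_target_inter_preimage e' hS
  have hDs : D ⊆ (e'.symm.trans e).source := fun y hy =>
    mem_transition_source.2 ⟨hy.1, hSe hy.2⟩
  have himg : (e ∘ e'.symm) '' D ⊆ e.target ∩ e.symm ⁻¹' S := by
    rintro _ ⟨y, hy, rfl⟩
    refine ⟨e.map_source (hSe hy.2), ?_⟩
    have : e.symm (e (e'.symm y)) = e'.symm y := e.left_inv (hSe hy.2)
    rw [mem_preimage, Function.comp_apply, this]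
    exact hy.2
  calc ∫⁻ y in D, ENNReal.ofReal (volDensity g e' y)
      = ∫⁻ y in D, ENNReal.ofReal |(fderiv ℝ (e ∘ e'.symm) y).det| *
          ENNReal.ofReal (volDensity g e ((e ∘ e'.symm) y)) := by
        refine setLIntegral_congr_fun hD fun y hy => ?_
        rw [volDensity_transition g he' he (hDs hy), ENNReal.ofReal_mul (abs_nonneg _)]
        rfl
    _ = ∫⁻ y in (e ∘ e'.symm) '' D, ENNReal.ofReal (volDensity g e y) :=
        (lintegral_image_eq_lintegral_abs_det_fderiv_mul volume hD
          (fun p hp => (hasFDerivAt_transition he' he (hDs hp)).hasFDerivWithinAt)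
          ((injOn_transition e' e).mono hDs) (fun y => ENNReal.ofReal (volDensity g e y))).symm
    _ ≤ _ := lintegral_mono_set himg

lemma vol_restrict_source_le {e : Chart d M} (he : e ∈ c11Charts d M) :
    g.vol.restrict e.source ≤ g.chartVolume e := by
  have hs := e.open_source.measurableSet
  -- As `vol` is a least upper bound, it suffices that the right-hand side dominates each chart
  -- volume: on `e.source` by change of variables, and trivially elsewhere. Restricted to
  -- `e.source`, the second summand disappears.
  have h1 : g.vol ≤ g.chartVolume e + g.vol.restrict e.sourceᶜ := by
    refine iSup₂_le fun e' he' => ?_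
    rw [← Measure.restrict_add_restrict_compl (μ := g.chartVolume e') hs]
    refine add_le_add ?_ (Measure.restrict_mono le_rfl (chartVolume_le_vol g he'))
    refine Measure.le_iff.2 fun S hS => ?_
    rw [Measure.restrict_apply hS]
    exact (chartVolume_apply_le g he he' (hS.inter hs) inter_subset_right).trans
      (measure_mono inter_subset_left)
  refine Measure.le_iff.2 fun S hS => ?_
  rw [Measure.restrict_apply hS]
  refine (h1 _).trans ?_
  rw [Measure.add_apply, Measure.restrict_apply (hS.inter hs)]
  have : S ∩ e.source ∩ e.sourceᶜ = ∅ := by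
    ext x; simp only [mem_inter_iff, mem_compl_iff, mem_empty_iff_false]; tauto
  rw [this, measure_empty, add_zero]
  exact measure_mono inter_subset_left

/-- On compact subsets of a chart, Lebesgue measure is dominated by the Riemannian volume. -/
lemma exists_restrict_le_smul_targetVolume {e : Chart d M} (he : e ∈ c11Charts d M)
    {K : Set (Coord d)} (hK : IsCompact K) (hKe : K ⊆ e.target) :
    ∃ C : ℝ≥0, volume.restrict K ≤ (C : ℝ≥0∞) • targetVolume g e := by
  obtain ⟨B, hB⟩ := hK.exists_bound_of_continuousOn
    ((continuousOn_volDensity g he).mono hKe |>.inv₀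
      (fun y hy => (volDensity_pos g he (hKe hy)).ne'))
  refine ⟨B.toNNReal, Measure.le_iff.2 fun S hS => ?_⟩
  rw [Measure.restrict_apply hS, Measure.smul_apply, smul_eq_mul, targetVolume,
    withDensity_apply _ hS]
  calc volume (S ∩ K) = ∫⁻ y in S ∩ K, 1 := by simp
    _ ≤ ∫⁻ y in S ∩ K, B.toNNReal * ENNReal.ofReal (volDensity g e y) := by
        refine setLIntegral_mono' (hS.inter hK.measurableSet) fun y hy => ?_
        have hp := volDensity_pos g he (hKe hy.2)
        have h1 := hB y hy.2
        rw [Pi.inv_apply, norm_inv, Real.norm_eq_abs, abs_of_pos hp, inv_le_iff_one_le_mul₀ hp] at h1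
        have hB0 : 0 ≤ B := (norm_nonneg _).trans (hB y hy.2)
        have h2 : (B.toNNReal : ℝ≥0∞) = ENNReal.ofReal B := rfl
        rw [h2, ← ENNReal.ofReal_mul hB0]
        exact ENNReal.one_le_ofReal.2 h1
    _ = B.toNNReal * ∫⁻ y in S ∩ K, ENNReal.ofReal (volDensity g e y) :=
        lintegral_const_mul' _ _ ENNReal.coe_ne_top
    _ ≤ _ := by
        rw [Measure.restrict_restrict hS]
        exact mul_le_mul_right (lintegral_mono_set (inter_subset_inter_right _ hKe)) _

/-- On compact subsets of a chart, the Riemannian volume is dominated by Lebesgue measure. -/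
lemma exists_targetVolume_restrict_le {e : Chart d M} (he : e ∈ c11Charts d M)
    {K : Set (Coord d)} (hK : IsCompact K) (hKe : K ⊆ e.target) :
    ∃ C : ℝ≥0, (targetVolume g e).restrict K ≤ (C : ℝ≥0∞) • volume.restrict K := by
  obtain ⟨B, hB⟩ := hK.exists_bound_of_continuousOn ((continuousOn_volDensity g he).mono hKe)
  refine ⟨B.toNNReal, Measure.le_iff.2 fun S hS => ?_⟩
  have hSK := hS.inter hK.measurableSet
  rw [Measure.restrict_apply hS, Measure.smul_apply, smul_eq_mul, targetVolume,
    withDensity_apply _ hSK, Measure.restrict_apply hS, Measure.restrict_restrict hSK]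
  calc _ ≤ ∫⁻ y in S ∩ K, ENNReal.ofReal (volDensity g e y) := lintegral_mono_set inter_subset_left
    _ ≤ ∫⁻ y in S ∩ K, B.toNNReal := by
        refine setLIntegral_mono' hSK fun y hy => ?_
        exact ENNReal.ofReal_le_ofReal ((le_abs_self _).trans (hB y hy.2))
    _ = _ := by simp

lemma AEStronglyMeasurable.comp_chart_symm {e : Chart d M} (he : e ∈ c11Charts d M) {u : M → ℝ}
    (hu : AEStronglyMeasurable u g.vol) :
    AEStronglyMeasurable (u ∘ e.symm) (volume.restrict e.target) :=
  ((hu.mono_measure (chartVolume_le_vol g he)).comp_aemeasurable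
    (aemeasurable_chart_symm_targetVolume g e)).mono_ac (ac_targetVolume g he)

lemma lintegral_chartVolume {e : Chart d M} (he : e ∈ c11Charts d M) {F : M → ℝ≥0∞}
    (hF : AEMeasurable F g.vol) :
    ∫⁻ x, F x ∂g.chartVolume e = ∫⁻ y, F (e.symm y) ∂targetVolume g e :=
  lintegral_map' (μ := targetVolume g e) (hF.mono_measure (chartVolume_le_vol g he))
    (aemeasurable_chart_symm_targetVolume g e)

/-- Upper bound for integrals in coordinates. -/
lemma exists_lintegral_comp_symm_le {e : Chart d M} (he : e ∈ c11Charts d M)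
    {K : Set (Coord d)} (hK : IsCompact K) (hKe : K ⊆ e.target) :
    ∃ C : ℝ≥0, ∀ F : M → ℝ≥0∞, AEMeasurable F g.vol →
      ∫⁻ y in K, F (e.symm y) ≤ C * ∫⁻ x, F x ∂g.vol := by
  obtain ⟨C, hC⟩ := exists_restrict_le_smul_targetVolume g he hK hKe
  refine ⟨C, fun F hF => ?_⟩
  calc ∫⁻ y in K, F (e.symm y) ≤ ∫⁻ y, F (e.symm y) ∂((C : ℝ≥0∞) • targetVolume g e) :=
        lintegral_mono' hC le_rfl
    _ = C * ∫⁻ x, F x ∂g.chartVolume e := by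
        rw [lintegral_smul_measure, lintegral_chartVolume g he hF, smul_eq_mul]
    _ ≤ _ := by gcongr; exact chartVolume_le_vol g he

/-- Upper bound for integrals on the manifold. -/
lemma exists_lintegral_vol_le {e : Chart d M} (he : e ∈ c11Charts d M)
    {K : Set M} (hK : IsCompact K) (hKe : K ⊆ e.source) :
    ∃ C : ℝ≥0, ∀ F : M → ℝ≥0∞, AEMeasurable F g.vol → (∀ x ∉ K, F x = 0) →
      ∫⁻ x, F x ∂g.vol ≤ C * ∫⁻ y in e '' K, F (e.symm y) := by
  have hK' := isCompact_chart_image hK hKe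
  obtain ⟨C, hC⟩ := exists_targetVolume_restrict_le g he hK' (chart_image_subset_target hKe)
  refine ⟨C, fun F hF h0 => ?_⟩
  calc ∫⁻ x, F x ∂g.vol = ∫⁻ x in e.source, F x ∂g.vol := by
        rw [← lintegral_indicator e.open_source.measurableSet]
        refine lintegral_congr fun x => ?_
        by_cases hx : x ∈ e.source
        · rw [indicator_of_mem hx]
        · rw [indicator_of_notMem hx, h0 x fun h => hx (hKe h)]
    _ ≤ ∫⁻ x, F x ∂g.chartVolume e := lintegral_mono' (vol_restrict_source_le g he) le_rfl
    _ = ∫⁻ y, F (e.symm y) ∂targetVolume g e := lintegral_chartVolume g he hF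
    _ = ∫⁻ y in e '' K, F (e.symm y) ∂targetVolume g e := by
        rw [← lintegral_indicator hK'.measurableSet]
        refine lintegral_congr_ae ?_
        filter_upwards [(targetVolume_ac g e).ae_le (ae_restrict_mem e.open_target.measurableSet)]
          with y hy
        by_cases hyK : y ∈ e '' K
        · rw [indicator_of_mem hyK]
        · rw [indicator_of_notMem hyK, h0 _ fun h => hyK ⟨_, h, e.right_inv hy⟩]
    _ ≤ ∫⁻ y, F (e.symm y) ∂((C : ℝ≥0∞) • volume.restrict (e '' K)) := lintegral_mono' hC le_rfl
    _ = _ := by rw [lintegral_smul_measure, smul_eq_mul]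

lemma vol_lt_top_of_isCompact {e : Chart d M} (he : e ∈ c11Charts d M) [T2Space M]
    {K : Set M} (hK : IsCompact K) (hKe : K ⊆ e.source) : g.vol K < ∞ := by
  obtain ⟨C, hC⟩ := exists_lintegral_vol_le g he hK hKe
  have h := hC (K.indicator 1) (measurable_one.indicator hK.measurableSet).aemeasurable
    (fun x hx => indicator_of_notMem hx _)
  rw [lintegral_indicator_one hK.measurableSet] at h
  refine h.trans_lt (ENNReal.mul_lt_top ENNReal.coe_lt_top ?_)
  calc _ ≤ ∫⁻ y in e '' K, 1 := by
        refine lintegral_mono fun y => ?_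
        exact indicator_le_self' (fun _ _ => zero_le_one) _
    _ < ∞ := by simpa using (isCompact_chart_image hK hKe).measure_lt_top

lemma iUnion_tsupport_eq (A : FiniteAtlas d M) : ⋃ i, tsupport (A.ψ i) = univ := by
  refine eq_univ_of_forall fun x => ?_
  obtain ⟨i, hi⟩ := A.ψ.exists_pos (mem_univ x)
  exact mem_iUnion.2 ⟨i, subset_tsupport _ hi.ne'⟩

lemma isFiniteMeasure_vol [T2Space M] [CompactSpace M] (A : FiniteAtlas d M) :
    IsFiniteMeasure g.vol := by
  refine ⟨?_⟩
  rw [← iUnion_tsupport_eq A]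
  refine (measure_iUnion_le _).trans_lt ?_
  rw [tsum_fintype]
  exact ENNReal.sum_lt_top.2 fun i _ => vol_lt_top_of_isCompact g (A.chart_mem i)
    (isClosed_tsupport _).isCompact (A.subordinate i)

end Volume

/-! ### Energies and approximation in H̊¹(Ω) -/

section Energy

variable {d : ℕ} {M : Type*} [TopologicalSpace M] [ChartedSpace (Coord d) M]
  (g : RiemMetric d M)

lemma continuousOn_inv_gram {e : Chart d M} (he : e ∈ c11Charts d M) (i j : Fin d) :
    ContinuousOn (fun y => (gram (g.form e y))⁻¹ i j) e.target := by
  have h1 : ContinuousOn (fun y => (gram (g.form e y)).det) e.target :=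
    continuous_gram.matrix_det.comp_continuousOn (g.cont e he)
  have h2 : ContinuousOn (fun y => (gram (g.form e y)).adjugate i j) e.target :=
    (continuous_gram.matrix_adjugate.matrix_elem i j).comp_continuousOn (g.cont e he)
  simp only [Matrix.inv_def, Matrix.smul_apply, Ring.inverse_eq_inv', smul_eq_mul]
  exact (h1.inv₀ fun y hy => (g.isInnerForm he hy).posDef.det_pos.ne').mul h2

lemma continuousOn_coSq {e : Chart d M} (he : e ∈ c11Charts d M)
    {ξ : Coord d → (Coord d →L[ℝ] ℝ)} (hξ : ContinuousOn ξ e.target) :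
    ContinuousOn (fun y => coSq (g.form e y) (ξ y)) e.target := by
  unfold coSq Matrix.mulVec dotProduct
  have h : ∀ i, ContinuousOn (fun y => ξ y (stdVec i)) e.target := fun i =>
    hξ.clm_apply continuousOn_const
  exact continuousOn_finsetSum _ fun i _ => (h i).mul (continuousOn_finsetSum _ fun j _ =>
    (continuousOn_inv_gram g he i j).mul (h j))

lemma aemeasurable_coSq {e : Chart d M} (he : e ∈ c11Charts d M)
    {ξ : Coord d → (Coord d →L[ℝ] ℝ)} (hξ : AEStronglyMeasurable ξ (volume.restrict e.target)) :
    AEMeasurable (fun y => coSq (g.form e y) (ξ y)) (volume.restrict e.target) := by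
  unfold coSq Matrix.mulVec dotProduct
  have h : ∀ i, AEMeasurable (fun y => ξ y (stdVec i)) (volume.restrict e.target) := fun i =>
    ((ContinuousLinearMap.apply ℝ ℝ (stdVec i)).continuous.comp_aestronglyMeasurable hξ).aemeasurable
  exact Finset.aemeasurable_fun_sum _ fun i _ => (h i).mul (Finset.aemeasurable_fun_sum _
    fun j _ => ((continuousOn_inv_gram g he i j).aemeasurable e.open_target.measurableSet).mul (h j))

lemma coSq_neg (B : Coord d →L[ℝ] Coord d →L[ℝ] ℝ) (ξ : Coord d →L[ℝ] ℝ) :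
    coSq B (-ξ) = coSq B ξ := by
  have : (fun i => (-ξ) (stdVec i)) = -fun i => ξ (stdVec i) := rfl
  rw [coSq, this, Matrix.mulVec_neg, neg_dotProduct_neg, coSq]

lemma coSq_zero (B : Coord d →L[ℝ] Coord d →L[ℝ] ℝ) : coSq B 0 = 0 := by
  have : (fun i => (0 : Coord d →L[ℝ] ℝ) (stdVec i)) = 0 := rfl
  rw [coSq, this, zero_dotProduct]

lemma classicalDifferential_eq_zero {p : M → ℝ} {x : M} (hx : x ∉ tsupport p) :
    classicalDifferential (d := d) p x = 0 := by
  set c := chartAt (Coord d) x with hc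
  have hxc : x ∈ c.source := mem_chart_source (Coord d) x
  have h1 : p =ᶠ[𝓝 x] fun _ => 0 := notMem_tsupport_iff_eventuallyEq.1 hx
  have h2 : Tendsto c.symm (𝓝 (c x)) (𝓝 x) := by
    have := c.continuousAt_symm (c.map_source hxc)
    rwa [ContinuousAt, c.left_inv hxc] at this
  have h3 : p ∘ c.symm =ᶠ[𝓝 (c x)] fun _ => 0 := h2.eventually h1
  unfold classicalDifferential
  rw [← hc, h3.fderiv_eq]
  simp

section Smooth

variable (hM : IsC11Manifold d M)
include hM

lemma NikolskiiForms.RiemMetric.cometric_nonneg (x : M) (ξ : Coord d →L[ℝ] ℝ) :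
    0 ≤ g.cometric x ξ :=
  (g.isInnerForm (chartAt_mem_c11Charts hM x) (mem_chart_target _ x)).coSq_nonneg ξ

lemma NikolskiiForms.RiemMetric.cometric_add_le (x : M) (ξ η : Coord d →L[ℝ] ℝ) :
    g.cometric x (ξ + η) ≤ 2 * g.cometric x ξ + 2 * g.cometric x η :=
  (g.isInnerForm (chartAt_mem_c11Charts hM x) (mem_chart_target _ x)).coSq_add_le ξ η

lemma ofReal_cometric_add_le (x : M) (ξ η : Coord d →L[ℝ] ℝ) :
    ENNReal.ofReal (g.cometric x (ξ + η)) ≤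
      2 * ENNReal.ofReal (g.cometric x ξ) + 2 * ENNReal.ofReal (g.cometric x η) := by
  have h1 := g.cometric_nonneg hM x ξ
  have h2 := g.cometric_nonneg hM x η
  refine (ENNReal.ofReal_le_ofReal (g.cometric_add_le hM x ξ η)).trans (le_of_eq ?_)
  rw [ENNReal.ofReal_add (by positivity) (by positivity), ENNReal.ofReal_mul zero_le_two,
    ENNReal.ofReal_mul zero_le_two, ENNReal.ofReal_ofNat]

lemma cometric_classicalDifferential_eq {e : Chart d M} (he : e ∈ c11Charts d M) {p : M → ℝ}
    (hp : IsC11Function d p) {x : M} (hx : x ∈ e.source) :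
    g.cometric x (classicalDifferential p x) =
      coSq (g.form e (e x)) (fderiv ℝ (p ∘ e.symm) (e x)) := by
  rw [g.cometric_eq hM he _ hx, covectorIn_classicalDifferential hM he hp (e.map_source hx)]

lemma continuous_cometric_classicalDifferential {p : M → ℝ} (hp : IsC11Function d p) :
    Continuous fun x => g.cometric x (classicalDifferential p x) := by
  rw [continuous_iff_continuousAt]
  intro x
  set e := chartAt (Coord d) x
  have he : e ∈ c11Charts d M := chartAt_mem_c11Charts hM x
  have hx : x ∈ e.source := mem_chart_source (Coord d) x
  have h1 := continuousOn_coSq g he ((hp e he).1.continuousOn_fderiv_of_isOpen e.open_target le_rfl)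
  have h2 := (h1.continuousAt (e.open_target.mem_nhds (e.map_source hx))).comp (e.continuousAt hx)
  refine h2.congr ?_
  filter_upwards [e.open_source.mem_nhds hx] with x' hx'
  exact (cometric_classicalDifferential_eq g hM he hp hx').symm

variable [MeasurableSpace M] [BorelSpace M]

lemma energy_classicalDifferential_lt_top [T2Space M] [CompactSpace M] (A : FiniteAtlas d M)
    {p : M → ℝ} (hp : IsC11Function d p) :
    g.energy univ (classicalDifferential p) < ∞ := by
  have := isFiniteMeasure_vol g A
  obtain ⟨B, hB⟩ := isCompact_univ.exists_bound_of_continuousOn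
    (continuous_cometric_classicalDifferential g hM hp).continuousOn
  unfold RiemMetric.energy
  calc _ ≤ ∫⁻ x in univ, ENNReal.ofReal B ∂g.vol := by
        refine lintegral_mono fun x => ENNReal.ofReal_le_ofReal ?_
        exact (le_abs_self _).trans (hB x (mem_univ x))
    _ < ∞ := by
        rw [lintegral_const]
        exact ENNReal.mul_lt_top ENNReal.ofReal_lt_top (measure_lt_top _ _)

/-- Coordinate functions known up to Lebesgue null sets can therefore be pulled back to M. -/
lemma map_vol_restrict_source_ac {e : Chart d M} (he : e ∈ c11Charts d M) :
    Measure.map e (g.vol.restrict e.source) ≪ volume.restrict e.target := by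
  have hem : AEMeasurable e (g.vol.restrict e.source) :=
    e.continuousOn.aemeasurable e.open_source.measurableSet
  refine Measure.AbsolutelyContinuous.mk fun N hN h0 => ?_
  rw [Measure.map_apply_of_aemeasurable hem hN, ← nonpos_iff_eq_zero]
  have hS : MeasurableSet (e.source ∩ e ⁻¹' N) := by
    have h := (e.continuousOn.domRestrict).measurable hN
    have := (MeasurableEmbedding.subtype_coe e.open_source.measurableSet).measurableSet_image.2 h
    convert this using 1
    ext y
    simp [domRestrict, and_comm]
  rw [Measure.restrict_apply₀' e.open_source.measurableSet.nullMeasurableSet, inter_comm]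
  have h1 := (vol_restrict_source_le g he) (e.source ∩ e ⁻¹' N)
  rw [Measure.restrict_apply hS, inter_eq_self_of_subset_left inter_subset_left,
    chartVolume_apply g e hS] at h1
  refine h1.trans (le_of_eq ?_)
  refine setLIntegral_measure_zero _ _ (measure_mono_null ?_
    ((Measure.restrict_apply hN).symm.trans h0))
  rintro y ⟨hy, hy'⟩
  refine ⟨?_, hy⟩
  have : e (e.symm y) ∈ N := hy'.2
  rwa [e.right_inv hy] at this

/-- Weak differentials are measurable only in coordinates, so measurability is checked on each of
the finitely many chart domains. -/
lemma aemeasurable_cometric (A : FiniteAtlas d M) {u : M → ℝ} {ξ : M → (Coord d →L[ℝ] ℝ)}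
    (hu : HasWeakDifferential u ξ) :
    AEMeasurable (fun x => g.cometric x (ξ x)) g.vol := by
  have hcov : ⋃ i, (A.chart i).source = univ :=
    univ_subset_iff.1 ((iUnion_tsupport_eq A).symm.subset.trans
      (iUnion_mono fun i => A.subordinate i))
  rw [← Measure.restrict_univ (μ := g.vol), ← hcov, aemeasurable_iUnion_iff]
  intro i
  set e := A.chart i
  have he := A.chart_mem i
  have h1 := aemeasurable_coSq g he ((hu e he).2.1.aestronglyMeasurable)
  have h2 := (h1.mono_ac (map_vol_restrict_source_ac g hM he)).comp_aemeasurable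
    (e.continuousOn.aemeasurable e.open_source.measurableSet)
  refine h2.congr ?_
  filter_upwards [ae_restrict_mem e.open_source.measurableSet] with x hx
  exact (g.cometric_eq hM he ξ hx).symm

lemma hasWeakDifferential_weakDifferential {u : M → ℝ}
    (h : ∃ ξ : M → (Coord d →L[ℝ] ℝ), HasWeakDifferential u ξ) :
    HasWeakDifferential (d := d) u (weakDifferential u) := by
  unfold weakDifferential
  rw [dif_pos h]
  exact h.choose_spec

lemma energy_univ_eq_of_tsupport_subset {Ω : Set M} (hΩ : MeasurableSet Ω) {p : M → ℝ}
    (hp : tsupport p ⊆ Ω) :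
    g.energy univ (classicalDifferential p) = g.energy Ω (classicalDifferential p) := by
  unfold RiemMetric.energy
  rw [Measure.restrict_univ, ← lintegral_indicator hΩ]
  refine lintegral_congr fun x => ?_
  by_cases hx : x ∈ Ω
  · rw [indicator_of_mem hx]
  · rw [indicator_of_notMem hx, classicalDifferential_eq_zero fun h => hx (hp h),
      RiemMetric.cometric, coSq_zero, ENNReal.ofReal_zero]

lemma energy_add_le {S : Set M} {ξ η : M → (Coord d →L[ℝ] ℝ)}
    (hξ : AEMeasurable (fun x => g.cometric x (ξ x)) g.vol) :
    g.energy S (fun x => ξ x + η x) ≤ 2 * g.energy S ξ + 2 * g.energy S η := by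
  unfold RiemMetric.energy
  rw [← lintegral_const_mul' _ _ (by norm_num), ← lintegral_const_mul' _ _ (by norm_num),
    ← lintegral_add_left' (hξ.ennreal_ofReal.const_mul 2).restrict]
  exact lintegral_mono fun x => ofReal_cometric_add_le g hM x _ _

lemma energy_mono {S S' : Set M} (h : S ⊆ S') (ξ : M → (Coord d →L[ℝ] ℝ)) :
    g.energy S ξ ≤ g.energy S' ξ := lintegral_mono_set h

lemma energy_neg_sub (S : Set M) (ξ η : M → (Coord d →L[ℝ] ℝ)) :
    g.energy S (fun x => η x - ξ x) = g.energy S (fun x => ξ x - η x) := by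
  unfold RiemMetric.energy RiemMetric.cometric
  refine lintegral_congr fun x => ?_
  dsimp only
  rw [← neg_sub, coSq_neg]

/-- Finiteness matters because `h10Norm` passes through `toReal`, which sends infinite energy to
zero. -/
lemma energy_lt_top_of_mem_H10 [T2Space M] [CompactSpace M] (A : FiniteAtlas d M) {Ω : Set M}
    {u : M → ℝ} (hu : u ∈ g.H10 Ω) : g.energy Ω (weakDifferential u) < ∞ := by
  obtain ⟨p, hp, -, -, hpe⟩ := hu.2.2 1 one_pos
  have h := energy_add_le g hM (S := univ) (ξ := classicalDifferential p)
    (η := fun x => weakDifferential u x - classicalDifferential p x)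
    (continuous_cometric_classicalDifferential g hM hp).measurable.aemeasurable
  simp only [add_sub_cancel] at h
  refine (energy_mono g hM (subset_univ Ω) _).trans_lt (h.trans_lt (ENNReal.add_lt_top.2
    ⟨ENNReal.mul_lt_top (by norm_num) (energy_classicalDifferential_lt_top g hM A hp),
      ENNReal.mul_lt_top (by norm_num) (hpe.trans ENNReal.one_lt_top)⟩))

/-- Elements of `H̊¹(Ω)` are approximated in `L_2` by `C^{1,1}` functions with support in `Ω` whose
energy is controlled by the norm of `H̊¹(Ω)`. -/
lemma exists_approx_of_mem_H10 [T2Space M] [CompactSpace M] (A : FiniteAtlas d M) {Ω : Set M}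
    (hΩ : IsOpen Ω) {u : M → ℝ} (hu : u ∈ g.H10 Ω) {ε : ℝ} (hε : 0 < ε) :
    ∃ p : M → ℝ, IsC11Function d p ∧ tsupport p ⊆ Ω ∧ eLpNorm (u - p) 2 g.vol ≤ ENNReal.ofReal ε ∧
      g.energy univ (classicalDifferential p) ≤ ENNReal.ofReal (2 * g.h10Norm Ω u ^ 2 + ε) := by
  obtain ⟨p, hp, hps, hpL, hpe⟩ := hu.2.2 (ENNReal.ofReal (ε / 2)) (by simpa using hε)
  refine ⟨p, hp, hps, hpL.le.trans (ENNReal.ofReal_le_ofReal (by linarith)), ?_⟩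
  -- Splitting ∇p = ∇u + (∇p - ∇u) costs a factor 2 on both energies, hence the choice ε/2 above.
  have h := energy_add_le g hM (S := Ω) (ξ := weakDifferential u)
    (η := fun x => classicalDifferential p x - weakDifferential u x)
    (aemeasurable_cometric g hM A (hasWeakDifferential_weakDifferential hM hu.2.1))
  simp only [add_sub_cancel] at h
  rw [energy_neg_sub g hM] at h
  rw [energy_univ_eq_of_tsupport_subset g hM hΩ.measurableSet hps]
  refine h.trans ?_
  have h1 : g.h10Norm Ω u ^ 2 = (g.energy Ω (weakDifferential u)).toReal :=
    Real.sq_sqrt ENNReal.toReal_nonneg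
  rw [h1, ENNReal.ofReal_add (by positivity) hε.le, ENNReal.ofReal_mul zero_le_two,
    ENNReal.ofReal_toReal (energy_lt_top_of_mem_H10 g hM A hu).ne, ENNReal.ofReal_ofNat]
  gcongr
  calc _ ≤ 2 * ENNReal.ofReal (ε / 2) := by
        gcongr; exact (energy_mono g hM (subset_univ _) _).trans hpe.le
    _ = ENNReal.ofReal ε := by
        rw [← ENNReal.ofReal_ofNat 2, ← ENNReal.ofReal_mul zero_le_two]
        congr 1; ring

/-- The Euclidean norm of the differential in coordinates is controlled by the energy. -/
lemma exists_lintegral_fderiv_sq_le {e : Chart d M} (he : e ∈ c11Charts d M)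
    {K : Set (Coord d)} (hK : IsCompact K) (hKe : K ⊆ e.target) :
    ∃ C : ℝ≥0, ∀ p : M → ℝ, IsC11Function d p →
      ∫⁻ y in K, ‖fderiv ℝ (p ∘ e.symm) y‖ₑ ^ 2 ≤ C * g.energy univ (classicalDifferential p) := by
  obtain ⟨C, hC⟩ := exists_lintegral_comp_symm_le g he hK hKe
  obtain ⟨B, hB⟩ := hK.exists_bound_of_continuousOn (f := g.form e) ((g.cont e he).mono hKe)
  refine ⟨B.toNNReal * C, fun p hp => ?_⟩
  have hm : AEMeasurable (fun x => ENNReal.ofReal (g.cometric x (classicalDifferential p x)))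
      g.vol := (continuous_cometric_classicalDifferential g hM hp).measurable.ennreal_ofReal.aemeasurable
  calc ∫⁻ y in K, ‖fderiv ℝ (p ∘ e.symm) y‖ₑ ^ 2
      ≤ ∫⁻ y in K, B.toNNReal *
          ENNReal.ofReal (g.cometric (e.symm y) (classicalDifferential p (e.symm y))) := by
        refine setLIntegral_mono' hK.measurableSet fun y hy => ?_
        have hI := g.isInnerForm he (hKe hy)
        have hB0 : 0 ≤ B := (norm_nonneg _).trans (hB y hy)
        rw [cometric_classicalDifferential_eq g hM he hp (e.map_target (hKe hy)),
          e.right_inv (hKe hy), ← ofReal_norm, ← ENNReal.ofReal_pow (norm_nonneg _)]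
        have h2 : (B.toNNReal : ℝ≥0∞) = ENNReal.ofReal B := rfl
        rw [h2, ← ENNReal.ofReal_mul hB0]
        refine ENNReal.ofReal_le_ofReal ((hI.norm_sq_le _).trans ?_)
        exact mul_le_mul_of_nonneg_right (hB y hy) (hI.coSq_nonneg _)
    _ = B.toNNReal * ∫⁻ y in K,
          ENNReal.ofReal (g.cometric (e.symm y) (classicalDifferential p (e.symm y))) :=
        lintegral_const_mul' _ _ ENNReal.coe_ne_top
    _ ≤ B.toNNReal * (C * ∫⁻ x, ENNReal.ofReal (g.cometric x (classicalDifferential p x)) ∂g.vol) := by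
        gcongr; exact hC _ hm
    _ = _ := by
        rw [RiemMetric.energy, Measure.restrict_univ, ENNReal.coe_mul, mul_assoc]

end Smooth

end Energy

/-! ### Differences of continuously differentiable functions -/

section Smooth

variable {d : ℕ}

lemma enorm_sub_le_lintegral_fderiv {f : Coord d → ℝ} {S : Set (Coord d)} (hS : IsOpen S)
    (hf : ContDiffOn ℝ 1 f S) {x h : Coord d} (hseg : ∀ θ ∈ Icc (0 : ℝ) 1, x + θ • h ∈ S) :
    ‖f (x + h) - f x‖ₑ ≤ ∫⁻ θ in Ioc (0 : ℝ) 1, ‖fderiv ℝ f (x + θ • h) h‖ₑ := by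
  have hd : ∀ θ ∈ uIcc (0 : ℝ) 1, HasDerivAt (fun θ : ℝ => f (x + θ • h))
      (fderiv ℝ f (x + θ • h) h) θ := by
    intro θ hθ
    rw [uIcc_of_le zero_le_one] at hθ
    have h1 : HasDerivAt (fun θ : ℝ => x + θ • h) h θ := by
      simpa using ((hasDerivAt_id θ).smul_const h).const_add x
    have h2 := ((hf.contDiffAt (hS.mem_nhds (hseg θ hθ))).differentiableAt
      one_ne_zero).hasFDerivAt.comp_hasDerivAt θ h1
    simpa [Function.comp_def] using h2
  have hc : ContinuousOn (fun θ : ℝ => fderiv ℝ f (x + θ • h) h) (uIcc 0 1) := by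
    rw [uIcc_of_le zero_le_one]
    exact ((hf.continuousOn_fderiv_of_isOpen hS le_rfl).comp (by fun_prop) hseg).clm_apply
      continuousOn_const
  have h3 := intervalIntegral.integral_eq_sub_of_hasDerivAt hd hc.intervalIntegrable
  rw [intervalIntegral.integral_of_le zero_le_one] at h3
  simp only [one_smul, zero_smul, add_zero] at h3
  rw [← h3]
  exact enorm_integral_le_lintegral_enorm _

/-- The gradient is averaged along segments; only a pointwise majorant in L_2 is required, which
saves computing it exactly. -/
lemma ContDiff.l2Le_fwdShift {f r : Coord d → ℝ} (hf : ContDiff ℝ 1 f) {b : ℝ}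
    (hr : L2Le r b) (hfr : ∀ y, ‖fderiv ℝ f y‖ ≤ r y) (k : Coord d) :
    L2Le (fwdShift k f) (‖k‖ * b) := by
  have hk := hr.const_mul ‖k‖
  rw [abs_norm] at hk
  refine hk.segment_average (continuous_fwdShift hf.continuous k).aestronglyMeasurable (h := k)
    (ae_of_all _ fun x => ?_)
  refine (enorm_sub_le_lintegral_fderiv isOpen_univ hf.contDiffOn
    (fun _ _ => mem_univ _)).trans (lintegral_mono fun θ => ?_)
  rw [← ofReal_norm, ← ofReal_norm]
  refine ENNReal.ofReal_le_ofReal ?_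
  refine (ContinuousLinearMap.le_opNorm _ _).trans ?_
  rw [Real.norm_eq_abs, mul_comm]
  refine (mul_le_mul_of_nonneg_left (hfr _) (norm_nonneg _)).trans (le_abs_self _)

lemma norm_fderiv_mul_le {a b : Coord d → ℝ} {y : Coord d} (ha : DifferentiableAt ℝ a y)
    (hb : DifferentiableAt ℝ b y) :
    ‖fderiv ℝ (a * b) y‖ ≤ |a y| * ‖fderiv ℝ b y‖ + |b y| * ‖fderiv ℝ a y‖ := by
  rw [fderiv_mul ha hb]
  refine (norm_add_le _ _).trans ?_
  rw [norm_smul, norm_smul, Real.norm_eq_abs, Real.norm_eq_abs]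

lemma L2Le.abs {f : Coord d → ℝ} {a : ℝ} (hf : L2Le f a) : L2Le (fun x => |f x|) a := by
  refine ⟨hf.1.norm, ?_⟩
  have : eLpNorm (fun x => ‖f x‖) 2 volume = eLpNorm f 2 volume := eLpNorm_norm f
  exact this.trans_le hf.2

lemma l2Le_indicator {S : Set (Coord d)} (hS : MeasurableSet S) {f : Coord d → ℝ} {a : ℝ}
    (hf : AEStronglyMeasurable f (volume.restrict S))
    (h : ∫⁻ y in S, ‖f y‖ₑ ^ 2 ≤ ENNReal.ofReal a ^ 2) : L2Le (S.indicator f) a := by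
  refine ⟨(aestronglyMeasurable_indicator_iff hS).2 hf, ?_⟩
  rw [eLpNorm_indicator_eq_eLpNorm_restrict hS]
  exact eLpNorm_two_le_iff.2 h

end Smooth

/-! ### Shifts in a chart -/

section ChartShift

variable {d : ℕ} {M : Type*} [TopologicalSpace M]

/-- The segment from y to y + h is connected, starts in the target and is too short to meet its
frontier. -/
lemma add_smul_mem_target {e : Chart d M} {φ : M → ℝ} (hφ : tsupport φ ⊆ e.source) {h : Coord d}
    (hh : ‖h‖ₑ < chartDist e φ) {y : Coord d} (hy : y ∈ e '' tsupport φ) {θ : ℝ}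
    (hθ : θ ∈ Icc (0 : ℝ) 1) : y + θ • h ∈ e.target := by
  have hyt := chart_image_subset_target hφ hy
  have hdist : ‖h‖ₑ < Metric.infEDist y (frontier e.target) :=
    hh.trans_le (iInf₂_le (f := fun y (_ : y ∈ e '' tsupport φ) =>
      Metric.infEDist y (frontier e.target)) y hy)
  have hconn : IsPreconnected ((fun t : ℝ => y + t • h) '' Icc 0 1) :=
    isPreconnected_Icc.image _ (by fun_prop)
  have hfr : ∀ p ∈ (fun t : ℝ => y + t • h) '' Icc (0 : ℝ) 1, p ∉ frontier e.target := by
    rintro _ ⟨t, ht, rfl⟩ hp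
    refine not_le.2 hdist ((Metric.infEDist_le_edist_of_mem hp).trans ?_)
    rw [edist_comm, edist_eq_enorm_sub, add_sub_cancel_left, enorm_smul]
    refine mul_le_of_le_one_left bot_le ?_
    rw [← ofReal_norm, Real.norm_eq_abs, abs_of_nonneg ht.1]
    exact ENNReal.ofReal_le_one.2 ht.2
  have hsub : (fun t : ℝ => y + t • h) '' Icc (0 : ℝ) 1 ⊆ e.target ∪ (closure e.target)ᶜ := by
    intro p hp
    by_cases hpt : p ∈ e.target
    · exact Or.inl hpt
    · refine Or.inr fun hc => hfr p hp ?_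
      rw [e.open_target.frontier_eq]
      exact ⟨hc, hpt⟩
  have := hconn.subset_left_of_subset_union e.open_target isClosed_closure.isOpen_compl
    (disjoint_compl_right.mono_left subset_closure) hsub ⟨y, ⟨0, by simp, by simp⟩, hyt⟩
  exact this ⟨θ, hθ, rfl⟩

lemma add_mem_target {e : Chart d M} {φ : M → ℝ} (hφ : tsupport φ ⊆ e.source) {h : Coord d}
    (hh : ‖h‖ₑ < chartDist e φ) {y : Coord d} (hy : y ∈ e '' tsupport φ) : y + h ∈ e.target := by
  simpa using add_smul_mem_target hφ hh hy (θ := 1) (by simp)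

/-- The coordinate expression of `φ (u_h - u)`, extended by zero to `ℝ^d`. -/
noncomputable def shiftExt (e : Chart d M) (φ u : M → ℝ) (h : Coord d) : Coord d → ℝ :=
  chartExt e φ * fwdShift h (chartExt e u)

/-- The sign reflects that `shiftDiff` contains u - u_h and δ_h the opposite. On the support of φ
the shifted point is still in the chart, where the extension by zero agrees with u. -/
lemma shiftDiff_eq {e : Chart d M} {φ : M → ℝ} (hφ : tsupport φ ⊆ e.source) (u : M → ℝ)
    {h : Coord d} (hh : ‖h‖ₑ < chartDist e φ) {x : M} (hx : x ∈ e.source) :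
    shiftDiff e φ u h x = -shiftExt e φ u h (e x) := by
  unfold shiftDiff shiftExt
  rw [Pi.mul_apply, chartExt_apply hx, fwdShift, chartExt_apply hx]
  by_cases hxφ : x ∈ tsupport φ
  · have := add_mem_target hφ hh (mem_image_of_mem e hxφ)
    rw [chartExt, indicator_of_mem this, Function.comp_apply]
    ring
  · rw [image_eq_zero_of_notMem_tsupport hxφ]; simp

lemma shiftDiff_eq_zero (e : Chart d M) {φ : M → ℝ} (u : M → ℝ) (h : Coord d) {x : M}
    (hx : x ∉ tsupport φ) : shiftDiff e φ u h x = 0 := by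
  unfold shiftDiff
  rw [image_eq_zero_of_notMem_tsupport hx, zero_mul]

lemma shiftExt_eq_zero {e : Chart d M} {φ : M → ℝ} (u : M → ℝ) (h : Coord d)
    {y : Coord d} (hy : y ∉ e '' tsupport φ) : shiftExt e φ u h y = 0 := by
  unfold shiftExt
  rw [Pi.mul_apply, chartExt_eq_zero hy, zero_mul]

variable [CompactSpace M] [ChartedSpace (Coord d) M]

/-- The estimates for the shifts of a `C^{1,1}` function `p` in a bounded chart. -/
lemma exists_l2Le_shiftExt_of_smooth {e : Chart d M} (he : e ∈ c11Charts d M)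
    (hbd : Bornology.IsBounded e.target) {φ : M → ℝ} (hφ : IsC11Function d φ)
    (hφs : tsupport φ ⊆ e.source) :
    ∃ C : ℝ, 0 ≤ C ∧ ∀ (h : Coord d), ‖h‖ₑ < chartDist e φ → ∀ (p : M → ℝ) (N : ℝ),
      IsC11Function d p → 0 ≤ N →
      ∫⁻ y in e.target, ‖fderiv ℝ (p ∘ e.symm) y‖ₑ ^ 2 ≤ ENNReal.ofReal N ^ 2 →
      L2Le (shiftExt e φ p h) (C * ‖h‖ * N) ∧
        ∀ k, L2Le (fwdShift k (shiftExt e φ p h)) (C * ‖k‖ * N) := by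
  have hφC := compactC11_chartExt he hφ hφs
  obtain ⟨c, hc⟩ := hφC.exists_mult
  obtain ⟨B, hB⟩ := (hφC.supp.fderiv ℝ).exists_bound_of_continuous
    (hφC.smooth.continuous_fderiv one_ne_zero)
  set c' := max c B with hc'
  have hc0 : 0 ≤ c' := hc.nonneg.trans (le_max_left _ _)
  have hcφ : ∀ y, |chartExt e φ y| ≤ c' := fun y => (hc.bound y).trans (le_max_left _ _)
  have hcD : ∀ y, ‖fderiv ℝ (chartExt e φ) y‖ ≤ c' := fun y => (hB y).trans (le_max_right _ _)
  set R := Metric.diam e.target with hR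
  have hR0 : 0 ≤ R := Metric.diam_nonneg
  -- In the gradient bound, 2 accounts for the gradients of p and of its shift, and R for ‖h‖ in the
  -- term with the derivative of φ.
  refine ⟨c' * (2 + R + 1), by positivity, fun h hh p N hp hN hgrad => ?_⟩
  set K := e '' tsupport φ with hK
  have hKc : IsCompact K := isCompact_chart_image (isClosed_tsupport φ).isCompact hφs
  have hKt : K ⊆ e.target := chart_image_subset_target hφs
  have hhR : K.Nonempty → ‖h‖ ≤ R := by
    rintro ⟨y, hy⟩
    have := Metric.dist_le_diam_of_mem hbd (add_mem_target hφs hh hy) (hKt hy)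
    simpa [dist_eq_norm] using this
  set P := p ∘ e.symm with hP
  have hPc : ContDiffOn ℝ 1 P e.target := (hp e he).1
  have hDc := hPc.continuousOn_fderiv_of_isOpen e.open_target le_rfl
  set q : Coord d → ℝ := e.target.indicator fun y => ‖fderiv ℝ P y‖ with hq
  have hqL : L2Le q N := l2Le_indicator e.open_target.measurableSet
    (hDc.norm.aestronglyMeasurable e.open_target.measurableSet) (by simpa using hgrad)
  set D : Coord d → ℝ := K.indicator (fwdShift h (chartExt e p)) with hD
  have hPe : ∀ y ∈ e.target, chartExt e p y = P y := fun y hy => indicator_of_mem hy _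
  have hDm : AEStronglyMeasurable D volume := by
    refine (aestronglyMeasurable_indicator_iff hKc.measurableSet).2 ?_
    have h1 : ContinuousOn (fun y => P (y + h) - P y) K :=
      (hPc.continuousOn.comp (continuous_add_const h).continuousOn
        (fun y hy => add_mem_target hφs hh hy)).sub (hPc.continuousOn.mono hKt)
    refine (h1.aestronglyMeasurable hKc.measurableSet).congr ?_
    filter_upwards [ae_restrict_mem hKc.measurableSet] with y hy
    rw [fwdShift, hPe _ (hKt hy), hPe _ (add_mem_target hφs hh hy)]
  have hDL : L2Le D (‖h‖ * N) := by
    have hk := hqL.const_mul ‖h‖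
    rw [abs_norm] at hk
    refine hk.segment_average hDm (h := h) (ae_of_all _ fun y => ?_)
    by_cases hy : y ∈ K
    · rw [hD, indicator_of_mem hy, fwdShift, hPe _ (hKt hy), hPe _ (add_mem_target hφs hh hy)]
      have hseg := fun θ hθ => add_smul_mem_target hφs hh hy (θ := θ) hθ
      refine (enorm_sub_le_lintegral_fderiv e.open_target hPc hseg).trans
        (setLIntegral_mono' measurableSet_Ioc fun θ hθ => ?_)
      rw [hq, indicator_of_mem (hseg θ (Ioc_subset_Icc_self hθ)), ← ofReal_norm, ← ofReal_norm]
      refine ENNReal.ofReal_le_ofReal ?_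
      refine (ContinuousLinearMap.le_opNorm _ _).trans ?_
      rw [norm_mul, norm_norm, norm_norm, mul_comm]
    · rw [hD, indicator_of_notMem hy]; simp
  have hwD : shiftExt e φ p h = chartExt e φ * D := by
    ext y
    by_cases hy : y ∈ K
    · simp [shiftExt, hD, hy]
    · rw [shiftExt_eq_zero p h hy]; simp [hD, hy]
  -- the gradient of the shifted difference
  have hev : ∀ y ∈ K, shiftExt e φ p h =ᶠ[𝓝 y] chartExt e φ * fwdShift h P := by
    intro y hy
    have h1 : ∀ᶠ z in 𝓝 y, z + h ∈ e.target :=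
      (continuous_add_const h).continuousAt.eventually
        (e.open_target.mem_nhds (add_mem_target hφs hh hy))
    filter_upwards [h1, e.open_target.mem_nhds (hKt hy)] with z hz1 hz2
    simp only [shiftExt, Pi.mul_apply, fwdShift, hPe _ hz1, hPe _ hz2]
  have hsh : ∀ y ∈ K, ContDiffAt ℝ 1 (fun z => P (z + h)) y := fun y hy =>
    ContDiffAt.comp y (g := P) (f := fun z => z + h)
      (hPc.contDiffAt (e.open_target.mem_nhds (add_mem_target hφs hh hy)))
      (contDiff_id.add contDiff_const).contDiffAt
  have hP1 : ∀ y ∈ K, ContDiffAt ℝ 1 P y := fun y hy =>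
    hPc.contDiffAt (e.open_target.mem_nhds (hKt hy))
  have hev0 : ∀ y ∉ K, shiftExt e φ p h =ᶠ[𝓝 y] fun _ => 0 := fun y hy => by
    filter_upwards [hKc.isClosed.isOpen_compl.mem_nhds hy] with z hz using shiftExt_eq_zero p h hz
  have hsmooth : ContDiff ℝ 1 (shiftExt e φ p h) := by
    rw [contDiff_iff_contDiffAt]
    intro y
    by_cases hy : y ∈ K
    · exact (hφC.smooth.contDiffAt.mul ((hsh y hy).sub (hP1 y hy))).congr_of_eventuallyEq (hev y hy)
    · exact contDiffAt_const.congr_of_eventuallyEq (hev0 y hy)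
  -- The product rule: q is the norm of the gradient of p in the chart, and D is the difference of p
  -- on the support of φ.
  set r : Coord d → ℝ := fun y => c' * ((q y + q (y + h)) + |D y|) with hr
  have hq0 : ∀ y, 0 ≤ q y := fun y => indicator_nonneg (fun _ _ => norm_nonneg _) y
  have hrb : ∀ y, ‖fderiv ℝ (shiftExt e φ p h) y‖ ≤ r y := by
    intro y
    by_cases hy : y ∈ K
    · rw [(hev y hy).fderiv_eq]
      have d1 := (hsh y hy).differentiableAt one_ne_zero
      have d2 := (hP1 y hy).differentiableAt one_ne_zero
      have hf : fderiv ℝ (fwdShift h P) y = fderiv ℝ P (y + h) - fderiv ℝ P y := by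
        have := fderiv_sub d1 d2
        rw [fderiv_comp_add_right] at this
        exact this
      refine (norm_fderiv_mul_le ((hφC.smooth.differentiable one_ne_zero) y) (d1.sub d2)).trans ?_
      have e1 : q y = ‖fderiv ℝ P y‖ := indicator_of_mem (hKt hy) _
      have e2 : q (y + h) = ‖fderiv ℝ P (y + h)‖ :=
        indicator_of_mem (add_mem_target hφs hh hy) _
      have e3 : D y = fwdShift h P y := by
        rw [hD, indicator_of_mem hy, fwdShift, fwdShift, hPe _ (hKt hy),
          hPe _ (add_mem_target hφs hh hy)]
      have e4 : ‖fderiv ℝ (fwdShift h P) y‖ ≤ q y + q (y + h) := by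
        rw [hf, e1, e2, add_comm ‖fderiv ℝ P y‖]; exact norm_sub_le _ _
      rw [hr]
      simp only
      rw [mul_add, e3]
      refine add_le_add ?_ ?_
      · exact mul_le_mul (hcφ y) e4 (norm_nonneg _) hc0
      · rw [mul_comm]
        exact mul_le_mul_of_nonneg_right (hcD y) (abs_nonneg _)
    · rw [(hev0 y hy).fderiv_eq]
      simp only [fderiv_fun_const, Pi.zero_apply, norm_zero, hr]
      have := hq0 y; have := hq0 (y + h)
      positivity
  constructor
  · rw [hwD]
    refine (hDL.mul_left hφC.smooth.continuous.aestronglyMeasurable hcφ hc0).mono ?_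
    have : 0 ≤ c' * (1 + R + 1) * (‖h‖ * N) := by positivity
    linarith
  · intro k
    by_cases hKne : K.Nonempty
    · have hrL : L2Le r (c' * (N + N + ‖h‖ * N)) := by
        have := ((hqL.add (hqL.shift h) hN hN).add hDL.abs (by positivity) (by positivity)).const_mul c'
        rw [abs_of_nonneg hc0] at this
        exact this
      refine (hsmooth.l2Le_fwdShift hrL hrb k).mono ?_
      have h1 : ‖h‖ * N ≤ R * N := by gcongr; exact hhR hKne
      have h2 : c' * (N + N + ‖h‖ * N) ≤ c' * (2 + R + 1) * N := by
        have := mul_le_mul_of_nonneg_left h1 hc0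
        have : 0 ≤ c' * N := by positivity
        linarith
      calc _ ≤ ‖k‖ * (c' * (2 + R + 1) * N) := by gcongr
        _ = _ := by ring
    · have : shiftExt e φ p h = 0 := by
        ext y
        exact shiftExt_eq_zero p h fun hy => hKne ⟨y, hy⟩
      have h0 : fwdShift k (0 : Coord d → ℝ) = 0 := by ext; simp [fwdShift]
      rw [this, h0]
      exact ⟨aestronglyMeasurable_zero, by simp⟩

end ChartShift

/-! ### Estimates in H̊¹(Ω) and domains of the forms -/

section H10

variable {d : ℕ} {M : Type*} [TopologicalSpace M] [ChartedSpace (Coord d) M]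
  (g : RiemMetric d M) (hM : IsC11Manifold d M)
include hM

lemma continuous_of_isC11Function {p : M → ℝ} (hp : IsC11Function d p) : Continuous p := by
  rw [continuous_iff_continuousAt]
  intro x
  set e := chartAt (Coord d) x
  have hx : x ∈ e.source := mem_chart_source (Coord d) x
  have h1 := (hp e (chartAt_mem_c11Charts hM x)).1.continuousOn.continuousAt
    (e.open_target.mem_nhds (e.map_source hx))
  refine (h1.comp (e.continuousAt hx)).congr ?_
  filter_upwards [e.open_source.mem_nhds hx] with x' hx'
  simp [e.left_inv hx']

variable [MeasurableSpace M] [BorelSpace M] [T2Space M] [CompactSpace M]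

lemma exists_chart_approx_of_mem_H10 (A : FiniteAtlas d M) {Ω : Set M} (hΩ : IsOpen Ω)
    {e : Chart d M} (he : e ∈ c11Charts d M) {K : Set (Coord d)} (hK : IsCompact K)
    (hKe : K ⊆ e.target) :
    ∃ C : ℝ, 0 ≤ C ∧ ∀ u ∈ g.H10 Ω, ∀ η : ℝ, 0 < η → ∃ p : M → ℝ, IsC11Function d p ∧
      ∫⁻ y in K, ‖u (e.symm y) - p (e.symm y)‖ₑ ^ 2 ≤ ENNReal.ofReal η ^ 2 ∧
      ∫⁻ y in K, ‖fderiv ℝ (p ∘ e.symm) y‖ₑ ^ 2 ≤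
        ENNReal.ofReal (C * g.h10Norm Ω u + η) ^ 2 := by
  obtain ⟨C1, hC1⟩ := exists_lintegral_comp_symm_le g he hK hKe
  obtain ⟨C2, hC2⟩ := exists_lintegral_fderiv_sq_le g hM he hK hKe
  refine ⟨2 * √C2, by positivity, fun u hu η hη => ?_⟩
  -- Chosen such that √C1 ε ≤ η and C2 ε ≤ η²; then C2 (2N² + ε) ≤ (2√C2 N + η)², where N is the
  -- norm of u.
  set ε := min (η / (√C1 + 1)) (η ^ 2 / (C2 + 1)) with hεdef
  have hε : 0 < ε := by positivity
  have hε1 : √C1 * ε ≤ η := by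
    have h1 : ε ≤ η / (√C1 + 1) := min_le_left _ _
    rw [le_div_iff₀ (by positivity)] at h1
    linarith
  have hε2 : C2 * ε ≤ η ^ 2 := by
    have h1 : ε ≤ η ^ 2 / (C2 + 1) := min_le_right _ _
    rw [le_div_iff₀ (by positivity)] at h1
    linarith
  have hN : 0 ≤ g.h10Norm Ω u := Real.sqrt_nonneg _
  obtain ⟨p, hp, -, hpL, hpE⟩ := exists_approx_of_mem_H10 g hM A hΩ hu hε
  refine ⟨p, hp, ?_, ?_⟩
  · have hm : AEMeasurable (fun x => ‖u x - p x‖ₑ ^ 2) g.vol :=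
      (hu.1.1.sub (continuous_of_isC11Function hM hp).aestronglyMeasurable).enorm.pow_const 2
    refine (hC1 _ hm).trans ?_
    calc (C1 : ℝ≥0∞) * ∫⁻ x, ‖u x - p x‖ₑ ^ 2 ∂g.vol ≤ C1 * ENNReal.ofReal ε ^ 2 := by
          gcongr; exact eLpNorm_two_le_iff.1 hpL
      _ = ENNReal.ofReal (√C1 * ε) ^ 2 := by
          rw [ENNReal.ofReal_mul (Real.sqrt_nonneg _), mul_pow,
            ← ENNReal.ofReal_pow (Real.sqrt_nonneg _), Real.sq_sqrt C1.coe_nonneg,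
            ENNReal.ofReal_coe_nnreal]
      _ ≤ _ := by gcongr
  · refine (hC2 p hp).trans ?_
    calc (C2 : ℝ≥0∞) * g.energy univ (classicalDifferential p)
        ≤ C2 * ENNReal.ofReal (2 * g.h10Norm Ω u ^ 2 + ε) := by gcongr
      _ = ENNReal.ofReal (C2 * (2 * g.h10Norm Ω u ^ 2 + ε)) := by
          rw [ENNReal.ofReal_mul C2.coe_nonneg, ENNReal.ofReal_coe_nnreal]
      _ ≤ ENNReal.ofReal ((2 * √C2 * g.h10Norm Ω u + η) ^ 2) := by
          refine ENNReal.ofReal_le_ofReal ?_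
          have h1 : √C2 ^ 2 = C2 := Real.sq_sqrt C2.coe_nonneg
          have h2 : 0 ≤ 2 * √C2 * g.h10Norm Ω u * η := by positivity
          have h3 : 0 ≤ C2 * g.h10Norm Ω u ^ 2 := by positivity
          nlinarith
      _ = _ := ENNReal.ofReal_pow (by positivity) 2

omit hM [T2Space M] in
lemma l2Le_chart_indicator_sub {e : Chart d M} (he : e ∈ c11Charts d M) {S K : Set (Coord d)}
    (hS : MeasurableSet S) (hSK : S ⊆ K) (hSe : S ⊆ e.target) {u p : M → ℝ}
    (hu : AEStronglyMeasurable u g.vol) (hp : IsC11Function d p) {η : ℝ}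
    (h : ∫⁻ y in K, ‖u (e.symm y) - p (e.symm y)‖ₑ ^ 2 ≤ ENNReal.ofReal η ^ 2) :
    L2Le (S.indicator (u ∘ e.symm) - S.indicator (p ∘ e.symm)) η := by
  rw [← indicator_sub']
  refine l2Le_indicator hS ?_ ?_
  · refine AEStronglyMeasurable.sub
      ((AEStronglyMeasurable.comp_chart_symm g he hu).mono_measure
        (Measure.restrict_mono hSe le_rfl)) ?_
    exact ((hp e he).1.continuousOn.mono hSe).aestronglyMeasurable hS
  · exact (lintegral_mono_set hSK).trans h

/-- The main estimate for `H̊¹(Ω)` in a small chart. -/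
lemma exists_l2Le_shiftExt_of_mem_H10 (A : FiniteAtlas d M) {Ω : Set M} (hΩ : IsOpen Ω)
    {e κ : Chart d M} (he : e ∈ c11Charts d M) (hκ : κ ∈ c11Charts d M)
    (heκ : (e.symm : Coord d → M) = κ.symm) {K : Set (Coord d)} (hK : IsCompact K)
    (heK : e.target ⊆ K) (hKκ : K ⊆ κ.target)
    {φ : M → ℝ} (hφ : IsC11Function d φ) (hφs : tsupport φ ⊆ e.source) :
    ∃ C : ℝ, 0 ≤ C ∧ ∀ u ∈ g.H10 Ω, ∀ (h : Coord d), ‖h‖ₑ < chartDist e φ →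
      L2Le (shiftExt e φ u h) (C * ‖h‖ * g.h10Norm Ω u) ∧
        ∀ k, L2Le (fwdShift k (shiftExt e φ u h)) (C * ‖k‖ * g.h10Norm Ω u) := by
  obtain ⟨C0, hC0, happ⟩ := exists_chart_approx_of_mem_H10 g hM A hΩ hκ hK hKκ
  obtain ⟨C, hC, hsm⟩ := exists_l2Le_shiftExt_of_smooth he (hK.isBounded.subset heK) hφ hφs
  obtain ⟨c, hc⟩ := (compactC11_chartExt he hφ hφs).exists_mult
  have hc0 := hc.nonneg
  refine ⟨C * C0, by positivity, fun u hu h hh => ?_⟩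
  have hN : 0 ≤ g.h10Norm Ω u := Real.sqrt_nonneg _
  have hum : AEStronglyMeasurable (chartExt e u) volume :=
    (aestronglyMeasurable_indicator_iff e.open_target.measurableSet).2
      (AEStronglyMeasurable.comp_chart_symm g he hu.1.1)
  have hwm : AEStronglyMeasurable (shiftExt e φ u h) volume :=
    hc.cont.aestronglyMeasurable.mul
      ((hum.comp_measurePreserving (measurePreserving_add_right _ h)).sub hum)
  -- For fixed h only L_2 convergence and a uniform bound on the gradients of the approximants are
  -- used; convergence of the gradients is not.
  have key : ∀ η : ℝ, 0 < η → ∃ p : M → ℝ,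
      L2Le (shiftExt e φ u h - shiftExt e φ p h) (2 * c * η) ∧
      L2Le (shiftExt e φ p h) (C * ‖h‖ * (C0 * g.h10Norm Ω u + η)) ∧
      ∀ k, L2Le (fwdShift k (shiftExt e φ p h)) (C * ‖k‖ * (C0 * g.h10Norm Ω u + η)) := by
    intro η hη
    obtain ⟨p, hp, hp1, hp2⟩ := happ u hu η hη
    -- Both charts have the same inverse map, so the bounds on K in the chart κ hold on `e.target`
    -- in the chart e.
    rw [← heκ] at hp1 hp2
    refine ⟨p, ?_, hsm h hh p _ hp (by positivity) ((lintegral_mono_set heK).trans hp2)⟩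
    have h1 : L2Le (chartExt e u - chartExt e p) η :=
      l2Le_chart_indicator_sub g he e.open_target.measurableSet heK le_rfl hu.1.1 hp hp1
    have h2 := (h1.fwd hη.le h).mul_left hc.cont.aestronglyMeasurable hc.bound hc0
    refine (h2.mono (by linarith)).congr' fun y => ?_
    simp only [shiftExt, Pi.mul_apply, Pi.sub_apply, fwdShift]
    ring
  constructor
  · refine L2Le.of_tendsto hwm (by positivity) fun ε hε => ?_
    obtain ⟨p, h1, h2, -⟩ := key (ε / (C * ‖h‖ + 2 * c + 1)) (by positivity)
    set η := ε / (C * ‖h‖ + 2 * c + 1)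
    have hη : η * (C * ‖h‖ + 2 * c + 1) = ε := div_mul_cancel₀ _ (by positivity)
    have i1 : 0 ≤ C * ‖h‖ * η := by positivity
    have i2 : 0 ≤ 2 * c * η := by positivity
    have i3 : 0 < η := by positivity
    exact ⟨_, h2.mono (by linarith), h1.mono (by linarith)⟩
  · intro k
    refine L2Le.of_tendsto ((hwm.comp_measurePreserving
      (measurePreserving_add_right _ k)).sub hwm) (by positivity) fun ε hε => ?_
    obtain ⟨p, h1, -, h2⟩ := key (ε / (C * ‖k‖ + 4 * c + 1)) (by positivity)
    set η := ε / (C * ‖k‖ + 4 * c + 1)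
    have hη : η * (C * ‖k‖ + 4 * c + 1) = ε := div_mul_cancel₀ _ (by positivity)
    have i1 : 0 ≤ C * ‖k‖ * η := by positivity
    have i2 : 0 ≤ 4 * c * η := by positivity
    have i3 : 0 < η := by positivity
    refine ⟨_, (h2 k).mono (by linarith), ?_⟩
    refine ((h1.fwd (by positivity) k).mono (b := ε) (by linarith)).congr' fun y => ?_
    simp only [fwdShift, Pi.sub_apply]
    ring

/-- The product rule for C^{1,1} approximants and an L_2 limit show that the shifts of ψ_i u are
Lipschitz in L_2, which is more than the decay of the quotients demands. -/
lemma memNikZero_piece_of_mem_H10 (A : FiniteAtlas d M) {Ω : Set M} (hΩ : IsOpen Ω) {γ : ℝ}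
    (hγ0 : 0 < γ) (hγ1 : γ < 1) {u : M → ℝ} (hu : u ∈ g.H10 Ω) (i : Fin A.n) :
    MemNikZero γ (A.piece i u) := by
  set e := A.chart i with he_def
  have he : e ∈ c11Charts d M := A.chart_mem i
  have hψs : tsupport (A.ψ i) ⊆ e.source := A.subordinate i
  set K := e '' tsupport (A.ψ i) with hKdef
  have hK : IsCompact K := isCompact_chart_image (isClosed_tsupport _).isCompact hψs
  have hKe : K ⊆ e.target := chart_image_subset_target hψs
  have hψC := compactC11_chartExt he (A.ψ_c11 i) hψs
  obtain ⟨c, hc⟩ := hψC.exists_mult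
  have hc0 := hc.nonneg
  obtain ⟨B, hB⟩ := (hψC.supp.fderiv ℝ).exists_bound_of_continuous
    (hψC.smooth.continuous_fderiv one_ne_zero)
  have hB0 : 0 ≤ B := (norm_nonneg _).trans (hB 0)
  obtain ⟨C0, hC0, happ⟩ := exists_chart_approx_of_mem_H10 g hM A hΩ he hK hKe
  obtain ⟨C1, hC1⟩ := exists_lintegral_comp_symm_le g he hK hKe
  have hN : 0 ≤ g.h10Norm Ω u := Real.sqrt_nonneg _
  have hpiece : ∀ p : M → ℝ, A.piece i p = chartExt e (A.ψ i) * K.indicator (p ∘ e.symm) := by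
    intro p
    ext y
    by_cases hy : y ∈ K
    · simp [FiniteAtlas.piece, chartExt, ← he_def, hKe hy, hy]
    · have h0 : chartExt e (A.ψ i) y = 0 := chartExt_eq_zero hy
      rw [Pi.mul_apply, h0, zero_mul]
      by_cases hyt : y ∈ e.target
      · rw [chartExt, indicator_of_mem hyt] at h0
        simp only [Function.comp_apply] at h0
        rw [FiniteAtlas.piece, ← he_def, indicator_of_mem hyt, h0, zero_mul]
      · exact indicator_of_notMem hyt _
  -- the function itself
  obtain ⟨b, hb0, hb⟩ : ∃ b : ℝ, 0 ≤ b ∧ L2Le (K.indicator (u ∘ e.symm)) b := by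
    have hfin : C1 * ∫⁻ x, ‖u x‖ₑ ^ 2 ∂g.vol < ∞ := by
      refine ENNReal.mul_lt_top ENNReal.coe_lt_top ?_
      rw [← eLpNorm_two_sq_eq_lintegral]
      exact ENNReal.pow_lt_top hu.1.2
    refine ⟨√(C1 * ∫⁻ x, ‖u x‖ₑ ^ 2 ∂g.vol).toReal, Real.sqrt_nonneg _,
      l2Le_indicator hK.measurableSet ((AEStronglyMeasurable.comp_chart_symm g he
        hu.1.1).mono_measure (Measure.restrict_mono hKe le_rfl)) ?_⟩
    rw [← ENNReal.ofReal_pow (Real.sqrt_nonneg _), Real.sq_sqrt ENNReal.toReal_nonneg,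
      ENNReal.ofReal_toReal hfin.ne]
    exact hC1 (fun x => ‖u x‖ₑ ^ 2) (hu.1.1.enorm.pow_const 2)
  have huL : L2Le (A.piece i u) (c * b) := by
    rw [hpiece]; exact hb.mul_left hc.cont.aestronglyMeasurable hc.bound hc0
  refine memNikZero_of_lipschitz_shift hγ0 hγ1 (a := c * b)
    (b := c * (C0 * g.h10Norm Ω u) + B * b) (by positivity) (by positivity) huL fun k => ?_
  refine L2Le.of_tendsto (huL.fwd (by positivity) k).1 (by positivity) fun ε hε => ?_
  set η := ε / (‖k‖ * (c + B) + 2 * c + 1) with hηdef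
  have hη : 0 < η := by positivity
  have hηε : η * (‖k‖ * (c + B) + 2 * c + 1) = ε := div_mul_cancel₀ _ (by positivity)
  obtain ⟨p, hp, hp1, hp2⟩ := happ u hu η hη
  have hdiff := l2Le_chart_indicator_sub g he hK.measurableSet le_rfl hKe hu.1.1 hp hp1
  set P := p ∘ e.symm with hP
  have hPc : ContDiffOn ℝ 1 P e.target := (hp e he).1
  have hDc := hPc.continuousOn_fderiv_of_isOpen e.open_target le_rfl
  have haL : L2Le (K.indicator P) (b + η) := by
    have := hb.sub hdiff hb0 hη.le
    rwa [sub_sub_cancel] at this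
  have hqL : L2Le (K.indicator fun y => ‖fderiv ℝ P y‖) (C0 * g.h10Norm Ω u + η) :=
    l2Le_indicator hK.measurableSet ((hDc.mono hKe).norm.aestronglyMeasurable hK.measurableSet)
      (by simpa using hp2)
  have hev : ∀ y ∈ e.target, A.piece i p =ᶠ[𝓝 y] chartExt e (A.ψ i) * P := by
    intro y hy
    filter_upwards [e.open_target.mem_nhds hy] with z hz
    simp [FiniteAtlas.piece, chartExt, ← he_def, hz, hP]
  have hev0 : ∀ y ∉ K, A.piece i p =ᶠ[𝓝 y] fun _ => 0 := by
    intro y hy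
    filter_upwards [hK.isClosed.isOpen_compl.mem_nhds hy] with z hz
    rw [hpiece, Pi.mul_apply, chartExt_eq_zero hz, zero_mul]
  have hsmooth : ContDiff ℝ 1 (A.piece i p) := by
    rw [contDiff_iff_contDiffAt]
    intro y
    by_cases hy : y ∈ K
    · exact (hψC.smooth.contDiffAt.mul (hPc.contDiffAt
        (e.open_target.mem_nhds (hKe hy)))).congr_of_eventuallyEq (hev y (hKe hy))
    · exact contDiffAt_const.congr_of_eventuallyEq (hev0 y hy)
  set r : Coord d → ℝ := fun y => c * K.indicator (fun y => ‖fderiv ℝ P y‖) y +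
    B * |K.indicator P y| with hr
  have hrb : ∀ y, ‖fderiv ℝ (A.piece i p) y‖ ≤ r y := by
    intro y
    by_cases hy : y ∈ K
    · rw [(hev y (hKe hy)).fderiv_eq]
      refine (norm_fderiv_mul_le ((hψC.smooth.differentiable one_ne_zero) y)
        ((hPc.contDiffAt (e.open_target.mem_nhds (hKe hy))).differentiableAt one_ne_zero)).trans ?_
      simp only [hr, indicator_of_mem hy]
      refine add_le_add (mul_le_mul_of_nonneg_right (hc.bound y) (norm_nonneg _)) ?_
      rw [mul_comm]
      exact mul_le_mul_of_nonneg_right (hB y) (abs_nonneg _)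
    · rw [(hev0 y hy).fderiv_eq]
      simp [hr, hy]
  have hrL : L2Le r (c * (C0 * g.h10Norm Ω u + η) + B * (b + η)) := by
    have h1 := hqL.const_mul c
    have h2 := haL.abs.const_mul B
    rw [abs_of_nonneg hc0] at h1
    rw [abs_of_nonneg hB0] at h2
    exact h1.add h2 (by positivity) (by positivity)
  refine ⟨fwdShift k (A.piece i p), (hsmooth.l2Le_fwdShift hrL hrb k).mono ?_, ?_⟩
  · have : 0 ≤ c * η := by positivity
    linarith
  · have h1 := (hdiff.mul_left hc.cont.aestronglyMeasurable hc.bound hc0).fwd (by positivity) k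
    refine (h1.mono (b := ε) ?_).congr' fun y => ?_
    · have : 0 ≤ ‖k‖ * (c + B) * η := by positivity
      linarith
    · simp only [hpiece, fwdShift, Pi.sub_apply, Pi.mul_apply]
      ring

/-- This puts H̊¹(Ω) into the domain of each functional. Off the closure of Ω, u coincides with u -
p, whose norm is arbitrarily small. -/
lemma mem_nikTildeZero_of_mem_H10 (A : FiniteAtlas d M) {Ω : Set M} (hΩ : IsOpen Ω) {γ : ℝ}
    (hγ0 : 0 < γ) (hγ1 : γ < 1) {u : M → ℝ} (hu : u ∈ g.H10 Ω) : u ∈ nikTildeZero g A γ Ω := by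
  refine ⟨hu.1, ?_, fun i => memNikZero_piece_of_mem_H10 g hM A hΩ hγ0 hγ1 hu i⟩
  have hS : MeasurableSet (closure Ω)ᶜ := isClosed_closure.measurableSet.compl
  have h0 : eLpNorm u 2 (g.vol.restrict (closure Ω)ᶜ) = 0 := by
    rw [← nonpos_iff_eq_zero]
    refine ENNReal.le_of_forall_pos_le_add fun ε hε _ => ?_
    obtain ⟨p, -, hps, hpL, -⟩ := hu.2.2 ε (by exact_mod_cast hε)
    have : eLpNorm u 2 (g.vol.restrict (closure Ω)ᶜ) =
        eLpNorm (u - p) 2 (g.vol.restrict (closure Ω)ᶜ) := by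
      refine eLpNorm_congr_ae ?_
      filter_upwards [ae_restrict_mem hS] with x hx
      rw [Pi.sub_apply, image_eq_zero_of_notMem_tsupport fun h => hx (subset_closure (hps h)),
        sub_zero]
    rw [this, zero_add]
    exact (eLpNorm_mono_measure _ Measure.restrict_le_self).trans hpL.le
  rw [eLpNorm_eq_zero_iff hu.1.1.restrict (by norm_num)] at h0
  exact (ae_restrict_iff' hS).1 h0

omit hM [BorelSpace M] [T2Space M] [CompactSpace M] in
lemma mem_nikTildeZero_of_mem_nikTildeOne (A : FiniteAtlas d M) {Ω : Set M} {γ t : ℝ}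
    (hγ0 : 0 < γ) (hγ1 : γ < 1) {u : M → ℝ} (hu : u ∈ nikTildeOne g A t Ω) :
    u ∈ nikTildeZero g A γ Ω := by
  refine ⟨hu.1, hu.2.1, fun i => ?_⟩
  have h := MemNikOne.diffBound (hu.2.2 i)
  exact memNikZero_of_lipschitz_shift hγ0 hγ1 (by positivity) (by positivity) h.zero h.one

end H10

/-! ### The atlas of small charts -/

section SmallCharts

variable {d : ℕ} {M : Type*} [TopologicalSpace M] [ChartedSpace (Coord d) M]

lemma restrOpen_mem_c11Charts {e : Chart d M} (he : e ∈ c11Charts d M) {s : Set M}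
    (hs : IsOpen s) : e.restrOpen s hs ∈ c11Charts d M := by
  intro e' he'
  obtain ⟨⟨h1, h2⟩, h3, h4⟩ := he e' he'
  have i1 : ((e.restrOpen s hs).symm.trans e').source ⊆ (e.symm.trans e').source :=
    fun y hy => ⟨hy.1.1, hy.2⟩
  have i2 : (e'.symm.trans (e.restrOpen s hs)).source ⊆ (e'.symm.trans e).source :=
    fun y hy => ⟨hy.1, hy.2.1⟩
  exact ⟨⟨h1.mono i1, h2.mono i1⟩, h3.mono i2, h4.mono i2⟩

/-- The restriction of a chart to the set where the corresponding function of the partition of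
unity is bounded from below. -/
def smallChart (A : FiniteAtlas d M) (j : Fin A.n) : Chart d M :=
  (A.chart j).restrOpen {x | 1 / (2 * (A.n + 1 : ℝ)) < A.ψ j x}
    (isOpen_lt continuous_const (A.ψ j).continuous)

variable (A : FiniteAtlas d M) (j : Fin A.n)

lemma coe_smallChart_symm : ((smallChart A j).symm : Coord d → M) = (A.chart j).symm := rfl

lemma smallChart_target_subset : (smallChart A j).target ⊆ (A.chart j).target :=
  fun _ hy => hy.1

lemma smallChart_mem : smallChart A j ∈ c11Charts d M :=
  restrOpen_mem_c11Charts (A.chart_mem j) _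

lemma lt_of_mem_smallChart_target {y : Coord d} (hy : y ∈ (smallChart A j).target) :
    1 / (2 * (A.n + 1 : ℝ)) < chartExt (A.chart j) (A.ψ j) y := by
  rw [chartExt, indicator_of_mem hy.1]
  exact ((smallChart A j).map_target hy).2

/-- The small chart is thus relatively compact in the original one: its target is bounded and all
constants are uniform on it. -/
lemma smallChart_target_subset_image :
    (smallChart A j).target ⊆ A.chart j '' tsupport (A.ψ j) := by
  intro y hy
  by_contra h
  have := lt_of_mem_smallChart_target A j hy
  rw [chartExt_eq_zero h] at this
  exact absurd this (not_lt.2 (by positivity))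

lemma isC11Atlas_smallChart : IsC11Atlas (range (smallChart A)) := by
  refine ⟨?_, fun x => ?_⟩
  · rintro _ ⟨j, rfl⟩
    exact smallChart_mem A j
  · obtain ⟨j, hj⟩ : ∃ j, 1 / (2 * (A.n + 1 : ℝ)) < A.ψ j x := by
      -- Otherwise the ψ_j would sum to at most n / (2(n + 1)) < 1. Using n + 1 keeps the threshold
      -- positive even for n = 0.
      by_contra! h
      have h1 : ∑ j, A.ψ j x = 1 := by
        rw [← finsum_eq_sum_of_fintype]; exact A.ψ.sum_eq_one (mem_univ x)
      have h2 : ∑ j, A.ψ j x ≤ ∑ _j : Fin A.n, 1 / (2 * (A.n + 1 : ℝ)) :=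
        Finset.sum_le_sum fun j _ => h j
      rw [h1, Finset.sum_const, Finset.card_univ, Fintype.card_fin, nsmul_eq_mul, mul_one_div,
        le_div_iff₀ (by positivity)] at h2
      have : (0 : ℝ) ≤ A.n := Nat.cast_nonneg _
      linarith
    have hpos : A.ψ j x ≠ 0 := ne_of_gt (lt_trans (by positivity) hj)
    exact ⟨_, ⟨j, rfl⟩, A.subordinate j (subset_tsupport _ hpos), hj⟩

end SmallCharts

/-! ### Hölder estimates for the functionals -/

section Estimates

variable {d : ℕ} {M : Type*} [TopologicalSpace M] [ChartedSpace (Coord d) M]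

lemma NikBound.neg {γ B : ℝ} {w : Coord d → ℝ} (h : NikBound γ w B) : NikBound γ (-w) B :=
  ⟨h.1.neg, fun k => (h.2 k).neg.congr' fun x => by simp only [fwdShift, Pi.neg_apply]; ring⟩

lemma nikBound_zero {γ B : ℝ} : NikBound γ (0 : Coord d → ℝ) B := by
  refine ⟨⟨aestronglyMeasurable_zero, by simp⟩, fun k => ?_⟩
  have h0 : fwdShift k (0 : Coord d → ℝ) = 0 := by ext; simp [fwdShift]
  rw [h0]
  exact ⟨aestronglyMeasurable_zero, by simp⟩

/-- Differences of order min(‖k‖, ‖h‖) are of order ‖h‖^s ‖k‖^{1-s}: the interpolation inequality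
with t = 0. -/
lemma nikBound_of_lipschitz_shift {w : Coord d → ℝ} {s C R N : ℝ} {h : Coord d} (hs0 : 0 < s)
    (hs1 : s < 1) (hC : 0 ≤ C) (hN : 0 ≤ N) (hR : 1 ≤ R) (h0 : h ≠ 0) (hh : ‖h‖ ≤ R)
    (h1 : L2Le w (C * ‖h‖ * N)) (h2 : ∀ k, L2Le (fwdShift k w) (C * ‖k‖ * N)) :
    NikBound (1 - s) w (2 * C * R * N * ‖h‖ ^ s) := by
  have hh0 : 0 < ‖h‖ := norm_pos_iff.2 h0
  have hCN : 0 ≤ C * N := by positivity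
  constructor
  · refine h1.mono ?_
    have e : ‖h‖ ≤ R * ‖h‖ ^ s := by
      calc ‖h‖ = ‖h‖ ^ (1 - s) * ‖h‖ ^ s := by rw [← Real.rpow_add hh0]; simp
        _ ≤ R * ‖h‖ ^ s := by
          gcongr
          calc ‖h‖ ^ (1 - s) ≤ R ^ (1 - s) := by gcongr
            _ ≤ R ^ (1 : ℝ) := Real.rpow_le_rpow_of_exponent_le hR (by linarith)
            _ = R := Real.rpow_one R
    have : 0 ≤ C * N * (R * ‖h‖ ^ s) := by positivity
    nlinarith [mul_le_mul_of_nonneg_left e hCN]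
  · intro k
    rcases eq_or_ne k 0 with rfl | hk
    · rw [fwdShift_zero]
      exact ⟨aestronglyMeasurable_zero, by simp⟩
    have hk0 : 0 < ‖k‖ := norm_pos_iff.2 hk
    have h3 := (h2 k).min (h1.fwd (by positivity) k)
    refine h3.mono ?_
    have key := le_rpow_mul_rpow_of_le (X := min (C * ‖k‖ * N) (2 * (C * ‖h‖ * N)))
      (N := 2 * C * N) (a := ‖k‖) (b := ‖h‖) (s := s) (t := 0) (by positivity) hk0 hh0 hs0.le
      (by linarith) ((min_le_left _ _).trans ?_) ((min_le_right _ _).trans ?_)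
    · refine key.trans ?_
      rw [add_zero]
      calc 2 * C * N * ‖h‖ ^ s * ‖k‖ ^ (1 - s) = 1 * (2 * C * N * ‖h‖ ^ s * ‖k‖ ^ (1 - s)) := by ring
        _ ≤ R * (2 * C * N * ‖h‖ ^ s * ‖k‖ ^ (1 - s)) := by gcongr
        _ = _ := by ring
    · rw [Real.rpow_zero, mul_one]
      have : 0 ≤ C * ‖k‖ * N := by positivity
      linarith
    · rw [Real.rpow_zero, mul_one]
      linarith

/-- A permitted shift keeps the support inside a bounded chart. For an empty support `chartDist` is
infinite and h is unrestricted, hence the condition of nonemptiness. -/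
lemma exists_norm_bound_of_lt_chartDist {e : Chart d M} (he : Bornology.IsBounded e.target)
    {φ : M → ℝ} (hφs : tsupport φ ⊆ e.source) :
    ∃ R : ℝ, 1 ≤ R ∧ ∀ h : Coord d, ‖h‖ₑ < chartDist e φ → (tsupport φ).Nonempty → ‖h‖ ≤ R := by
  refine ⟨max 1 (Metric.diam e.target), le_max_left _ _, fun h hh ⟨x, hx⟩ => ?_⟩
  have h1 : e x + h ∈ e.target := add_mem_target hφs hh ⟨x, hx, rfl⟩
  have h2 := Metric.dist_le_diam_of_mem he h1 (e.map_source (hφs hx))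
  rw [dist_eq_norm, add_sub_cancel_left] at h2
  exact h2.trans (le_max_right _ _)

lemma shiftExt_zero_shift (e : Chart d M) (φ u : M → ℝ) : shiftExt e φ u 0 = 0 := by
  rw [shiftExt, fwdShift_zero, mul_zero]

variable [MeasurableSpace M] [CompactSpace M]

/-- Each ψ_i z is estimated by transfer to the i-th chart; the factor 2 accounts for the two parts
of the norm. -/
lemma exists_norm_le_of_nikBound (g : RiemMetric d M) (A : FiniteAtlas d M) (Ω : Set M)
    {e : Chart d M} (he : e ∈ c11Charts d M) {φ : M → ℝ} (hφs : tsupport φ ⊆ e.source) {γ : ℝ}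
    (hγ0 : 0 < γ) (hγ1 : γ < 1) :
    ∃ D : ℝ, 0 ≤ D ∧ ∀ (z : nikTildeZero g A γ Ω) (w : Coord d → ℝ) (B : ℝ), 0 ≤ B →
      (∀ x ∉ tsupport φ, z.1 x = 0) → (∀ x ∈ e.source, z.1 x = w (e x)) → NikBound γ w B →
        ‖NikTildeZero.of g A γ Ω z‖ ≤ D * B := by
  choose D hD0 hD using fun i => exists_nikBound_transfer he (A.chart_mem i) hφs (A.ψ_c11 i)
    (A.subordinate i) hγ0 hγ1
  refine ⟨∑ i, 2 * D i, Finset.sum_nonneg fun i _ => by have := hD0 i; positivity,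
    fun z w B hB h1 h2 h3 => ?_⟩
  rw [NikTildeZero.norm_def, Finset.sum_mul]
  refine Finset.sum_le_sum fun i _ => ?_
  have h4 : NikBound γ (A.piece i z.1) (D i * B) := hD i z.1 w B hB h1 h2 h3
  have h5 : 0 ≤ D i * B := mul_nonneg (hD0 i) hB
  refine ENNReal.toReal_le_of_le_ofReal (by linarith) ?_
  refine (nikNorm_le_ofReal h5 h5 h4.1 fun k _ => h4.2 k).trans (ENNReal.ofReal_le_ofReal ?_)
  linarith

/-- Hölder estimates of `τ(f, ·)` follow from estimates of the shifts in the charts. -/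
lemma exists_abs_tauDual_le (g : RiemMetric d M) (A : FiniteAtlas d M) (Ω : Set M)
    {e : Chart d M} (he : e ∈ c11Charts d M) (heb : Bornology.IsBounded e.target) {φ : M → ℝ}
    (hφs : tsupport φ ⊆ e.source) {s σ : ℝ} (hs0 : 0 < s) (hs1 : s < 1)
    {H : Set (M → ℝ)} {nrm : (M → ℝ) → ℝ} (hn : ∀ u, 0 ≤ nrm u)
    (hest : ∀ R : ℝ, 1 ≤ R → ∃ C : ℝ, 0 ≤ C ∧ ∀ u ∈ H, ∀ h : Coord d, h ≠ 0 → ‖h‖ ≤ R →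
      ‖h‖ₑ < chartDist e φ → NikBound (1 - s) (shiftExt e φ u h) (C * nrm u * ‖h‖ ^ σ)) :
    ∃ K : ℝ≥0, ∀ f : StrongDual ℝ (NikTildeZero g A (1 - s) Ω), ∀ u ∈ H, ∀ h : Coord d,
      ‖h‖ₑ < chartDist e φ → shiftDiff e φ u h ∈ H →
        ∀ hz : shiftDiff e φ u h ∈ (tauDual g A (1 - s) Ω f).domain,
          |tauDual g A (1 - s) Ω f ⟨shiftDiff e φ u h, hz⟩| ≤ K * ‖f‖ * nrm u * ‖h‖ ^ σ := by
  obtain ⟨R, hR, hRh⟩ := exists_norm_bound_of_lt_chartDist heb hφs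
  obtain ⟨C, hC, hCb⟩ := hest R hR
  obtain ⟨D, hD, hDb⟩ := exists_norm_le_of_nikBound g A Ω he hφs (γ := 1 - s) (by linarith)
    (by linarith)
  refine ⟨(D * C).toNNReal, fun f u hu h hh _ hz => ?_⟩
  -- The cases h = 0 and φ = 0, in which the difference vanishes, are not covered by the assumed
  -- estimate.
  have hw : NikBound (1 - s) (shiftExt e φ u h) (C * nrm u * ‖h‖ ^ σ) := by
    by_cases h0 : h = 0
    · rw [h0, shiftExt_zero_shift]; exact nikBound_zero
    by_cases hne : (tsupport φ).Nonempty
    · exact hCb u hu h h0 (hRh h hh hne) hh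
    · have : shiftExt e φ u h = 0 := by
        ext y
        exact shiftExt_eq_zero u h fun ⟨x, hx, _⟩ => hne ⟨x, hx⟩
      rw [this]; exact nikBound_zero
  have hB : 0 ≤ C * nrm u * ‖h‖ ^ σ := by have := hn u; positivity
  have hnorm := hDb ⟨shiftDiff e φ u h, hz⟩ (-shiftExt e φ u h) _ hB
    (fun x hx => shiftDiff_eq_zero e u h hx) (fun x hx => shiftDiff_eq hφs u hh hx) hw.neg
  calc |tauDual g A (1 - s) Ω f ⟨shiftDiff e φ u h, hz⟩|
      ≤ ‖f‖ * ‖NikTildeZero.of g A (1 - s) Ω ⟨shiftDiff e φ u h, hz⟩‖ := f.le_opNorm _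
    _ ≤ ‖f‖ * (D * (C * nrm u * ‖h‖ ^ σ)) := by gcongr
    _ = _ := by rw [Real.coe_toNNReal _ (mul_nonneg hD hC)]; ring

/-- In the small chart u equals β ψ_j u with β a reciprocal of ψ_j. The support of φ and its
translate by h stay in that chart, so u may be replaced there by a function with `DiffBound` on all
of ℝ^d. -/
lemma exists_nikBound_shiftExt_of_nikTildeOne (g : RiemMetric d M) (A : FiniteAtlas d M)
    (Ω : Set M) (j : Fin A.n) {φ : M → ℝ} (hφ : IsC11Function d φ)
    (hφs : tsupport φ ⊆ (smallChart A j).source) {s t : ℝ} (hs0 : 0 < s) (hs1 : s < 1)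
    (ht0 : 0 < t) (hst : s + t ≤ 1) {R : ℝ} (hR : 1 ≤ R) :
    ∃ C : ℝ, 0 ≤ C ∧ ∀ u ∈ nikTildeOne g A t Ω, ∀ h : Coord d, h ≠ 0 → ‖h‖ ≤ R →
      ‖h‖ₑ < chartDist (smallChart A j) φ →
        NikBound (1 - s) (shiftExt (smallChart A j) φ u h)
          (C * nikTildeOneNorm A t u * ‖h‖ ^ (s + t)) := by
  set e := smallChart A j with he_def
  have he : e ∈ c11Charts d M := smallChart_mem A j
  obtain ⟨c, hc⟩ := (compactC11_chartExt he hφ hφs).exists_mult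
  have hc0 := hc.nonneg
  have hn : (0 : ℝ) ≤ A.n := Nat.cast_nonneg _
  obtain ⟨β, hβ, hβχ⟩ := (compactC11_chartExt (A.chart_mem j) (A.ψ_c11 j)
    (A.subordinate j)).exists_inv (c := 1 / (2 * (A.n + 1 : ℝ))) (by positivity)
    ((div_lt_one (by positivity)).2 (by linarith))
  obtain ⟨b, hb⟩ := hβ.exists_mult
  have hb0 := hb.nonneg
  -- Here d + 1 comes from the differences of ψ_j u, 7b from multiplication by β, and 3cR from the
  -- Euclidean estimate.
  refine ⟨3 * c * R * (7 * b * (d + 1)), by positivity, fun u hu h h0 hhR hh => ?_⟩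
  set N := (nikNormOne t (A.piece j u)).toReal with hN_def
  have hN : 0 ≤ N := ENNReal.toReal_nonneg
  have hNle : N ≤ nikTildeOneNorm A t u :=
    Finset.single_le_sum (f := fun i => (nikNormOne t (A.piece i u)).toReal)
      (fun _ _ => ENNReal.toReal_nonneg) (Finset.mem_univ j)
  have hv := (MemNikOne.diffBound (hu.2.2 j)).mul (β := β) (by positivity) ht0.le
    (by linarith) hb
  have hU : ∀ y ∈ e.target, (β * A.piece j u) y = chartExt e u y := by
    intro y hy
    have hyκ : y ∈ (A.chart j).target := smallChart_target_subset A j hy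
    have h1 := hβχ y (lt_of_mem_smallChart_target A j hy).le (by
      rw [chartExt, indicator_of_mem hyκ]; exact A.ψ.le_one j _)
    rw [chartExt, indicator_of_mem hyκ] at h1
    rw [chartExt, indicator_of_mem hy, Pi.mul_apply, FiniteAtlas.piece, indicator_of_mem hyκ,
      ← mul_assoc]
    simp only [Function.comp_apply] at h1 ⊢
    rw [h1, one_mul]
    rfl
  have hsh : shiftExt e φ u h = chartExt e φ * fwdShift h (β * A.piece j u) := by
    ext y
    by_cases hy : y ∈ e '' tsupport φ
    · rw [shiftExt, Pi.mul_apply, Pi.mul_apply, fwdShift, fwdShift,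
        hU _ (add_mem_target hφs hh hy), hU _ (chart_image_subset_target hφs hy)]
    · rw [shiftExt_eq_zero u h hy, Pi.mul_apply, chartExt_eq_zero hy, zero_mul]
  rw [hsh]
  have hfin := hv.nikBound_mul_fwdShift (by positivity) ht0.le hs0 hs1 hst hc.toLipMult hR h0 hhR
  have hle : 3 * c * R * (7 * b * ((d + 1) * N)) * ‖h‖ ^ (s + t) ≤
      3 * c * R * (7 * b * (d + 1)) * nikTildeOneNorm A t u * ‖h‖ ^ (s + t) := by
    calc _ = 3 * c * R * (7 * b * (d + 1)) * N * ‖h‖ ^ (s + t) := by ring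
      _ ≤ _ := by gcongr
  refine ⟨hfin.1.mono hle, fun k => (hfin.2 k).mono ?_⟩
  gcongr

end Estimates

/-! ### The form of a square integrable function -/

section L2

lemma abs_integral_mul_le_norm_mul {X : Type*} [MeasurableSpace X] {ν : Measure X}
    (f : Lp ℝ 2 ν) {z : X → ℝ} (hz : MemLp z 2 ν) {a : ℝ} (ha : 0 ≤ a)
    (h : eLpNorm z 2 ν ≤ ENNReal.ofReal a) : |∫ x, f x * z x ∂ν| ≤ ‖f‖ * a := by
  have h1 : ∫ x, f x * z x ∂ν = inner ℝ f (hz.toLp z) := by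
    rw [L2.inner_def]
    refine integral_congr_ae ?_
    filter_upwards [hz.coeFn_toLp] with x hx
    rw [hx]
    simp [mul_comm]
  rw [h1]
  refine (abs_real_inner_le_norm _ _).trans ?_
  gcongr
  rw [Lp.norm_toLp]
  exact ENNReal.toReal_le_of_le_ofReal ha h

variable {d : ℕ} {M : Type*} [TopologicalSpace M] [ChartedSpace (Coord d) M] [MeasurableSpace M]
  [BorelSpace M] [T2Space M] [CompactSpace M]

/-- The difference lives on the compact support of φ, where the volume is dominated by Lebesgue
measure. -/
lemma exists_eLpNorm_shiftDiff_le (g : RiemMetric d M) {e : Chart d M} (he : e ∈ c11Charts d M)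
    {φ : M → ℝ} (hφs : tsupport φ ⊆ e.source) :
    ∃ D : ℝ, 0 ≤ D ∧ ∀ (u : M → ℝ) (h : Coord d) (a : ℝ), 0 ≤ a → ‖h‖ₑ < chartDist e φ →
      AEStronglyMeasurable (shiftDiff e φ u h) g.vol → L2Le (shiftExt e φ u h) a →
        eLpNorm (shiftDiff e φ u h) 2 g.vol ≤ ENNReal.ofReal (D * a) := by
  obtain ⟨C, hC⟩ := exists_lintegral_vol_le g he (isClosed_tsupport φ).isCompact hφs
  refine ⟨√C, Real.sqrt_nonneg _, fun u h a ha hh hm hw => ?_⟩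
  rw [eLpNorm_two_le_iff]
  have hK : MeasurableSet (e '' tsupport φ) :=
    (isCompact_chart_image (isClosed_tsupport φ).isCompact hφs).measurableSet
  calc ∫⁻ x, ‖shiftDiff e φ u h x‖ₑ ^ 2 ∂g.vol
      ≤ C * ∫⁻ y in e '' tsupport φ, ‖shiftDiff e φ u h (e.symm y)‖ₑ ^ 2 :=
        hC _ (hm.enorm.pow_const 2) fun x hx => by simp [shiftDiff_eq_zero e u h hx]
    _ = C * ∫⁻ y in e '' tsupport φ, ‖shiftExt e φ u h y‖ₑ ^ 2 := by
        congr 1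
        refine setLIntegral_congr_fun hK ?_
        rintro _ ⟨x, hx, rfl⟩
        simp only
        rw [e.left_inv (hφs hx), shiftDiff_eq hφs u hh (hφs hx), enorm_neg]
    _ ≤ C * ENNReal.ofReal a ^ 2 := by
        gcongr
        exact (setLIntegral_le_lintegral _ _).trans (eLpNorm_two_le_iff.1 hw.2)
    _ = ENNReal.ofReal (√C * a) ^ 2 := by
        rw [ENNReal.ofReal_mul (Real.sqrt_nonneg _), mul_pow,
          ← ENNReal.ofReal_pow (Real.sqrt_nonneg _), Real.sq_sqrt C.coe_nonneg,
          ENNReal.ofReal_coe_nnreal]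

/-- The constant is chosen for each chart and cut-off function before f, which gives uniformity in
f. -/
lemma exists_isHolderForm (g : RiemMetric d M) {Ω : Set M} {𝒰 : Set (Chart d M)} {γ : ℝ}
    {H : Set (M → ℝ)} {nrm : (M → ℝ) → ℝ} {ι : Type*} {ζ : ι → (M → ℝ) →ₗ.[ℝ] ℝ} {Cζ : ι → ℝ}
    (h1 : ∀ f, H ⊆ (ζ f).domain) (h2 : ∀ f, ∀ v ∈ (ζ f).domain, IntegrableOn v Ω g.vol)
    (h3 : ∀ e ∈ 𝒰, ∀ φ : M → ℝ, IsC11Function d φ → tsupport φ ⊆ e.source → ∃ K : ℝ≥0, ∀ f,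
      ∀ u ∈ H, ∀ h : Coord d, ‖h‖ₑ < chartDist e φ → shiftDiff e φ u h ∈ H →
        ∀ hz : shiftDiff e φ u h ∈ (ζ f).domain,
          |ζ f ⟨shiftDiff e φ u h, hz⟩| ≤ K * Cζ f * nrm u * ‖h‖ ^ γ) :
    ∃ K : Chart d M → (M → ℝ) → ℝ≥0, ∀ f, IsHolderForm g Ω 𝒰 K γ H nrm (ζ f) (Cζ f) := by
  choose! K hK using h3
  exact ⟨K, fun f => ⟨h1 f, h2 f, fun e he φ hφ hφs => hK e he φ hφ hφs f⟩⟩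

end L2

/-! ### The three claims -/

theorem mainTheorem7 {d : ℕ} {M : Type*} [TopologicalSpace M] [T2Space M] [CompactSpace M]
    [ChartedSpace (Coord d) M] [MeasurableSpace M] [BorelSpace M]
    (hM : IsC11Manifold d M) (g : RiemMetric d M) (A : FiniteAtlas d M)
    (Ω : Set M) (hΩ : IsOpen Ω) :
    ∃ 𝒰 : Set (Chart d M), IsC11Atlas 𝒰 ∧
      (∀ s : ℝ, 0 < s → s < 1 →
        (∀ t : ℝ, 0 < t → s + t ≤ 1 →
          ∃ K : Chart d M → (M → ℝ) → ℝ≥0,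
            ∀ f : StrongDual ℝ (NikTildeZero g A (1 - s) Ω),
              IsHolderForm g Ω 𝒰 K (s + t) (nikTildeOne g A t Ω) (nikTildeOneNorm A t)
                (tauDual g A (1 - s) Ω f) ‖f‖) ∧
        (∃ K : Chart d M → (M → ℝ) → ℝ≥0,
          ∀ f : StrongDual ℝ (NikTildeZero g A (1 - s) Ω),
            IsHolderForm g Ω 𝒰 K s (g.H10 Ω) (g.h10Norm Ω)
              (tauDual g A (1 - s) Ω f) ‖f‖)) ∧
      (∃ K : Chart d M → (M → ℝ) → ℝ≥0,
        ∀ f : Lp ℝ 2 (g.vol.restrict Ω),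
          IsHolderForm g Ω 𝒰 K 1 (g.H10 Ω) (g.h10Norm Ω) (tauL2 g Ω f) ‖f‖) := by
  have hfin := isFiniteMeasure_vol g A
  have hKc : ∀ j, IsCompact (A.chart j '' tsupport (A.ψ j)) := fun j =>
    isCompact_chart_image (isClosed_tsupport _).isCompact (A.subordinate j)
  have hbdd : ∀ j, Bornology.IsBounded (smallChart A j).target := fun j =>
    (hKc j).isBounded.subset (smallChart_target_subset_image A j)
  have hH10 : ∀ j, ∀ φ : M → ℝ, IsC11Function d φ → tsupport φ ⊆ (smallChart A j).source → _ :=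
    fun j φ hφ hφs => exists_l2Le_shiftExt_of_mem_H10 g hM A hΩ (smallChart_mem A j)
      (A.chart_mem j) (coe_smallChart_symm A j) (hKc j) (smallChart_target_subset_image A j)
      (chart_image_subset_target (A.subordinate j)) hφ hφs
  have hint : ∀ v : M → ℝ, MemLp v 2 g.vol → IntegrableOn v Ω g.vol := fun v hv =>
    (hv.integrable (by norm_num)).integrableOn
  -- The atlas depends on the partition of unity only, so it is fixed before s, t and f.
  refine ⟨range (smallChart A), isC11Atlas_smallChart A, fun s hs0 hs1 =>
    ⟨fun t ht0 hst => ?_, ?_⟩, ?_⟩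
  · refine exists_isHolderForm g (fun f u hu => mem_nikTildeZero_of_mem_nikTildeOne g A
      (by linarith) (by linarith) hu) (fun f v hv => hint v hv.1) ?_
    rintro _ ⟨j, rfl⟩ φ hφ hφs
    exact exists_abs_tauDual_le g A Ω (smallChart_mem A j) (hbdd j) hφs hs0 hs1
      (fun u => Finset.sum_nonneg fun _ _ => ENNReal.toReal_nonneg)
      fun R hR => exists_nikBound_shiftExt_of_nikTildeOne g A Ω j hφ hφs hs0 hs1 ht0 hst hR
  · refine exists_isHolderForm g (fun f u hu => mem_nikTildeZero_of_mem_H10 g hM A hΩ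
      (by linarith) (by linarith) hu) (fun f v hv => hint v hv.1) ?_
    rintro _ ⟨j, rfl⟩ φ hφ hφs
    refine exists_abs_tauDual_le g A Ω (smallChart_mem A j) (hbdd j) hφs hs0 hs1
      (fun u => Real.sqrt_nonneg _) fun R hR => ?_
    obtain ⟨C, hC, hCb⟩ := hH10 j φ hφ hφs
    refine ⟨2 * C * R, by positivity, fun u hu h h0 hhR hh => ?_⟩
    obtain ⟨h1, h2⟩ := hCb u hu h hh
    exact nikBound_of_lipschitz_shift hs0 hs1 hC (Real.sqrt_nonneg _) hR h0 hhR h1 h2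
  · refine exists_isHolderForm g (fun f u hu => hu.1.restrict Ω) (fun f v hv =>
      MemLp.integrable (q := 2) (by norm_num) hv) ?_
    rintro _ ⟨j, rfl⟩ φ hφ hφs
    obtain ⟨C, hC, hCb⟩ := hH10 j φ hφ hφs
    obtain ⟨D, hD, hDb⟩ := exists_eLpNorm_shiftDiff_le g (smallChart_mem A j) hφs
    refine ⟨(D * C).toNNReal, fun f u hu h hh hzH hz => ?_⟩
    have hN : 0 ≤ g.h10Norm Ω u := Real.sqrt_nonneg _
    -- Order 1 needs only the L_2 bound of the difference; its measurability comes from the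
    -- assumption that it lies in H̊¹(Ω).
    have h1 := hDb u h _ (by positivity) hh hzH.1.1 (hCb u hu h hh).1
    calc |tauL2 g Ω f ⟨shiftDiff (smallChart A j) φ u h, hz⟩|
        ≤ ‖f‖ * (D * (C * ‖h‖ * g.h10Norm Ω u)) :=
          abs_integral_mul_le_norm_mul f hz (by positivity)
            ((eLpNorm_mono_measure _ Measure.restrict_le_self).trans h1)
      _ = _ := by rw [Real.rpow_one, Real.coe_toNNReal _ (mul_nonneg hD hC)]; ring
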